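/- Let $G$ be a finite simple 3-connected cubic planar graph, embedded on the sphere; the facial walks of this embedding are the faces of $G$, two faces are called neighbouring if they are distinct and share an edge, and $G^{\ast}$ is the dual graph, whose vertices are the faces and whose edges join neighbouring faces. Embeddings of $G$ are cellular and are described by a rotation system together with a set of twisted edges. A subgraph $H$ of $G^{\ast}$ defines the embedding $\beta_H$ of $G$ that has the rotation system of the spherical embedding and whose twisted edges are exactly the edges of $G$ dual to the edges of $H$. For a set $S$ of faces let $H_S$ be the subgraph of $G^{\ast}$ whose vertices are the faces outside $S$ that have a neighbour in $S$, and whose edges are the pairs $\{g,h\}$ of neighbouring faces outside $S$ for which some $f\in S$ forms a triangle with $g$ and $h$ in $G^{\ast}$ such that $f,g,h$ share a vertex of $G$. (For $S=\{f\}$ this is the cycle through the neighbours of $f$ in their cyclic order around $f$.) The embedding induced by $S$ is $\beta_{H_S}$. An embedding is strong if every facial walk is a cycle, and two strong embeddings of $G$ are isomorphic if some automorphism of $G$ maps the set of facial cycles of one onto that of the other. $G$ is cyclically $k$-edge connected if there is no set of at most $k-1$ edges whose deletion leaves two different connected components that both contain a cycle. 1) Suppose that $G$ is cyclically 4-edge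 connected. If $f$ is a face of length $2k$ with $k\ge 2$, then the embedding of $G$ induced by $\{f\}$ is strong and is an embedding on the orientable surface of genus $k-1$. For two faces $f,f'$ of even lengths at least $4$, the embeddings induced by $\{f\}$ and $\{f'\}$ are isomorphic if and only if $f$ and $f'$ lie in the same $\mathrm{Aut}(G)$-orbit. 2) Suppose that $G$ is cyclically 5-edge connected. If $f_1,f_2$ are neighbouring faces of lengths $2k+1$ and $2m+1$ with $k,m\ge 2$, then the embedding of $G$ induced by $\{f_1,f_2\}$ is strong and is an embedding on the orientable surface of genus $k+m-2$. For two pairs $\{f_1,f_2\}$ and $\{f_1',f_2'\}$ of neighbouring faces, all four of odd length at least $5$, the induced embeddings are isomorphic if and only if the two unordered pairs lie in the same $\mathrm{Aut}(G)$-orbit. -/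

import Mathlib

/-- `G` is `k`-connected: it has more than `k` vertices, and deleting fewer than `k` vertices
never disconnects it. -/
def SimpleGraph.IsKConnected {V : Type*} [Fintype V] (G : SimpleGraph V) (k : ℕ) : Prop :=
  k < Fintype.card V ∧
    ∀ S : Finset V, S.card < k → (G.induce {v : V | v ∉ S}).Connected

/-- `G` is cyclically `k`-edge connected: there is no set `A` of fewer than `k` edges such that
two different connected components of `G \ A` contain a cycle. -/
def SimpleGraph.IsCyclicallyEdgeConnected {V : Type*} (G : SimpleGraph V) (k : ℕ) : Prop :=
  ¬ ∃ A : Finset (Sym2 V), (A : Set (Sym2 V)) ⊆ G.edgeSet ∧ A.card < k ∧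
    ∃ (u v : V) (p : (G.deleteEdges (A : Set (Sym2 V))).Walk u u)
      (q : (G.deleteEdges (A : Set (Sym2 V))).Walk v v),
      p.IsCycle ∧ q.IsCycle ∧ ¬ (G.deleteEdges (A : Set (Sym2 V))).Reachable u v

/-- A (cellular) embedding of a graph `G` on a closed surface, given in the usual combinatorial
form by a rotation system and a signature.  The rotation system is the permutation `rot` of the
darts (oriented edges); it permutes the darts leaving each vertex cyclically.  The signature is
`sign`; the edges `e` with `sign e = -1` are the twisted edges. -/
structure SurfaceEmbedding {V : Type*} (G : SimpleGraph V) where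
  rot : Equiv.Perm G.Dart
  rot_fst : ∀ d : G.Dart, (rot d).fst = d.fst
  rot_cyclic : ∀ d d' : G.Dart, d.fst = d'.fst → rot.SameCycle d d'
  sign : G.edgeSet → ℤˣ

namespace SurfaceEmbedding

/-- The states of the face traversal algorithm: a dart about to be traversed together with the
current local orientation (`1`: clockwise, `-1`: anticlockwise). -/
abbrev Flag {V : Type*} {G : SimpleGraph V} (_E : SurfaceEmbedding G) : Type _ := G.Dart × ℤˣ

/-- The sign of the edge underlying a dart. -/
def dartSign {V : Type*} {G : SimpleGraph V} (E : SurfaceEmbedding G) (d : G.Dart) : ℤˣ :=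
  E.sign ⟨d.edge, d.edge_mem⟩

theorem dartSign_symm {V : Type*} {G : SimpleGraph V} (E : SurfaceEmbedding G) (d : G.Dart) :
    E.dartSign d.symm = E.dartSign d := by
  unfold dartSign
  congr 2
  exact d.edge_symm

/-- One step of face traversal: traverse the dart `d`, switch the local orientation if its edge is
twisted, and leave along the dart following `d.symm` in the rotation at the end vertex (in the
inverse rotation, if the current orientation is `-1`). -/
def step {V : Type*} {G : SimpleGraph V} (E : SurfaceEmbedding G) : Equiv.Perm E.Flag where
  toFun x := ((E.rot ^ ((x.2 * E.dartSign x.1 : ℤˣ) : ℤ)) x.1.symm, x.2 * E.dartSign x.1)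
  invFun y := (((E.rot ^ (-(y.2 : ℤ))) y.1).symm,
    y.2 * E.dartSign ((E.rot ^ (-(y.2 : ℤ))) y.1))
  left_inv x := by
    obtain ⟨d, s⟩ := x
    have h : (E.rot ^ (-((s * E.dartSign d : ℤˣ) : ℤ)))
        ((E.rot ^ ((s * E.dartSign d : ℤˣ) : ℤ)) d.symm) = d.symm := by
      rw [← Equiv.Perm.mul_apply, ← zpow_add]; simp
    simp only [h, SimpleGraph.Dart.symm_symm, dartSign_symm, mul_assoc, Int.units_mul_self,
      mul_one]
  right_inv y := by
    obtain ⟨d, s⟩ := y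
    simp only [SimpleGraph.Dart.symm_symm, dartSign_symm, mul_assoc, Int.units_mul_self, mul_one]
    rw [← Equiv.Perm.mul_apply, ← zpow_add]; simp

/-- The state obtained by running through the same edge side in the opposite direction. -/
def rev {V : Type*} {G : SimpleGraph V} (E : SurfaceEmbedding G) : Equiv.Perm E.Flag where
  toFun x := (x.1.symm, -(x.2 * E.dartSign x.1))
  invFun x := (x.1.symm, -(x.2 * E.dartSign x.1))
  left_inv x := by
    simp [dartSign_symm, mul_assoc, Int.units_mul_self]
  right_inv x := by
    simp [dartSign_symm, mul_assoc, Int.units_mul_self]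

theorem rev_mul_rev {V : Type*} {G : SimpleGraph V} (E : SurfaceEmbedding G) :
    E.rev * E.rev = 1 := by
  ext1 x
  exact E.rev.left_inv x

theorem rev_inv {V : Type*} {G : SimpleGraph V} (E : SurfaceEmbedding G) : E.rev⁻¹ = E.rev :=
  inv_eq_of_mul_eq_one_left E.rev_mul_rev

/-- Reversing direction conjugates face traversal to its inverse. -/
theorem rev_step_rev {V : Type*} {G : SimpleGraph V} (E : SurfaceEmbedding G) :
    E.rev * E.step * E.rev⁻¹ = E.step⁻¹ := by
  rw [eq_inv_iff_mul_eq_one, rev_inv]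
  ext1 x
  obtain ⟨d, s⟩ := x
  have h : (E.rot ^ (-((s * E.dartSign d : ℤˣ) : ℤ)))
      ((E.rot ^ ((s * E.dartSign d : ℤˣ) : ℤ)) d.symm) = d.symm := by
    rw [← Equiv.Perm.mul_apply, ← zpow_add]; simp
  simp only [Equiv.Perm.mul_apply, Equiv.Perm.one_apply, step, rev, Equiv.coe_fn_mk,
    dartSign_symm, SimpleGraph.Dart.symm_symm, mul_assoc, neg_mul, Int.units_mul_self, mul_one,
    Units.val_neg, neg_neg, h]

theorem rev_sameCycle {V : Type*} {G : SimpleGraph V} (E : SurfaceEmbedding G) {x y : E.Flag}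
    (h : E.step.SameCycle x y) : E.step.SameCycle (E.rev x) (E.rev y) := by
  rw [← Equiv.Perm.sameCycle_inv, ← E.rev_step_rev, Equiv.Perm.sameCycle_conj]
  simpa using h

/-- Two states belong to the same facial walk, up to its direction and its starting point. -/
def faceSetoid {V : Type*} {G : SimpleGraph V} (E : SurfaceEmbedding G) : Setoid E.Flag where
  r x y := E.step.SameCycle x y ∨ E.step.SameCycle (E.rev x) y
  iseqv := by
    have hrr : ∀ x, E.rev (E.rev x) = x := E.rev.left_inv
    refine ⟨fun x => Or.inl (Equiv.Perm.SameCycle.refl _ _), ?_, ?_⟩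
    · rintro x y (h | h)
      · exact Or.inl h.symm
      · refine Or.inr ?_
        have := E.rev_sameCycle h
        rw [hrr] at this
        exact this.symm
    · rintro x y z (h | h) (h' | h')
      · exact Or.inl (h.trans h')
      · exact Or.inr ((E.rev_sameCycle h).trans h')
      · exact Or.inr (h.trans h')
      · have := E.rev_sameCycle h
        rw [hrr] at this
        exact Or.inl (this.trans h')

/-- The faces (facial walks) of an embedding. -/
def Face {V : Type*} {G : SimpleGraph V} (E : SurfaceEmbedding G) : Type _ :=
  Quotient E.faceSetoid

/-- The face whose facial walk runs through the state `x`. -/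
def faceOf {V : Type*} {G : SimpleGraph V} (E : SurfaceEmbedding G) (x : E.Flag) : E.Face :=
  Quotient.mk E.faceSetoid x

/-- The length of the facial walk that starts in state `x`. -/
noncomputable def walkLength {V : Type*} {G : SimpleGraph V} (E : SurfaceEmbedding G)
    (x : E.Flag) : ℕ :=
  Function.minimalPeriod E.step x

/-- The list of darts traversed by the facial walk that starts in state `x`. -/
noncomputable def walkDarts {V : Type*} {G : SimpleGraph V} (E : SurfaceEmbedding G)
    (x : E.Flag) : List G.Dart :=
  (List.range (E.walkLength x)).map fun i => ((E.step ^ i) x).1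

theorem walkLength_congr {V : Type*} {G : SimpleGraph V} (E : SurfaceEmbedding G) (x y : E.Flag)
    (h : E.faceSetoid.r x y) : E.walkLength x = E.walkLength y := by
  have key : ∀ (n : ℕ) (z : E.Flag),
      Function.IsPeriodicPt E.step n z ↔ (E.step ^ n) z = z := by
    intro n z
    rw [Function.IsPeriodicPt, Function.IsFixedPt, Equiv.Perm.iterate_eq_pow]
  have h1 : ∀ x y, E.step.SameCycle x y → E.walkLength x = E.walkLength y := by
    rintro x y ⟨i, rfl⟩
    refine Function.minimalPeriod_eq_minimalPeriod_iff.2 fun n => ?_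
    rw [key, key, ← Equiv.Perm.mul_apply, ← zpow_natCast, ← zpow_add, add_comm, zpow_add,
      Equiv.Perm.mul_apply, EmbeddingLike.apply_eq_iff_eq]
  have h2 : ∀ x, E.walkLength (E.rev x) = E.walkLength x := by
    intro x
    refine Function.minimalPeriod_eq_minimalPeriod_iff.2 fun n => ?_
    have hc : E.step ^ n * E.rev = E.rev * (E.step ^ n)⁻¹ := by
      have := congrArg (· ^ n) E.rev_step_rev
      simp only [conj_pow, inv_pow] at this
      rw [← this, rev_inv]
      simp only [← mul_assoc, rev_mul_rev, one_mul]
    rw [key, key, ← Equiv.Perm.mul_apply, hc, Equiv.Perm.mul_apply,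
      EmbeddingLike.apply_eq_iff_eq, Equiv.Perm.inv_eq_iff_eq, eq_comm]
  rcases h with h | h
  · exact h1 _ _ h
  · rw [← h1 _ _ h, h2]

/-- The length of a face. -/
noncomputable def Face.length {V : Type*} {G : SimpleGraph V} {E : SurfaceEmbedding G}
    (f : E.Face) : ℕ :=
  Quotient.lift E.walkLength E.walkLength_congr f

/-- The set of edges of a face. -/
def Face.edges {V : Type*} {G : SimpleGraph V} {E : SurfaceEmbedding G} (f : E.Face) :
    Set (Sym2 V) :=
  {e | ∃ x : E.Flag, E.faceOf x = f ∧ x.1.edge = e}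

/-- The set of vertices of a face. -/
def Face.verts {V : Type*} {G : SimpleGraph V} {E : SurfaceEmbedding G} (f : E.Face) : Set V :=
  {v | ∃ x : E.Flag, E.faceOf x = f ∧ x.1.fst = v}

/-- The Euler characteristic of the surface on which a connected graph is embedded. -/
noncomputable def eulerChar {V : Type*} {G : SimpleGraph V} (E : SurfaceEmbedding G) : ℤ :=
  (Nat.card V : ℤ) - (Nat.card G.edgeSet : ℤ) + (Nat.card E.Face : ℤ)

/-- The surface is orientable: the signature becomes constantly `1` after reversing the rotation
at suitable vertices (equivalently, every cycle of `G` has an even number of twisted edges). -/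
def IsOrientable {V : Type*} {G : SimpleGraph V} (E : SurfaceEmbedding G) : Prop :=
  ∃ o : V → ℤˣ, ∀ d : G.Dart, E.dartSign d = o d.fst * o d.snd

/-- The surface is the orientable surface of genus `g`. -/
def IsOnOrientableSurface {V : Type*} {G : SimpleGraph V} (E : SurfaceEmbedding G) (g : ℕ) :
    Prop :=
  E.IsOrientable ∧ E.eulerChar = 2 - 2 * (g : ℤ)

/-- An embedding on the sphere, given by a rotation system without twisted edges. -/
def IsPlanar {V : Type*} {G : SimpleGraph V} (E : SurfaceEmbedding G) : Prop :=
  (∀ e, E.sign e = 1) ∧ E.eulerChar = 2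

/-- The embedding is strong: every facial walk is a cycle. -/
def IsStrong {V : Type*} {G : SimpleGraph V} (E : SurfaceEmbedding G) : Prop :=
  ∀ x : E.Flag, ∃ (v : V) (p : G.Walk v v), p.IsCycle ∧ p.darts = E.walkDarts x

/-- The facial cycles of a (strong) embedding, each given by its set of edges. -/
def facialCycles {V : Type*} {G : SimpleGraph V} (E : SurfaceEmbedding G) : Set (Set (Sym2 V)) :=
  Set.range (Face.edges (E := E))

/-- Two strong embeddings of `G` are isomorphic: some automorphism of `G` maps the set of facial
cycles of the first onto that of the second. -/
def Isomorphic {V : Type*} {G : SimpleGraph V} (E E' : SurfaceEmbedding G) : Prop :=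
  ∃ φ : G ≃g G, (fun C : Set (Sym2 V) => Sym2.map φ '' C) '' E.facialCycles = E'.facialCycles

/-- The automorphism `φ` of `G` maps the face `f` onto the face `f'`. -/
def MapsFace {V : Type*} {G : SimpleGraph V} {E : SurfaceEmbedding G} (φ : G ≃g G)
    (f f' : E.Face) : Prop :=
  Sym2.map φ '' f.edges = f'.edges

/-- Two faces lie in the same orbit of `Aut(G)`. -/
def SameOrbit {V : Type*} {G : SimpleGraph V} {E : SurfaceEmbedding G} (f f' : E.Face) : Prop :=
  ∃ φ : G ≃g G, MapsFace φ f f'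

/-- The unordered pairs `{f₁, f₂}` and `{f₁', f₂'}` of faces lie in the same orbit of `Aut(G)`. -/
def SamePairOrbit {V : Type*} {G : SimpleGraph V} {E : SurfaceEmbedding G}
    (f₁ f₂ f₁' f₂' : E.Face) : Prop :=
  ∃ φ : G ≃g G, (MapsFace φ f₁ f₁' ∧ MapsFace φ f₂ f₂') ∨ (MapsFace φ f₁ f₂' ∧ MapsFace φ f₂ f₁')

/-- The dual graph: its vertices are the faces; different faces that share an edge are
adjacent (neighbouring). -/
def dualGraph {V : Type*} {G : SimpleGraph V} (E : SurfaceEmbedding G) : SimpleGraph E.Face where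
  Adj f g := f ≠ g ∧ ∃ e, e ∈ f.edges ∧ e ∈ g.edges
  symm := ⟨fun _ _ ⟨hne, e, hf, hg⟩ => ⟨hne.symm, e, hg, hf⟩⟩
  loopless := ⟨fun _ h => h.1 rfl⟩

/-- The subgraph of the dual graph surrounding a set `S` of faces.  Its vertices are the faces
outside `S` that have a neighbour in `S`.  Its edges are the pairs of neighbouring faces outside
`S` that form, together with a face of `S`, a triangle of the dual graph around a vertex of `G`.
If `S` consists of a single face, these are the neighbours of that face with consecutive
neighbours joined. -/
def link {V : Type*} {G : SimpleGraph V} (E : SurfaceEmbedding G) (S : Set E.Face) :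
    E.dualGraph.Subgraph where
  verts := {g | g ∉ S ∧ ∃ f ∈ S, E.dualGraph.Adj f g}
  Adj g h := g ∉ S ∧ h ∉ S ∧ E.dualGraph.Adj g h ∧
    ∃ f ∈ S, E.dualGraph.Adj f g ∧ E.dualGraph.Adj f h ∧
      ∃ v, v ∈ f.verts ∧ v ∈ g.verts ∧ v ∈ h.verts
  adj_sub h := h.2.2.1
  edge_vert h := ⟨h.1, let ⟨f, hf, hfg, _⟩ := h.2.2.2; ⟨f, hf, hfg⟩⟩
  symm := ⟨fun _ _ ⟨hg, hh, hgh, f, hf, hfg, hfh, v, hvf, hvg, hvh⟩ =>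
    ⟨hh, hg, hgh.symm, f, hf, hfh, hfg, v, hvf, hvh, hvg⟩⟩

open Classical in
/-- The embedding defined by a twisted subgraph `H` of the dual graph: the rotation system is
kept, and the twisted edges are exactly the edges of `G` whose dual edge lies in `H`. -/
noncomputable def reembed {V : Type*} {G : SimpleGraph V} (E : SurfaceEmbedding G)
    (H : E.dualGraph.Subgraph) : SurfaceEmbedding G where
  rot := E.rot
  rot_fst := E.rot_fst
  rot_cyclic := E.rot_cyclic
  sign e := if ∃ f g : E.Face, H.Adj f g ∧ (e : Sym2 V) ∈ f.edges ∧ (e : Sym2 V) ∈ g.edges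
    then -1 else 1

end SurfaceEmbedding

open SimpleGraph

/-! Let the region of `S` be the set of vertices on faces of `S`, and the rim the set of faces
outside `S` that share an edge with a face of `S`. In the cases at hand the edges dual to the link
of `S` are exactly the edges between the region and its complement (`exists_link_adj_iff`). Twisting
the edges of a cut amounts to reversing the rotation on one side of it. So the induced embedding is
orientable, and its facial walks are the cycles of a permutation of darts (`isGauge_reembed_link`).

The new faces can be listed. Faces in `S` are traversed backwards and faces off the rim do not
change. A walk along a rim face, on reaching the region, crosses to the inner side of the border
edge of the next rim face and then continues along the rim face after that. If the cyclic sequence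
of rim faces has a proper 2-colouring, the whole rim is thus replaced by two faces, one for each
colour. The function `label` records this. It separates the two sides of every edge, so no walk uses
both sides and, the graph being cubic, every facial walk is a cycle. The number of faces drops by
|rim| - 2, which gives genus |rim|/2 - 1. The rim has 2k faces for one face of length 2k, and (2k+1)
+ (2m+1) - 4 faces for a pair: the common edge is lost on both sides, and the two faces at its ends
are counted twice.

Planarity enters as exactness over `ZMod 2` (`exists_potential`): an even set of dual edges is an
edge cut of the graph, and a cycle bounds. A cut with fewer edges than cyclic connectivity demands
has a side that is a forest, and in a cubic graph a forest with n vertices sends out at least n + 2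
edges (`exists_small_side`). Hence there are no dual cycles of length one or two, dual triangles
surround vertices, and dual 4-cycles have chords if the graph is cyclically 5-edge connected.

For the classification, the facial cycles of a strong embedding determine its twisted edges relative
to the spherical rotation (`straight_iff`), and automorphisms respect that rotation up to reflection
(Whitney's theorem, `eq_or_eq_symm`). An isomorphism therefore carries one cut to the other, so one
region goes to the other or to its complement. For single faces the complementary case yields an
automorphism exchanging the two faces (`exists_swap`). For pairs it cannot occur (`not_compl`). -/

namespace CubicMap

/-! ### Exactness over `ZMod 2` from a rank count -/

section Homology

variable {V : Type*} {G : SimpleGraph V}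

open Classical in
/-- The incidence matrix over `ZMod 2` between edges and the classes of darts given by `q`. -/
noncomputable def dartMatrix [Fintype G.Dart] {Q : Type*} (q : G.Dart → Q) :
    Matrix G.edgeSet Q (ZMod 2) :=
  fun e x => ∑ d : G.Dart, if d.edge = e ∧ q d = x then 1 else 0

theorem dartMatrix_mulVec [Fintype G.Dart] {Q : Type*} [Fintype Q] (q : G.Dart → Q)
    (p : Q → ZMod 2) (d : G.Dart) :
    (dartMatrix q).mulVec p ⟨d.edge, d.edge_mem⟩ = p (q d) + p (q d.symm) := by
  classical
  have h : (dartMatrix q).mulVec p ⟨d.edge, d.edge_mem⟩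
      = ∑ d' : G.Dart, if d'.edge = d.edge then p (q d') else 0 := by
    simp only [Matrix.mulVec, dotProduct, dartMatrix, Finset.sum_mul]
    rw [Finset.sum_comm]
    refine Finset.sum_congr rfl fun d' _ => ?_
    by_cases hd : d'.edge = d.edge <;> simp [hd]
  rw [h, ← Finset.sum_filter]
  have : (Finset.univ.filter fun d' : G.Dart => d'.edge = d.edge) = {d, d.symm} :=
    Finset.ext fun d' => by simpa using dart_edge_eq_iff d' d
  rw [this, Finset.sum_pair d.symm_ne.symm]

theorem dartMatrix_transpose_mulVec [Fintype G.Dart] [Fintype G.edgeSet] {Q : Type*}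
    [DecidableEq Q] (q : G.Dart → Q) (c : G.edgeSet → ZMod 2) (x : Q) :
    (dartMatrix q).transpose.mulVec c x
      = ∑ d : G.Dart with q d = x, c ⟨d.edge, d.edge_mem⟩ := by
  classical
  simp only [Matrix.mulVec, dotProduct, dartMatrix, Matrix.transpose_apply, Finset.sum_mul]
  rw [Finset.sum_comm, Finset.sum_filter]
  refine Finset.sum_congr rfl fun d _ => ?_
  rw [Finset.sum_eq_single (⟨d.edge, d.edge_mem⟩ : G.edgeSet)]
  · by_cases hd : q d = x <;> simp [hd]
  · rintro ⟨e, he⟩ - hne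
    have : ¬ d.edge = e := fun h => hne (by simp [h])
    simp [this]
  · simp

/-- By connectedness, the kernel of the incidence matrix consists of constant functions, so its
dimension is at most one. -/
theorem card_le_rank_add_one [Fintype G.Dart] [Fintype G.edgeSet] {Q : Type*} [Fintype Q]
    (q : G.Dart → Q)
    (h : ∀ p : Q → ZMod 2, (∀ d, p (q d) = p (q d.symm)) → ∀ x y, p x = p y) :
    Fintype.card Q ≤ (dartMatrix q).rank + 1 := by
  classical
  have h1 := LinearMap.finrank_range_add_finrank_ker (dartMatrix q).mulVecLin
  rw [Module.finrank_fintype_fun_eq_card] at h1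
  have h2 : Module.finrank (ZMod 2) (LinearMap.ker (dartMatrix q).mulVecLin) ≤ 1 := by
    have hle : LinearMap.ker (dartMatrix q).mulVecLin
        ≤ Submodule.span (ZMod 2) {fun _ : Q => (1 : ZMod 2)} := by
      intro p hp
      have hp' : (dartMatrix q).mulVec p = 0 := hp
      have hc := h p fun d => by
        have := congrFun hp' ⟨d.edge, d.edge_mem⟩
        rw [dartMatrix_mulVec, Pi.zero_apply] at this
        exact CharTwo.add_eq_zero.1 this
      rw [Submodule.mem_span_singleton]
      rcases isEmpty_or_nonempty Q with hQ | ⟨⟨x⟩⟩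
      · exact ⟨0, Subsingleton.elim _ _⟩
      · exact ⟨p x, funext fun y => by simp [hc y x]⟩
    exact (Submodule.finrank_mono hle).trans ((finrank_span_le_card _).trans (by simp))
  rw [Matrix.rank]
  omega

/-- Exactness over `ZMod 2`: if two systems of dart classes are orthogonal, connected and numerous
enough, then a function on edges with vanishing sums over the classes of the second kind is a
coboundary for the first kind. -/
theorem exists_potential [Fintype G.Dart] [Finite V] {Q₁ Q₂ : Type*} [Fintype Q₁] [Fintype Q₂]
    [DecidableEq Q₂]
    (q₁ : G.Dart → Q₁) (q₂ : G.Dart → Q₂)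
    (h₁ : ∀ p : Q₁ → ZMod 2, (∀ d, p (q₁ d) = p (q₁ d.symm)) → ∀ x y, p x = p y)
    (h₂ : ∀ p : Q₂ → ZMod 2, (∀ d, p (q₂ d) = p (q₂ d.symm)) → ∀ x y, p x = p y)
    (horth : ∀ (p : Q₁ → ZMod 2) (x : Q₂),
      ∑ d with q₂ d = x, (p (q₁ d) + p (q₁ d.symm)) = 0)
    (hcard : Fintype.card Q₁ + Fintype.card Q₂ = Nat.card G.edgeSet + 2)
    (c : G.Dart → ZMod 2) (hc : ∀ d, c d.symm = c d)
    (hsum : ∀ x, ∑ d with q₂ d = x, c d = 0) :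
    ∃ p : Q₁ → ZMod 2, ∀ d, c d = p (q₁ d) + p (q₁ d.symm) := by
  classical
  let _ : Fintype G.edgeSet := Fintype.ofFinite _
  have hE : ∀ e : G.edgeSet, ∃ d : G.Dart, d.edge = e := by
    rintro ⟨⟨u, v⟩, he⟩
    exact ⟨⟨(u, v), he⟩, rfl⟩
  choose δ hδ using hE
  have hc' : ∀ d, c (δ ⟨d.edge, d.edge_mem⟩) = c d := by
    intro d
    rcases (dart_edge_eq_iff _ _).1 (hδ ⟨d.edge, d.edge_mem⟩) with h | h <;> rw [h]
    exact hc d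
  have hle : LinearMap.range (dartMatrix q₁).mulVecLin
      ≤ LinearMap.ker (dartMatrix q₂).transpose.mulVecLin := by
    rintro _ ⟨p, rfl⟩
    refine LinearMap.mem_ker.2 (funext fun x => ?_)
    simp only [Matrix.mulVecLin_apply, dartMatrix_transpose_mulVec, dartMatrix_mulVec]
    exact horth p x
  -- The kernel has dimension |E| - rank₂ ≤ |E| - |Q₂| + 1 = |Q₁| - 1 ≤ rank₁, so the inclusion of
  -- the image in the kernel is an equality.
  have hfin : Module.finrank (ZMod 2) (LinearMap.ker (dartMatrix q₂).transpose.mulVecLin)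
      ≤ Module.finrank (ZMod 2) (LinearMap.range (dartMatrix q₁).mulVecLin) := by
    have e1 := LinearMap.finrank_range_add_finrank_ker (dartMatrix q₂).transpose.mulVecLin
    rw [Module.finrank_fintype_fun_eq_card] at e1
    have e2 := card_le_rank_add_one q₁ h₁
    have e3 := card_le_rank_add_one q₂ h₂
    rw [← Matrix.rank_transpose, Matrix.rank] at e3
    rw [Matrix.rank] at e2
    rw [Nat.card_eq_fintype_card] at hcard
    omega
  have heq := Submodule.eq_of_le_of_finrank_le hle hfin
  have hmem : (fun e => c (δ e)) ∈ LinearMap.ker (dartMatrix q₂).transpose.mulVecLin := by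
    refine LinearMap.mem_ker.2 (funext fun x => ?_)
    simp only [Matrix.mulVecLin_apply, dartMatrix_transpose_mulVec, hc']
    exact hsum x
  rw [← heq] at hmem
  obtain ⟨p, hp⟩ := hmem
  refine ⟨p, fun d => ?_⟩
  rw [← dartMatrix_mulVec, ← hc']
  exact (congrFun hp _).symm

end Homology

/-! ### Small edge cuts in cubic graphs -/

section Cut

variable {V : Type*}

theorem card_edges_add_one_le_of_isAcyclic [Fintype V] [Nonempty V] {H : SimpleGraph V}
    [DecidableRel H.Adj] (h : H.IsAcyclic) : H.edgeFinset.card + 1 ≤ Fintype.card V := by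
  classical
  obtain ⟨T, hHT, -, hT⟩ :=
    (connected_top (V := V)).exists_isTree_le_of_le_of_isAcyclic le_top h
  rw [← hT.card_edgeFinset]
  gcongr

theorem card_inner_darts [Fintype V] (G : SimpleGraph V) [DecidableRel G.Adj]
    (X : Set V) [DecidablePred (· ∈ X)] :
    (Finset.univ.filter fun d : G.Dart => d.fst ∈ X ∧ d.snd ∈ X).card
      = 2 * (G.induce X).edgeFinset.card := by
  classical
  rw [← dart_card_eq_twice_card_edges, ← Finset.card_univ]
  symm
  refine Finset.card_bij
    (fun d _ => (⟨(d.fst.1, d.snd.1), by simpa using d.adj⟩ : G.Dart)) ?_ ?_ ?_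
  · intro d _
    simp
  · intro d _ d' _ h
    simp only [Dart.mk.injEq, Prod.mk.injEq] at h
    exact Dart.ext _ _ (Prod.ext (Subtype.ext h.1) (Subtype.ext h.2))
  · intro d hd
    simp only [Finset.mem_filter, Finset.mem_univ, true_and] at hd
    exact ⟨⟨(⟨d.fst, hd.1⟩, ⟨d.snd, hd.2⟩), d.adj⟩, Finset.mem_univ _, rfl⟩

/-- Cycles on both sides of `C` would contradict cyclic connectivity, so one side induces a forest.
Summing degrees over that side gives the equation; the bound on the number of edges of a forest
gives the inequality. Together they bound the number n of its vertices by n + 2 ≤ |C|. -/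
theorem exists_small_side [Fintype V] (G : SimpleGraph V) [DecidableRel G.Adj]
    (hcubic : G.IsRegularOfDegree 3) {k : ℕ} (hcyc : G.IsCyclicallyEdgeConnected k)
    [DecidableEq V]
    (C : Finset (Sym2 V)) (hCE : (C : Set (Sym2 V)) ⊆ G.edgeSet) (hCk : C.card < k)
    (hC : C.Nonempty) (p : V → ZMod 2) (hp : ∀ d : G.Dart, d.edge ∈ C ↔ p d.fst ≠ p d.snd) :
    ∃ i : ZMod 2, (∃ v, p v = i) ∧
      3 * (Finset.univ.filter fun v => p v = i).card
        = (Finset.univ.filter fun d : G.Dart => p d.fst = i ∧ p d.snd = i).card + C.card ∧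
      (Finset.univ.filter fun d : G.Dart => p d.fst = i ∧ p d.snd = i).card + 2
        ≤ 2 * (Finset.univ.filter fun v => p v = i).card := by
  have hz : ∀ a b c : ZMod 2, a ≠ b → a ≠ c → b = c := by decide
  obtain ⟨e₀, he₀⟩ := hC
  have hd₀ : ∃ d : G.Dart, d.edge = e₀ := by
    have := hCE he₀
    induction e₀ with
    | h u v => exact ⟨⟨(u, v), this⟩, rfl⟩
  obtain ⟨d₀, rfl⟩ := hd₀
  have hd₀ := (hp d₀).1 he₀
  have hne : ∀ i : ZMod 2, ∃ v, p v = i := by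
    intro i
    by_cases h : p d₀.fst = i
    · exact ⟨_, h⟩
    · exact ⟨d₀.snd, hz _ _ _ hd₀ h⟩
  have hacyc : ∃ i : ZMod 2, (G.induce {v | p v = i}).IsAcyclic := by
    by_contra hcon
    push Not at hcon
    -- An induced cycle on either side avoids `C`, as `p` is constant there.
    have hcycle : ∀ i : ZMod 2, ∃ (u : V)
        (q : (G.deleteEdges (C : Set (Sym2 V))).Walk u u), p u = i ∧ q.IsCycle := by
      intro i
      have := hcon i
      simp only [IsAcyclic, not_forall, not_not] at this
      obtain ⟨u, q, hq⟩ := this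
      let φ : G.induce {v | p v = i} →g G.deleteEdges (C : Set (Sym2 V)) :=
        { toFun := Subtype.val
          map_rel' := by
            rintro ⟨a, ha⟩ ⟨b, hb⟩ hab
            refine deleteEdges_adj.2 ⟨hab, fun hmem => ?_⟩
            refine (hp ⟨(a, b), hab⟩).1 hmem ?_
            exact Eq.trans ha (Eq.symm hb) }
      exact ⟨u, q.map φ, u.2, hq.map Subtype.val_injective⟩
    obtain ⟨u, q, hu, hq⟩ := hcycle 0
    obtain ⟨v, q', hv, hq'⟩ := hcycle 1
    refine hcyc ⟨C, hCE, hCk, u, v, q, q', hq, hq', ?_⟩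
    rintro ⟨w⟩
    have : ∀ {a b} (w : (G.deleteEdges (C : Set (Sym2 V))).Walk a b), p a = p b := by
      intro a b w
      induction w with
      | nil => rfl
      | cons h w ih =>
        rw [← ih]
        have h' := deleteEdges_adj.1 h
        by_contra hab
        exact h'.2 ((hp ⟨(_, _), h'.1⟩).2 hab)
    have := this w
    rw [hu, hv] at this
    exact absurd this (by decide)
  obtain ⟨i, hi⟩ := hacyc
  refine ⟨i, hne i, ?_, ?_⟩
  · have h3 : ∑ v with p v = i, (Finset.univ.filter fun d : G.Dart => d.fst = v).card
        = 3 * (Finset.univ.filter fun v => p v = i).card := by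
      simp_rw [dart_fst_fiber_card_eq_degree, hcubic.degree_eq]
      simp [mul_comm]
    rw [← h3]
    have h4 : ∑ v with p v = i, (Finset.univ.filter fun d : G.Dart => d.fst = v).card
        = (Finset.univ.filter fun d : G.Dart => p d.fst = i).card := by
      rw [Finset.card_eq_sum_card_fiberwise (f := fun d : G.Dart => d.fst)
        (t := Finset.univ.filter fun v => p v = i)]
      · refine Finset.sum_congr rfl fun v hv => ?_
        congr 1
        ext d
        simp only [Finset.mem_filter, Finset.mem_univ, true_and] at hv ⊢
        exact ⟨fun h => ⟨h ▸ hv, h⟩, fun h => h.2⟩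
      · intro d hd
        simpa using hd
    rw [h4, ← Finset.card_filter_add_card_filter_not (fun d : G.Dart => p d.snd = i),
      Finset.filter_filter, Finset.filter_filter]
    congr 1
    -- Each edge of the cut has exactly one dart that starts on the chosen side.
    refine Finset.card_bij (fun d _ => d.edge) ?_ ?_ ?_
    · intro d hd
      simp only [Finset.mem_filter, Finset.mem_univ, true_and] at hd
      exact (hp d).2 fun h => hd.2 (h ▸ hd.1)
    · intro d hd d' hd' h
      simp only [Finset.mem_filter, Finset.mem_univ, true_and] at hd hd'
      rcases (dart_edge_eq_iff _ _).1 h with h | h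
      · exact h
      · subst h
        exact absurd hd'.1 hd.2
    · intro e he
      obtain ⟨d, rfl⟩ : ∃ d : G.Dart, d.edge = e := by
        have := hCE he
        induction e with
        | h u v => exact ⟨⟨(u, v), this⟩, rfl⟩
      have hd := (hp d).1 he
      by_cases h : p d.fst = i
      · exact ⟨d, by simp only [Finset.mem_filter, Finset.mem_univ, true_and]
                     exact ⟨h, fun h' => hd (h.trans h'.symm)⟩, rfl⟩
      · refine ⟨d.symm, ?_, d.edge_symm⟩
        simp only [Finset.mem_filter, Finset.mem_univ, true_and]
        exact ⟨hz _ _ _ hd h, h⟩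
  · have h1 := card_inner_darts G {v | p v = i}
    simp only [Set.mem_ofPred_eq] at h1
    obtain ⟨v, hv⟩ := hne i
    have : Nonempty {v // v ∈ {v | p v = i}} := ⟨⟨v, hv⟩⟩
    have h2 := card_edges_add_one_le_of_isAcyclic hi
    have h3 : Fintype.card ({v | p v = i} : Set V)
        = (Finset.univ.filter fun v => p v = i).card := by
      rw [Fintype.card_subtype]; rfl
    rw [h1, ← h3]
    omega

end Cut

/-! ### Cubic rotation systems and their facial walks -/

section Rotation

variable {V : Type*} {G : SimpleGraph V}

/-- The permutation of the darts that follows the faces of a rotation system. -/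
def facePerm (r : Equiv.Perm G.Dart) : Equiv.Perm G.Dart :=
  (Dart.symm_involutive.toPerm).trans r

@[simp]
theorem facePerm_apply (r : Equiv.Perm G.Dart) (d : G.Dart) : facePerm r d = r d.symm := rfl

theorem facePerm_symm_apply (r : Equiv.Perm G.Dart) (d : G.Dart) :
    (facePerm r).symm d = (r.symm d).symm := by
  rw [Equiv.symm_apply_eq]
  simp

/-- The rotation systems of cubic graphs. -/
structure IsCubicRotation (r : Equiv.Perm G.Dart) : Prop where
  fst_apply : ∀ d, (r d).fst = d.fst
  apply_ne : ∀ d, r d ≠ d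
  cube : ∀ d, r (r (r d)) = d
  cases : ∀ d d' : G.Dart, d'.fst = d.fst → d' = d ∨ d' = r d ∨ d' = r (r d)

/-- The rotation system that is reversed at the vertices where `o` is `-1`. -/
def twistRot (r : Equiv.Perm G.Dart) (hr : ∀ d, (r d).fst = d.fst) (o : V → ℤˣ) :
    Equiv.Perm G.Dart where
  toFun d := if o d.fst = 1 then r d else r.symm d
  invFun d := if o d.fst = 1 then r.symm d else r d
  left_inv d := by
    have hs : (r.symm d).fst = d.fst := by rw [← hr (r.symm d)]; simp
    by_cases h : o d.fst = 1 <;> simp [h, hr, hs]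
  right_inv d := by
    have hs : (r.symm d).fst = d.fst := by rw [← hr (r.symm d)]; simp
    by_cases h : o d.fst = 1 <;> simp [h, hr, hs]

variable {r : Equiv.Perm G.Dart}

theorem IsCubicRotation.symm_apply (hr : IsCubicRotation r) (d : G.Dart) :
    r.symm d = r (r d) := by
  rw [Equiv.symm_apply_eq, hr.cube]

theorem IsCubicRotation.twistRot_apply (hr : IsCubicRotation r) (o : V → ℤˣ) (d : G.Dart) :
    twistRot r hr.fst_apply o d = if o d.fst = 1 then r d else r (r d) := by
  rw [← hr.symm_apply]; rfl

theorem IsCubicRotation.apply_apply_ne (hr : IsCubicRotation r) (d : G.Dart) : r (r d) ≠ d :=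
  fun h => hr.apply_ne d (by rw [← congrArg r h, hr.cube])

theorem IsCubicRotation.twistRot (hr : IsCubicRotation r) (o : V → ℤˣ) :
    IsCubicRotation (twistRot r hr.fst_apply o) where
  fst_apply d := by
    rw [hr.twistRot_apply]; split_ifs <;> simp [hr.fst_apply]
  apply_ne d := by
    rw [hr.twistRot_apply]; split_ifs
    · exact hr.apply_ne d
    · exact hr.apply_apply_ne d
  cube d := by
    simp only [hr.twistRot_apply]
    by_cases h : o d.fst = 1 <;> simp [h, hr.fst_apply, hr.cube]
  cases d d' h := by
    simp only [hr.twistRot_apply]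
    by_cases ho : o d.fst = 1
    · simpa [ho, hr.fst_apply] using hr.cases d d' h
    · have := hr.cases d d' h
      simp only [ho, hr.fst_apply, hr.cube, if_false]
      tauto

theorem IsCubicRotation.facePerm_fst (hr : IsCubicRotation r) (d : G.Dart) :
    (facePerm r d).fst = d.snd := hr.fst_apply _

/-- No face runs through both sides of an edge. -/
def IsTwoSided (r : Equiv.Perm G.Dart) : Prop :=
  ∀ d, ¬ (facePerm r).SameCycle d d.symm

/-- Since `r d` follows `d.symm` on its face, a walk through both `d` and `r d` would use both sides
of the edge of `d`. With only three darts at a vertex, each facial walk thus visits a vertex at most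
once. -/
theorem IsTwoSided.eq_of_fst_eq (h : IsTwoSided r) (hr : IsCubicRotation r) {d d' : G.Dart}
    (hs : (facePerm r).SameCycle d d') (hf : d'.fst = d.fst) : d' = d := by
  rcases hr.cases d d' hf with e | e | e
  · exact e
  · refine absurd ?_ (h d)
    rw [← Equiv.Perm.sameCycle_apply_right]
    simpa [← e] using hs
  · refine absurd ?_ (h d')
    rw [← Equiv.Perm.sameCycle_apply_right]
    have : r d' = d := by rw [e, hr.cube]
    simpa [this] using hs.symm

theorem IsTwoSided.eq_of_snd_eq (h : IsTwoSided r) (hr : IsCubicRotation r) {d d' : G.Dart}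
    (hs : (facePerm r).SameCycle d d') (hf : d'.snd = d.snd) : d' = d := by
  apply (facePerm r).injective
  refine h.eq_of_fst_eq hr ?_ ?_
  · rwa [Equiv.Perm.sameCycle_apply_left, Equiv.Perm.sameCycle_apply_right]
  · rw [hr.facePerm_fst, hr.facePerm_fst, hf]

theorem IsTwoSided.eq_of_edge_eq (h : IsTwoSided r) {d d' : G.Dart}
    (hs : (facePerm r).SameCycle d d') (he : d'.edge = d.edge) : d' = d := by
  rcases (dart_edge_eq_iff _ _).1 he with e | e
  · exact e
  · subst e
    exact absurd hs (h d)

theorem exists_walk (hr : ∀ d, (r d).fst = d.fst) (n : ℕ) (d : G.Dart) :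
    ∃ p : G.Walk d.fst (((facePerm r) ^ n) d).fst,
      p.darts = (List.range n).map fun i => ((facePerm r) ^ i) d := by
  induction n generalizing d with
  | zero => exact ⟨Walk.nil, rfl⟩
  | succ n ih =>
    obtain ⟨p, hp⟩ := ih (facePerm r d)
    have h1 : (facePerm r d).fst = d.snd := hr _
    have h2 : ∀ i : ℕ, ((facePerm r) ^ i) (facePerm r d) = ((facePerm r) ^ (i + 1)) d := fun i => by
      rw [pow_succ, Equiv.Perm.mul_apply]
    refine ⟨Walk.cons d.adj (p.copy h1 (by rw [h2])), ?_⟩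
    rw [Walk.darts_cons, Walk.darts_copy, hp, List.range_succ_eq_map]
    simp only [List.map_cons, List.map_map]
    congr 1

theorem pow_minimalPeriod_apply {α : Type*} (f : Equiv.Perm α) (x : α) :
    (f ^ Function.minimalPeriod f x) x = x := by
  rw [← Equiv.Perm.iterate_eq_pow]
  exact Function.iterate_minimalPeriod

theorem pow_injOn_minimalPeriod {α : Type*} (f : Equiv.Perm α) (x : α) {i j : ℕ}
    (hi : i < Function.minimalPeriod f x) (hj : j < Function.minimalPeriod f x)
    (h : (f ^ i) x = (f ^ j) x) : i = j := by
  rw [← Equiv.Perm.iterate_eq_pow, ← Equiv.Perm.iterate_eq_pow] at h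
  exact Function.iterate_injOn_Iio_minimalPeriod hi hj h

/-- If no face runs through both sides of an edge, then the facial walks are cycles. -/
theorem IsTwoSided.exists_isCycle [Finite G.Dart] (h : IsTwoSided r) (hr : IsCubicRotation r)
    (d : G.Dart) : ∃ p : G.Walk d.fst d.fst, p.IsCycle ∧
      p.darts = (List.range (Function.minimalPeriod (facePerm r) d)).map
        fun i => ((facePerm r) ^ i) d := by
  set n := Function.minimalPeriod (facePerm r) d with hn
  obtain ⟨p, hp⟩ := exists_walk hr.fst_apply n d
  have hd : ((facePerm r) ^ n) d = d := pow_minimalPeriod_apply _ _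
  have hnpos : 0 < n := by
    refine Function.minimalPeriod_pos_of_mem_periodicPts ?_
    exact (Function.Injective.mem_periodicPts (facePerm r).injective) d
  have hs : ∀ i : ℕ, (facePerm r).SameCycle d (((facePerm r) ^ i) d) := fun i =>
    ⟨i, by simp⟩
  refine ⟨p.copy rfl (by rw [hd]), ?_, by rw [Walk.darts_copy, hp]⟩
  rw [Walk.isCycle_def]
  refine ⟨?_, ?_, ?_⟩
  · rw [Walk.isTrail_def, Walk.edges, Walk.darts_copy, hp, List.map_map]
    refine List.Nodup.map_on ?_ List.nodup_range
    intro i hi j hj hij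
    rw [List.mem_range] at hi hj
    refine pow_injOn_minimalPeriod _ d hi hj ?_
    exact h.eq_of_edge_eq ((hs j).symm.trans (hs i)) hij
  · intro hnil
    have := congrArg Walk.length hnil
    rw [← Walk.length_darts, Walk.darts_copy, hp] at this
    simp at this
    omega
  · rw [← Walk.map_snd_darts, Walk.darts_copy, hp, List.map_map]
    refine List.Nodup.map_on ?_ List.nodup_range
    intro i hi j hj hij
    rw [List.mem_range] at hi hj
    refine pow_injOn_minimalPeriod _ d hi hj ?_
    exact h.eq_of_snd_eq hr ((hs j).symm.trans (hs i)) hij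

end Rotation

/-! ### Gauges: facial walks of orientable embeddings as cycles on darts -/

section Gauge

variable {V : Type*} {G : SimpleGraph V}

/-- The signature of `E` is the coboundary of `o`. -/
def IsGauge (E : SurfaceEmbedding G) (o : V → ℤˣ) : Prop :=
  ∀ d : G.Dart, E.dartSign d = o d.fst * o d.snd

/-- The faces of an embedding with gauge `o`, as cycles of a permutation of the darts. -/
def gaugePerm (E : SurfaceEmbedding G) (o : V → ℤˣ) : Equiv.Perm G.Dart :=
  facePerm (twistRot E.rot E.rot_fst o)

/-- The state that traverses the dart `d` with the orientation prescribed by the gauge. -/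
def gaugeFlag (E : SurfaceEmbedding G) (o : V → ℤˣ) (d : G.Dart) : E.Flag := (d, o d.fst)

variable {E : SurfaceEmbedding G} {o : V → ℤˣ}

theorem gaugePerm_fst (d : G.Dart) : (gaugePerm E o d).fst = d.snd := by
  have hs : (E.rot.symm d.symm).fst = d.symm.fst := by rw [← E.rot_fst (E.rot.symm d.symm)]; simp
  simp only [gaugePerm, facePerm_apply, twistRot, Equiv.coe_fn_mk]
  split_ifs
  · exact E.rot_fst _
  · exact hs

/-- The flags whose orientation agrees with `o` are closed under face traversal, because the sign of
an edge is the change of `o` along it. The remaining flags are their reverses (`eq_or_eq`), so darts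
suffice to describe all faces. -/
theorem IsGauge.step_gaugeFlag (hE : IsGauge E o) (d : G.Dart) :
    E.step (gaugeFlag E o d) = gaugeFlag E o (gaugePerm E o d) := by
  have h1 : o d.fst * E.dartSign d = o d.snd := by
    rw [hE, ← mul_assoc, Int.units_mul_self, one_mul]
  simp only [gaugeFlag, SurfaceEmbedding.step, Equiv.coe_fn_mk, h1, gaugePerm_fst]
  congr 1
  change _ = if o d.snd = 1 then _ else _
  rcases Int.units_eq_one_or (o d.snd) with h | h <;> simp [h]

theorem IsGauge.step_pow_gaugeFlag (hE : IsGauge E o) (d : G.Dart) (n : ℕ) :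
    (E.step ^ n) (gaugeFlag E o d) = gaugeFlag E o ((gaugePerm E o ^ n) d) := by
  induction n with
  | zero => rfl
  | succ n ih =>
    rw [pow_succ', Equiv.Perm.mul_apply, ih, hE.step_gaugeFlag, pow_succ', Equiv.Perm.mul_apply]

theorem gaugeFlag_injective : Function.Injective (gaugeFlag E o) := fun _ _ h =>
  congrArg Prod.fst h

theorem IsGauge.step_sameCycle_iff [Finite V] (hE : IsGauge E o) (d d' : G.Dart) :
    E.step.SameCycle (gaugeFlag E o d) (gaugeFlag E o d') ↔ (gaugePerm E o).SameCycle d d' := by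
  classical
  have hfin : Finite G.Dart := Finite.of_injective _ (Dart.toProd_injective (G := G))
  constructor
  · intro h
    obtain ⟨n, -, hn⟩ := h.exists_pow_eq'
    rw [hE.step_pow_gaugeFlag] at hn
    exact ⟨n, by simpa using gaugeFlag_injective hn⟩
  · intro h
    obtain ⟨n, -, hn⟩ := h.exists_pow_eq'
    exact ⟨n, by rw [zpow_natCast, hE.step_pow_gaugeFlag, hn]⟩

theorem IsGauge.rev_gaugeFlag (hE : IsGauge E o) (d : G.Dart) :
    E.rev (gaugeFlag E o d) = (d.symm, -o d.snd) := by
  have h1 : o d.fst * E.dartSign d = o d.snd := by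
    rw [hE, ← mul_assoc, Int.units_mul_self, one_mul]
  simp only [gaugeFlag, SurfaceEmbedding.rev, Equiv.coe_fn_mk, h1]

theorem IsGauge.eq_or_eq (hE : IsGauge E o) (x : E.Flag) :
    x = gaugeFlag E o x.1 ∨ x = E.rev (gaugeFlag E o x.1.symm) := by
  obtain ⟨d, s⟩ := x
  rw [hE.rev_gaugeFlag]
  by_cases h : s = o d.fst
  · left; rw [h]; rfl
  · right
    have : s = -o d.fst := by
      rcases Int.units_eq_one_or s with h1 | h1 <;>
      rcases Int.units_eq_one_or (o d.fst) with h2 | h2 <;> simp_all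
    rw [this]; rfl

theorem IsGauge.exists_faceOf (hE : IsGauge E o) (f : E.Face) :
    ∃ d, E.faceOf (gaugeFlag E o d) = f := by
  induction f using Quotient.inductionOn with
  | h x =>
    rcases hE.eq_or_eq x with h | h
    · exact ⟨x.1, by rw [h]; rfl⟩
    · refine ⟨x.1.symm, ?_⟩
      conv_rhs => rw [h]
      exact Quotient.sound (Or.inr (Equiv.Perm.SameCycle.refl _ _))

theorem neg_units_ne (s : ℤˣ) : -s ≠ s := by
  rcases Int.units_eq_one_or s with h | h <;> rw [h] <;> decide

theorem IsGauge.faceOf_eq_iff [Finite V] (hE : IsGauge E o) (d d' : G.Dart) :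
    E.faceOf (gaugeFlag E o d) = E.faceOf (gaugeFlag E o d') ↔ (gaugePerm E o).SameCycle d d' := by
  classical
  have hfin : Finite G.Dart := Finite.of_injective _ (Dart.toProd_injective (G := G))
  rw [← hE.step_sameCycle_iff]
  constructor
  · intro h
    rcases Quotient.exact h with h | h
    · exact h
    -- The reverse of a flag that agrees with the gauge disagrees with it, so the two are never on
    -- one directed walk.
    · exfalso
      obtain ⟨n, -, hn⟩ := h.symm.exists_pow_eq'
      rw [hE.step_pow_gaugeFlag, hE.rev_gaugeFlag] at hn
      have h1 := congrArg Prod.fst hn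
      have h2 := congrArg Prod.snd hn
      simp only [gaugeFlag] at h1 h2
      rw [h1] at h2
      exact neg_units_ne _ h2.symm
  · exact fun h => Quotient.sound (Or.inl h)

theorem IsGauge.faceOf_rev (d : G.Dart) :
    E.faceOf (E.rev (gaugeFlag E o d)) = E.faceOf (gaugeFlag E o d) :=
  (Quotient.sound (Or.inr (Equiv.Perm.SameCycle.refl _ _))).symm

theorem IsGauge.mem_edges_iff [Finite V] (hE : IsGauge E o) (d : G.Dart) (e : Sym2 V) :
    e ∈ (E.faceOf (gaugeFlag E o d)).edges ↔
      ∃ d', (gaugePerm E o).SameCycle d d' ∧ d'.edge = e := by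
  constructor
  · rintro ⟨x, hx, rfl⟩
    rcases hE.eq_or_eq x with h | h
    · rw [h] at hx
      exact ⟨x.1, ((hE.faceOf_eq_iff _ _).1 hx).symm, rfl⟩
    · rw [h, IsGauge.faceOf_rev] at hx
      exact ⟨x.1.symm, ((hE.faceOf_eq_iff _ _).1 hx).symm, x.1.edge_symm⟩
  · rintro ⟨d', h, rfl⟩
    exact ⟨gaugeFlag E o d', ((hE.faceOf_eq_iff _ _).2 h).symm, rfl⟩

theorem IsGauge.mem_verts_iff [Finite V] (hE : IsGauge E o) (d : G.Dart) (v : V) :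
    v ∈ (E.faceOf (gaugeFlag E o d)).verts ↔
      ∃ d', (gaugePerm E o).SameCycle d d' ∧ d'.fst = v := by
  constructor
  · rintro ⟨x, hx, rfl⟩
    rcases hE.eq_or_eq x with h | h
    · rw [h] at hx
      exact ⟨x.1, ((hE.faceOf_eq_iff _ _).1 hx).symm, rfl⟩
    · rw [h, IsGauge.faceOf_rev] at hx
      refine ⟨gaugePerm E o x.1.symm, ?_, gaugePerm_fst _⟩
      rw [Equiv.Perm.sameCycle_apply_right]
      exact ((hE.faceOf_eq_iff _ _).1 hx).symm
  · rintro ⟨d', h, rfl⟩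
    exact ⟨gaugeFlag E o d', ((hE.faceOf_eq_iff _ _).2 h).symm, rfl⟩

theorem IsGauge.minimalPeriod_step (hE : IsGauge E o) (d : G.Dart) :
    Function.minimalPeriod E.step (gaugeFlag E o d)
      = Function.minimalPeriod (gaugePerm E o) d := by
  refine Function.minimalPeriod_eq_minimalPeriod_iff.2 fun n => ?_
  rw [Function.IsPeriodicPt, Function.IsPeriodicPt, Function.IsFixedPt, Function.IsFixedPt,
    Equiv.Perm.iterate_eq_pow, Equiv.Perm.iterate_eq_pow, hE.step_pow_gaugeFlag,
    gaugeFlag_injective.eq_iff]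

theorem IsGauge.length_faceOf (hE : IsGauge E o) (d : G.Dart) :
    (E.faceOf (gaugeFlag E o d)).length = Function.minimalPeriod (gaugePerm E o) d :=
  hE.minimalPeriod_step d

theorem IsGauge.neg (hE : IsGauge E o) : IsGauge E (fun v => -o v) := fun d => by
  rw [hE]; simp

theorem IsGauge.exists_isCycle [Finite V] (hE : IsGauge E o)
    (hr : IsCubicRotation E.rot) (h : IsTwoSided (twistRot E.rot E.rot_fst o)) (d : G.Dart) :
    ∃ (v : V) (p : G.Walk v v), p.IsCycle ∧ p.darts = E.walkDarts (gaugeFlag E o d) := by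
  classical
  have hfin : Finite G.Dart := Finite.of_injective _ (Dart.toProd_injective (G := G))
  obtain ⟨p, hp, hd⟩ := h.exists_isCycle (hr.twistRot o) d
  refine ⟨_, p, hp, ?_⟩
  rw [hd, SurfaceEmbedding.walkDarts, SurfaceEmbedding.walkLength, hE.minimalPeriod_step]
  refine List.map_congr_left fun i _ => ?_
  rw [hE.step_pow_gaugeFlag]
  rfl

theorem IsCubicRotation.isTwoSided_neg {r : Equiv.Perm G.Dart} (hr : IsCubicRotation r)
    (h : IsTwoSided (CubicMap.twistRot r hr.fst_apply o)) :
    IsTwoSided (CubicMap.twistRot r hr.fst_apply fun v => -o v) := by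
  intro d hd
  set ψ := facePerm (CubicMap.twistRot r hr.fst_apply o) with hψ
  set ψ' := facePerm (CubicMap.twistRot r hr.fst_apply fun v => -o v) with hψ'
  set α : Equiv.Perm G.Dart := Dart.symm_involutive.toPerm with hα
  -- Negating the gauge inverts the rotation everywhere, which merely runs every face backwards on
  -- the reversed darts.
  have key : ψ'⁻¹ = α * ψ * α⁻¹ := by
    rw [inv_eq_iff_mul_eq_one]
    ext1 x
    have hf : (CubicMap.twistRot r hr.fst_apply o x).fst = x.fst := (hr.twistRot o).fst_apply x
    have h1 : α⁻¹ x = x.symm := rfl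
    have h3 : ∀ y, α y = y.symm := fun _ => rfl
    simp only [Equiv.Perm.mul_apply, h1, h3, hψ, hψ', facePerm_apply, Dart.symm_symm,
      Equiv.Perm.one_apply]
    rw [hr.twistRot_apply _ (CubicMap.twistRot r hr.fst_apply o x), hf]
    rw [hr.twistRot_apply]
    rcases Int.units_eq_one_or (o x.fst) with h2 | h2 <;> simp [h2, hr.cube]
  rw [← Equiv.Perm.sameCycle_inv, key, Equiv.Perm.sameCycle_conj] at hd
  exact h d.symm hd

theorem IsGauge.isStrong [Finite V] (hE : IsGauge E o)
    (hr : IsCubicRotation E.rot) (h : IsTwoSided (twistRot E.rot E.rot_fst o)) :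
    E.IsStrong := by
  rintro ⟨d, s⟩
  by_cases hs : s = o d.fst
  · rw [hs]; exact hE.exists_isCycle hr h d
  · have : s = -o d.fst := by
      rcases Int.units_eq_one_or s with h1 | h1 <;>
      rcases Int.units_eq_one_or (o d.fst) with h2 | h2 <;> simp_all
    rw [this]
    -- Flags that disagree with `o` agree with the gauge `-o`.
    exact hE.neg.exists_isCycle hr (hr.isTwoSided_neg h) d

end Gauge

/-! ### Cubic maps and their local geometry -/

variable {V : Type*} {G : SimpleGraph V} {Φ : Type*}

/-- A cubic map, given by a rotation system `r` and the function `F` that sends each dart to the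
face it runs along, such that the cycles of the face permutation are the fibres of `F`. -/
structure IsCubicMap (r : Equiv.Perm G.Dart) (F : G.Dart → Φ) : Prop where
  rot : IsCubicRotation r
  face_iff : ∀ d d', F d = F d' ↔ (facePerm r).SameCycle d d'

/-- A cubic map in which every dual cycle of length at most two is degenerate. -/
structure IsPolyhedral (r : Equiv.Perm G.Dart) (F : G.Dart → Φ) : Prop
    extends IsCubicMap r F where
  symm_ne : ∀ d, F d ≠ F d.symm
  inj : ∀ d d', F d = F d' → F d.symm = F d'.symm → d = d'

/-- A cubic map in which dual triangles surround vertices. -/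
structure IsTriangleFree (r : Equiv.Perm G.Dart) (F : G.Dart → Φ) : Prop
    extends IsPolyhedral r F where
  triangle : ∀ d₁ d₂ d₃, F d₁.symm = F d₂ → F d₂.symm = F d₃ → F d₃.symm = F d₁ →
    ∃ v, v ∈ d₁.edge ∧ v ∈ d₂.edge ∧ v ∈ d₃.edge

variable {r : Equiv.Perm G.Dart} {F : G.Dart → Φ}

theorem IsCubicMap.apply_facePerm (h : IsCubicMap r F) (d : G.Dart) :
    F (facePerm r d) = F d := by
  rw [h.face_iff, Equiv.Perm.sameCycle_apply_left]

theorem IsCubicMap.apply_rot (h : IsCubicMap r F) (d : G.Dart) : F (r d) = F d.symm := by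
  have := h.apply_facePerm d.symm
  simpa using this

theorem IsCubicMap.apply_rot_rot_symm (h : IsCubicMap r F) (d : G.Dart) :
    F (r (r d)).symm = F d := by
  rw [← h.apply_rot, h.rot.cube]

theorem IsCubicMap.apply_rot_rot (h : IsCubicMap r F) (d : G.Dart) :
    F (r (r d)) = F (r d).symm := by
  rw [h.apply_rot]

theorem IsPolyhedral.isTwoSided (h : IsPolyhedral r F) : IsTwoSided r := fun d hd =>
  h.symm_ne d ((h.face_iff _ _).2 hd)

theorem IsPolyhedral.eq_of_fst_eq (h : IsPolyhedral r F) {d d' : G.Dart} (hF : F d = F d')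
    (hf : d.fst = d'.fst) : d = d' :=
  h.isTwoSided.eq_of_fst_eq h.rot ((h.face_iff _ _).1 hF.symm) hf

/-- The three faces at the start of a dart are the only ones there. -/
theorem IsCubicMap.eq_of_fst_eq (h : IsCubicMap r F) {d d' : G.Dart} (hf : d'.fst = d.fst) :
    F d' = F d ∨ F d' = F d.symm ∨ F d' = F (r (r d)) := by
  rcases h.rot.cases d d' hf with e | e | e
  · exact Or.inl (e ▸ rfl)
  · exact Or.inr (Or.inl (e ▸ h.apply_rot d))
  · exact Or.inr (Or.inr (e ▸ rfl))

/-- The common face and the two faces behind `d` and `d'` form a dual triangle, which surrounds a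
vertex. Hence the two darts share an end and are consecutive on their face. -/
theorem IsTriangleFree.eq_facePerm (h : IsTriangleFree r F) {d d' e : G.Dart} (hF : F d = F d')
    (hne : d ≠ d') (h1 : F e = F d.symm) (h2 : F e.symm = F d'.symm) :
    d' = facePerm r d ∨ d = facePerm r d' := by
  obtain ⟨v, hv, -, hv'⟩ := h.triangle d e d'.symm h1.symm h2 (by simp [hF])
  rw [Dart.edge_symm] at hv'
  simp only [Dart.edge, Sym2.mem_iff] at hv hv'
  have hs : ∀ {x y : G.Dart}, F x = F y → x.snd = y.fst → y = facePerm r x := fun {x y} hxy h' =>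
    h.eq_of_fst_eq (by rw [h.apply_facePerm, hxy]) (by rw [h.rot.facePerm_fst, h'])
  rcases hv with hv | hv <;> rcases hv' with hv' | hv'
  · exact absurd (h.eq_of_fst_eq hF (hv ▸ hv')) hne
  · exact Or.inr (hs hF.symm (hv' ▸ hv))
  · exact Or.inl (hs hF (hv ▸ hv'))
  · refine absurd ((facePerm r).injective (h.eq_of_fst_eq ?_ ?_)) hne
    · rw [h.apply_facePerm, h.apply_facePerm, hF]
    · rw [h.rot.facePerm_fst, h.rot.facePerm_fst, ← hv, ← hv']

/-! ### Boundaries, coboundaries and connectedness -/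

section Sums

variable [Fintype G.Dart]

/-- The sum telescopes: the end of each dart of a face is the start of the next one. -/
theorem sum_face_coboundary [DecidableEq Φ] (h : IsCubicMap r F) (p : V → ZMod 2) (f : Φ) :
    ∑ d with F d = f, (p d.fst + p d.snd) = 0 := by
  rw [Finset.sum_add_distrib]
  have : ∑ d with F d = f, p d.snd = ∑ d with F d = f, p d.fst := by
    refine Finset.sum_equiv (facePerm r) ?_ ?_
    · intro d; simp only [Finset.mem_filter, Finset.mem_univ, true_and, h.apply_facePerm]
    · intro d _; rw [h.rot.facePerm_fst]
  rw [this, CharTwo.add_self_eq_zero]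

theorem sum_star_coboundary [DecidableEq V] (h : IsCubicMap r F) (y : Φ → ZMod 2) (v : V) :
    ∑ d : G.Dart with d.fst = v, (y (F d) + y (F d.symm)) = 0 := by
  rw [Finset.sum_add_distrib]
  have : ∑ d : G.Dart with d.fst = v, y (F d.symm) = ∑ d : G.Dart with d.fst = v, y (F d) := by
    refine Finset.sum_equiv r ?_ ?_
    · intro d; simp only [Finset.mem_filter, Finset.mem_univ, true_and, h.rot.fst_apply]
    · intro d _; rw [h.apply_rot]
  rw [this, CharTwo.add_self_eq_zero]

/-- This turns the cocycle condition at a face into a count of the sides of `D` on it. For a closed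
walk in the dual graph the count is visibly even. -/
theorem sum_face_indicator [DecidableEq Φ] [DecidableEq (Sym2 V)] (f : Φ) (D : Finset G.Dart)
    (hD : Set.InjOn Dart.edge (D : Set G.Dart)) :
    (∑ d with F d = f, if d.edge ∈ D.image Dart.edge then (1 : ZMod 2) else 0)
      = ∑ e ∈ D, ((if F e = f then 1 else 0) + (if F e.symm = f then 1 else 0)) := by
  classical
  have h1 : ∀ d : G.Dart, (if d.edge ∈ D.image Dart.edge then (1 : ZMod 2) else 0)
      = ∑ e ∈ D, if d.edge = e.edge then 1 else 0 := by
    intro d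
    split_ifs with hd
    · obtain ⟨e, he, hde⟩ := Finset.mem_image.1 hd
      rw [Finset.sum_eq_single e, if_pos hde.symm]
      · intro b hb hne
        rw [if_neg]
        exact fun hb' => hne (hD hb he (hb'.symm.trans hde.symm))
      · exact fun h => absurd he h
    · rw [Finset.sum_eq_zero]
      intro e he
      rw [if_neg]
      exact fun h => hd (Finset.mem_image.2 ⟨e, he, h.symm⟩)
  simp only [h1]
  rw [Finset.sum_comm]
  refine Finset.sum_congr rfl fun e _ => ?_
  rw [Finset.sum_filter]
  have h2 : ∀ d : G.Dart, (if F d = f then if d.edge = e.edge then (1 : ZMod 2) else 0 else 0)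
      = if d.edge = e.edge then (if F d = f then 1 else 0) else 0 := by
    intro d; split_ifs <;> rfl
  simp only [h2]
  rw [← Finset.sum_filter]
  have : (Finset.univ.filter fun d' : G.Dart => d'.edge = e.edge) = {e, e.symm} :=
    Finset.ext fun d' => by simpa using dart_edge_eq_iff d' e
  rw [this, Finset.sum_pair e.symm_ne.symm]

end Sums

/-- A function on the vertices of a connected graph that agrees at the ends of each edge is
constant. -/
theorem eq_of_forall_dart {α : Type*} (hG : G.Connected) (p : V → α)
    (hp : ∀ d : G.Dart, p d.fst = p d.snd) (u v : V) : p u = p v := by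
  obtain ⟨w⟩ := hG.preconnected u v
  induction w with
  | nil => rfl
  | cons h w ih => rw [← ih]; exact hp ⟨(_, _), h⟩

theorem exists_dart_fst [Fintype V] [DecidableRel G.Adj] (hcubic : G.IsRegularOfDegree 3) (v : V) :
    ∃ d : G.Dart, d.fst = v := by
  classical
  have := dart_fst_fiber_card_eq_degree G v
  rw [hcubic.degree_eq] at this
  obtain ⟨d, hd⟩ := Finset.card_pos.1 (by rw [this]; norm_num : 0 < _)
  exact ⟨d, by simpa using hd⟩

/-- The dual graph is connected: faces around one vertex are linked through its edges, and adjacent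
vertices have a face in common. -/
theorem eq_of_forall_face [Fintype V] [DecidableRel G.Adj] (hcubic : G.IsRegularOfDegree 3)
    (hG : G.Connected) (h : IsCubicMap r F) (y : Φ → ZMod 2)
    (hy : ∀ d, y (F d) = y (F d.symm)) (d d' : G.Dart) : y (F d) = y (F d') := by
  choose δ hδ using exists_dart_fst hcubic
  have h1 : ∀ a b : G.Dart, b.fst = a.fst → y (F b) = y (F a) := by
    intro a b hab
    rcases h.rot.cases a b hab with e | e | e
    · rw [e]
    · rw [e, h.apply_rot, ← hy]
    · rw [e, h.apply_rot, ← hy, h.apply_rot, ← hy]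
  have h2 : ∀ a : G.Dart, y (F (δ a.fst)) = y (F (δ a.snd)) := by
    intro a
    rw [h1 a _ (hδ _), h1 a.symm (δ a.snd) (hδ _), hy]
  have h3 := eq_of_forall_dart hG (fun v => y (F (δ v))) h2 d.fst d'.fst
  rw [← h1 d _ (hδ _), ← h1 d' _ (hδ _)]
  exact h3

/-- The homological form of planarity. -/
structure IsHomologySphere (r : Equiv.Perm G.Dart) (F : G.Dart → Φ) [Fintype G.Dart] : Prop
    extends IsCubicMap r F where
  connected : G.Connected
  surj : Function.Surjective F
  cut : ∀ [DecidableEq Φ] (c : G.Dart → ZMod 2), (∀ d, c d.symm = c d) →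
    (∀ f, ∑ d with F d = f, c d = 0) → ∃ p : V → ZMod 2, ∀ d, c d = p d.fst + p d.snd
  cycle : ∀ [DecidableEq V] (c : G.Dart → ZMod 2), (∀ d, c d.symm = c d) →
    (∀ v, ∑ d with d.fst = v, c d = 0) → ∃ y : Φ → ZMod 2, ∀ d, c d = y (F d) + y (F d.symm)

/-- Vertex stars and faces are two connected, mutually orthogonal systems of dart classes, and
Euler's formula is the count that `exists_potential` needs. Applying it in both directions gives
both forms of exactness. -/
theorem IsCubicMap.isHomologySphere [Fintype V] [DecidableRel G.Adj] [Finite Φ]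
    (hcubic : G.IsRegularOfDegree 3) (hG : G.Connected) (h : IsCubicMap r F)
    (hF : Function.Surjective F)
    (hcard : Nat.card V + Nat.card Φ = Nat.card G.edgeSet + 2) : IsHomologySphere r F := by
  let _ : Fintype Φ := Fintype.ofFinite Φ
  have h₁ : ∀ p : V → ZMod 2, (∀ d : G.Dart, p d.fst = p d.symm.fst) → ∀ x y, p x = p y :=
    fun p hp => eq_of_forall_dart hG p hp
  have h₂ : ∀ p : Φ → ZMod 2, (∀ d : G.Dart, p (F d) = p (F d.symm)) → ∀ x y, p x = p y := by
    intro p hp x y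
    obtain ⟨d, rfl⟩ := hF x
    obtain ⟨d', rfl⟩ := hF y
    exact eq_of_forall_face hcubic hG h p hp d d'
  rw [Nat.card_eq_fintype_card (α := V), Nat.card_eq_fintype_card (α := Φ)] at hcard
  refine ⟨h, hG, hF, ?_, ?_⟩
  · intro _ c hc hsum
    exact exists_potential (fun d : G.Dart => d.fst) F h₁ h₂
      (fun p f => sum_face_coboundary h p f) hcard c hc hsum
  · intro _ c hc hsum
    exact exists_potential F (fun d : G.Dart => d.fst) h₂ h₁
      (fun y v => sum_star_coboundary h y v) (by omega) c hc hsum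

/-! ### Short dual cycles under cyclic edge connectivity -/

section CutLemma

theorem ne_of_edge_ne {d d' : G.Dart} (h : d.edge ≠ d'.edge) : d ≠ d' := fun e => h (e ▸ rfl)

variable [Fintype V] [DecidableRel G.Adj]

-- A set of edges with an even number of sides on every face is a cocycle, so on the sphere it is an
-- edge cut, and `exists_small_side` applies. `X` is the forest side.
open Classical in
theorem IsHomologySphere.exists_cut (hcubic : G.IsRegularOfDegree 3) (h : IsHomologySphere r F)
    {k : ℕ} (hcyc : G.IsCyclicallyEdgeConnected k) (D : Finset G.Dart)
    (hD : Set.InjOn Dart.edge (D : Set G.Dart)) (hk : D.card < k) (hne : D.Nonempty)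
    (hsum : ∀ f, ∑ e ∈ D, ((if F e = f then 1 else 0) + (if F e.symm = f then 1 else 0)
      : ZMod 2) = 0) :
    ∃ X : Finset V, X.Nonempty ∧
      (∀ d : G.Dart, d.edge ∈ D.image Dart.edge ↔ (d.fst ∈ X ↔ d.snd ∉ X)) ∧
      3 * X.card = (Finset.univ.filter fun d : G.Dart => d.fst ∈ X ∧ d.snd ∈ X).card + D.card ∧
      (Finset.univ.filter fun d : G.Dart => d.fst ∈ X ∧ d.snd ∈ X).card + 2 ≤ 2 * X.card := by
  obtain ⟨p, hp⟩ := h.cut (fun d => if d.edge ∈ D.image Dart.edge then 1 else 0)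
    (fun d => by rw [Dart.edge_symm]) (fun f =>
      (sum_face_indicator f D hD).trans (hsum f))
  have hp' : ∀ d : G.Dart, d.edge ∈ D.image Dart.edge ↔ p d.fst ≠ p d.snd := by
    intro d
    have := hp d
    have hz : ∀ a b : ZMod 2, (1 = a + b → a ≠ b) ∧ (0 = a + b → a = b) := by decide
    constructor
    · intro hd
      rw [if_pos hd] at this
      exact (hz _ _).1 this
    · intro hd
      by_contra hcon
      rw [if_neg hcon] at this
      exact hd ((hz _ _).2 this)
  have hcard : (D.image Dart.edge).card = D.card := Finset.card_image_of_injOn hD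
  obtain ⟨i, ⟨v, hv⟩, h1, h2⟩ := exists_small_side G hcubic hcyc (D.image Dart.edge)
    (by intro e he
        obtain ⟨d, -, rfl⟩ := Finset.mem_image.1 (Finset.mem_coe.1 he)
        exact d.edge_mem)
    (by rw [hcard]; exact hk) (hne.image _) p hp'
  rw [hcard] at h1
  refine ⟨Finset.univ.filter fun v => p v = i, ⟨v, by simpa using hv⟩, ?_, ?_, ?_⟩
  · intro d
    rw [hp']
    simp only [Finset.mem_filter, Finset.mem_univ, true_and]
    have hz : ∀ a b i : ZMod 2, a ≠ b ↔ (a = i ↔ ¬ b = i) := by decide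
    exact hz _ _ _
  · simpa using h1
  · simpa using h2

theorem IsHomologySphere.symm_ne (hcubic : G.IsRegularOfDegree 3) (h : IsHomologySphere r F)
    {k : ℕ} (hk : 4 ≤ k) (hcyc : G.IsCyclicallyEdgeConnected k) (d : G.Dart) :
    F d ≠ F d.symm := by
  classical
  intro hd
  obtain ⟨X, hX, -, h1, h2⟩ := h.exists_cut hcubic hcyc {d} (by simp)
    (by rw [Finset.card_singleton]; omega) (by simp)
    (fun f => by rw [Finset.sum_singleton, ← hd, CharTwo.add_self_eq_zero])
  rw [Finset.card_singleton] at h1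
  omega

/-- Two edges with the same pair of faces would form a cut of size 2, while a nonempty forest side
needs n + 2 ≤ 2. -/
theorem IsHomologySphere.isPolyhedral (hcubic : G.IsRegularOfDegree 3)
    (h : IsHomologySphere r F) {k : ℕ} (hk : 4 ≤ k) (hcyc : G.IsCyclicallyEdgeConnected k) :
    IsPolyhedral r F where
  toIsCubicMap := h.toIsCubicMap
  symm_ne := h.symm_ne hcubic hk hcyc
  inj d d' h1 h2 := by
    classical
    by_contra hne
    have hedge : d.edge ≠ d'.edge := by
      intro he
      rcases (dart_edge_eq_iff _ _).1 he with e | e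
      · exact hne e
      · refine h.symm_ne hcubic hk hcyc d' ?_
        rw [← h1, e]
    obtain ⟨X, hX, -, h1, h2⟩ := h.exists_cut hcubic hcyc {d, d'}
      (by rw [Finset.coe_pair, Set.injOn_pair]; exact fun h => absurd h hedge)
      (by rw [Finset.card_pair hne]; omega) (by simp)
      (fun f => by rw [Finset.sum_pair hne, h1, h2, CharTwo.add_self_eq_zero])
    rw [Finset.card_pair hne] at h1
    have := hX.card_pos
    omega

/-- A dual triangle is a cut of size 3, so n + 2 ≤ 3 and the forest side is the single vertex
sought. -/
theorem IsHomologySphere.isTriangleFree (hcubic : G.IsRegularOfDegree 3)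
    (h : IsHomologySphere r F) {k : ℕ} (hk : 4 ≤ k) (hcyc : G.IsCyclicallyEdgeConnected k) :
    IsTriangleFree r F where
  toIsPolyhedral := h.isPolyhedral hcubic hk hcyc
  triangle d₁ d₂ d₃ h12 h23 h31 := by
    classical
    have hs := h.symm_ne hcubic hk hcyc
    have hne : ∀ a b c : G.Dart, F a.symm = F b → F b.symm = F c → F c.symm = F a →
        a.edge ≠ b.edge := by
      intro a b c hab hbc hca he
      rcases (dart_edge_eq_iff _ _).1 he with e | e
      · subst e; exact hs a hab.symm
      · subst e
        exact hs c (hbc.symm.trans hca.symm)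
    have n12 := hne _ _ _ h12 h23 h31
    have n23 := hne _ _ _ h23 h31 h12
    have n31 := hne _ _ _ h31 h12 h23
    have hcard : ({d₁, d₂, d₃} : Finset G.Dart).card = 3 :=
      Finset.card_eq_three.2 ⟨_, _, _, ne_of_edge_ne n12, ne_of_edge_ne n31.symm,
        ne_of_edge_ne n23, rfl⟩
    obtain ⟨X, hX, hd, h1, h2⟩ := h.exists_cut hcubic hcyc {d₁, d₂, d₃}
      (by
        intro a ha b hb hab
        simp only [Finset.coe_insert, Finset.coe_singleton, Set.mem_insert_iff,
          Set.mem_singleton_iff] at ha hb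
        rcases ha with rfl | rfl | rfl <;> rcases hb with rfl | rfl | rfl <;>
          first | rfl | exact absurd hab ‹_› | exact absurd hab.symm ‹_›)
      (by omega) (by simp)
      (fun f => by
        rw [Finset.sum_insert (by
            simp only [Finset.mem_insert, Finset.mem_singleton, not_or]
            exact ⟨ne_of_edge_ne n12, ne_of_edge_ne n31.symm⟩),
          Finset.sum_pair (ne_of_edge_ne n23), h12, h23, h31]
        have hz : ∀ a b c : ZMod 2, a + b + (b + c + (c + a)) = 0 := by decide
        exact hz _ _ _)
    rw [hcard] at h1
    have hX1 : X.card = 1 := by have := hX.card_pos; omega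
    obtain ⟨v, rfl⟩ := Finset.card_eq_one.1 hX1
    have key : ∀ d : G.Dart, d.edge ∈ ({d₁, d₂, d₃} : Finset G.Dart).image Dart.edge →
        v ∈ d.edge := by
      intro d hd'
      have := (hd d).1 hd'
      simp only [Finset.mem_singleton] at this
      rw [Dart.edge, Sym2.mem_iff]
      by_cases h1 : d.fst = v
      · exact Or.inl h1.symm
      · right
        by_contra h2
        exact h1 (this.2 fun h => h2 h.symm)
    exact ⟨v, key _ (by simp), key _ (by simp), key _ (by simp)⟩

/-- In a cyclically 5-edge connected graph dual 4-cycles have chords. -/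
theorem IsHomologySphere.exists_chord (hcubic : G.IsRegularOfDegree 3)
    (h : IsHomologySphere r F) {k : ℕ} (hk : 5 ≤ k) (hcyc : G.IsCyclicallyEdgeConnected k)
    (d₁ d₂ d₃ d₄ : G.Dart) (h12 : F d₁.symm = F d₂) (h23 : F d₂.symm = F d₃)
    (h34 : F d₃.symm = F d₄) (h41 : F d₄.symm = F d₁) (h13 : F d₁ ≠ F d₃) (h24 : F d₂ ≠ F d₄) :
    ∃ e, (F e = F d₁ ∧ F e.symm = F d₃) ∨ (F e = F d₂ ∧ F e.symm = F d₄) := by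
  classical
  have hpoly := h.isPolyhedral hcubic (by omega : 4 ≤ k) hcyc
  have hs := hpoly.symm_ne
  have hne : ∀ a b c : G.Dart, F a.symm = F b → F b.symm = F c → F a ≠ F c →
      a.edge ≠ b.edge := by
    intro a b c hab hbc hac he
    rcases (dart_edge_eq_iff _ _).1 he with e | e
    · subst e; exact hs a hab.symm
    · subst e
      exact hac hbc
  have hne' : ∀ a b c : G.Dart, F b.symm = F c → F c.symm = F a → F a ≠ F b →
      a.edge ≠ b.edge := by
    intro a b c hbc hca hab he
    rcases (dart_edge_eq_iff _ _).1 he with e | e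
    · exact hab (e ▸ rfl)
    · subst e
      exact hs c (hbc.symm.trans hca.symm)
  have n12 := hne _ _ _ h12 h23 h13
  have n23 := hne _ _ _ h23 h34 h24
  have n34 := hne _ _ _ h34 h41 h13.symm
  have n41 := hne _ _ _ h41 h12 h24.symm
  have n13 := hne' _ _ _ h34 h41 h13
  have n24 := hne' _ _ _ h41 h12 h24
  have hcard : ({d₁, d₂, d₃, d₄} : Finset G.Dart).card = 4 := by
    rw [Finset.card_insert_of_notMem, Finset.card_eq_three.2 ⟨_, _, _, ne_of_edge_ne n23,
      ne_of_edge_ne n24, ne_of_edge_ne n34, rfl⟩]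
    simp only [Finset.mem_insert, Finset.mem_singleton, not_or]
    exact ⟨ne_of_edge_ne n12, ne_of_edge_ne n13, ne_of_edge_ne n41.symm⟩
  obtain ⟨X, hX, hd, h1, h2⟩ := h.exists_cut hcubic hcyc {d₁, d₂, d₃, d₄}
    (by
      intro a ha b hb hab
      simp only [Finset.coe_insert, Finset.coe_singleton, Set.mem_insert_iff,
        Set.mem_singleton_iff] at ha hb
      rcases ha with rfl | rfl | rfl | rfl <;> rcases hb with rfl | rfl | rfl | rfl <;>
        first | rfl | exact absurd hab ‹_› | exact absurd hab.symm ‹_›)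
    (by omega) (by simp)
    (fun f => by
      rw [Finset.sum_insert (by
          simp only [Finset.mem_insert, Finset.mem_singleton, not_or]
          exact ⟨ne_of_edge_ne n12, ne_of_edge_ne n13, ne_of_edge_ne n41.symm⟩),
        Finset.sum_insert (by
          simp only [Finset.mem_insert, Finset.mem_singleton, not_or]
          exact ⟨ne_of_edge_ne n23, ne_of_edge_ne n24⟩),
        Finset.sum_pair (ne_of_edge_ne n34), h12, h23, h34, h41]
      have hz : ∀ a b c d : ZMod 2, a + b + (b + c + (c + d + (d + a))) = 0 := by decide
      exact hz _ _ _ _)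
  rw [hcard] at h1
  -- From n + 2 ≤ 4 and 3n ≥ 4. There remain 3 · 2 - 4 = 2 inner darts, those of the edge joining
  -- the two vertices.
  have hX2 : X.card = 2 := by omega
  obtain ⟨e, he⟩ : (Finset.univ.filter fun d : G.Dart => d.fst ∈ X ∧ d.snd ∈ X).Nonempty := by
    rw [← Finset.card_pos]; omega
  simp only [Finset.mem_filter, Finset.mem_univ, true_and] at he
  have hXe : ∀ v ∈ X, v = e.fst ∨ v = e.snd := by
    obtain ⟨a, b, hab, rfl⟩ := Finset.card_eq_two.1 hX2
    simp only [Finset.mem_insert, Finset.mem_singleton] at he ⊢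
    have := e.fst_ne_snd
    rintro v (rfl | rfl) <;> rcases he with ⟨h1 | h1, h2 | h2⟩ <;> simp_all
  have hout : ∀ x : G.Dart, x.fst = e.fst → x ≠ e →
      x.edge ∈ ({d₁, d₂, d₃, d₄} : Finset G.Dart).image Dart.edge := by
    intro x hx hxe
    rw [hd]
    refine ⟨fun _ hx2 => ?_, fun _ => hx ▸ he.1⟩
    rcases hXe _ hx2 with h' | h'
    · exact x.snd_ne_fst (h'.trans hx.symm)
    · exact hxe (Dart.ext _ _ (Prod.ext hx h'))
  have hin : ∀ i ∈ ({d₁, d₂, d₃, d₄} : Finset G.Dart), e ≠ i ∧ e ≠ i.symm := by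
    intro i hi
    have : e.edge ∉ ({d₁, d₂, d₃, d₄} : Finset G.Dart).image Dart.edge := by
      rw [hd]; simp [he]
    constructor <;> rintro rfl
    · exact this (Finset.mem_image_of_mem _ hi)
    · rw [Dart.edge_symm] at this
      exact this (Finset.mem_image_of_mem _ hi)
  have hcases : ∀ x : G.Dart, x.edge ∈ ({d₁, d₂, d₃, d₄} : Finset G.Dart).image Dart.edge →
      F x = F d₁ ∨ F x = F d₂ ∨ F x = F d₃ ∨ F x = F d₄ := by
    intro x hx
    obtain ⟨i, hi, hix⟩ := Finset.mem_image.1 hx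
    simp only [Finset.mem_insert, Finset.mem_singleton] at hi
    rcases (dart_edge_eq_iff _ _).1 hix.symm with rfl | rfl <;>
      rcases hi with rfl | rfl | rfl | rfl <;> simp [h12, h23, h34, h41]
  -- The other two edges at the start of `e` are in the cut, so both faces beside `e` are on the
  -- dual 4-cycle. They are not consecutive there, since then `e` would be an edge of the cut by
  -- `inj`. So `e` is a chord.
  have hB := hcases _ (hout (r e) (h.rot.fst_apply _) (h.rot.apply_ne _))
  rw [h.apply_rot] at hB
  have hA := hcases (r (r e)).symm (by
    rw [Dart.edge_symm]
    exact hout _ (by rw [h.rot.fst_apply, h.rot.fst_apply]) (h.rot.apply_apply_ne _))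
  rw [h.apply_rot_rot_symm] at hA
  have adj : ∀ i ∈ ({d₁, d₂, d₃, d₄} : Finset G.Dart), F e = F i → F e.symm = F i.symm → False :=
    fun i hi h1 h2 => (hin i hi).1 (hpoly.inj _ _ h1 h2)
  have adj' : ∀ i ∈ ({d₁, d₂, d₃, d₄} : Finset G.Dart), F e = F i.symm → F e.symm = F i → False :=
    fun i hi h1 h2 => (hin i hi).2 (hpoly.inj _ _ h1 (by simpa using h2))
  have a1 := adj d₁ (by simp)
  have a2 := adj d₂ (by simp)
  have a3 := adj d₃ (by simp)
  have a4 := adj d₄ (by simp)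
  have b1 := adj' d₁ (by simp)
  have b2 := adj' d₂ (by simp)
  have b3 := adj' d₃ (by simp)
  have b4 := adj' d₄ (by simp)
  rw [h12] at a1 b1
  rw [h23] at a2 b2
  rw [h34] at a3 b3
  rw [h41] at a4 b4
  have hse := hs e
  rcases hA with hA | hA | hA | hA <;> rcases hB with hB | hB | hB | hB
  · exact absurd (hA.trans hB.symm) hse
  · exact (a1 hA hB).elim
  · exact ⟨e, Or.inl ⟨hA, hB⟩⟩
  · exact (b4 hA hB).elim
  · exact (b1 hA hB).elim
  · exact absurd (hA.trans hB.symm) hse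
  · exact (a2 hA hB).elim
  · exact ⟨e, Or.inr ⟨hA, hB⟩⟩
  · exact ⟨e.symm, Or.inl ⟨hB, by simpa using hA⟩⟩
  · exact (b2 hA hB).elim
  · exact absurd (hA.trans hB.symm) hse
  · exact (a3 hA hB).elim
  · exact (a4 hA hB).elim
  · exact ⟨e.symm, Or.inr ⟨hB, by simpa using hA⟩⟩
  · exact (b3 hA hB).elim
  · exact absurd (hA.trans hB.symm) hse

end CutLemma

/-! ### The spherical embedding as a cubic map -/

section Planar

variable {V : Type*} {G : SimpleGraph V}

/-- Each orbit of the rotation is the full set of darts at a vertex, hence has length three. -/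
theorem isCubicRotation_rot [Fintype V] [DecidableRel G.Adj] (hcubic : G.IsRegularOfDegree 3)
    (E : SurfaceEmbedding G) : IsCubicRotation E.rot := by
  classical
  have key : ∀ d, Function.minimalPeriod E.rot d = 3 := by
    intro d
    have h1 := dart_fst_fiber_card_eq_degree G d.fst
    rw [hcubic.degree_eq] at h1
    have h2 : (Finset.univ.filter fun d' : G.Dart => d'.fst = d.fst)
        = (Finset.range (Function.minimalPeriod E.rot d)).image fun i => (E.rot ^ i) d := by
      ext d'
      simp only [Finset.mem_filter, Finset.mem_univ, true_and, Finset.mem_image, Finset.mem_range]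
      constructor
      · intro h
        obtain ⟨i, -, hi⟩ := (E.rot_cyclic d d' h.symm).exists_pow_eq'
        refine ⟨i % Function.minimalPeriod E.rot d, Nat.mod_lt _ ?_, ?_⟩
        · exact Function.minimalPeriod_pos_of_mem_periodicPts
            (Function.Injective.mem_periodicPts E.rot.injective d)
        · rw [← hi, ← Equiv.Perm.iterate_eq_pow, ← Equiv.Perm.iterate_eq_pow,
            Function.iterate_mod_minimalPeriod_eq]
      · rintro ⟨i, -, rfl⟩
        induction i with
        | zero => rfl
        | succ i ih => rw [pow_succ', Equiv.Perm.mul_apply, E.rot_fst, ih]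
    rw [h2, Finset.card_image_of_injOn, Finset.card_range] at h1
    · exact h1
    · intro i hi j hj hij
      simp only [Finset.coe_range, Set.mem_Iio] at hi hj
      exact pow_injOn_minimalPeriod _ d hi hj hij
  refine ⟨E.rot_fst, ?_, ?_, ?_⟩
  · intro d hd
    have := Function.minimalPeriod_eq_one_iff_isFixedPt.2 hd
    rw [key] at this
    omega
  · intro d
    have := pow_minimalPeriod_apply E.rot d
    rw [key] at this
    exact this
  · intro d d' h
    obtain ⟨i, -, hi⟩ := (E.rot_cyclic d d' h.symm).exists_pow_eq'
    rw [← Equiv.Perm.iterate_eq_pow, ← Function.iterate_mod_minimalPeriod_eq, key] at hi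
    have : i % 3 < 3 := Nat.mod_lt _ (by norm_num)
    interval_cases i % 3
    · exact Or.inl hi.symm
    · exact Or.inr (Or.inl hi.symm)
    · exact Or.inr (Or.inr hi.symm)

/-- The face of an embedding that runs along a dart with the positive orientation. -/
def dartFace (E : SurfaceEmbedding G) (d : G.Dart) : E.Face := E.faceOf (d, 1)

variable {P : SurfaceEmbedding G}

theorem isGauge_one (hP : ∀ e, P.sign e = 1) : IsGauge P fun _ => 1 := fun d => by
  rw [SurfaceEmbedding.dartSign, hP, one_mul]

theorem twistRot_one (r : Equiv.Perm G.Dart) (hr : ∀ d, (r d).fst = d.fst) :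
    twistRot r hr (fun _ => 1) = r := by
  ext1 d
  simp [twistRot]

theorem gaugePerm_one : gaugePerm P (fun _ => 1) = facePerm P.rot := by
  rw [gaugePerm, twistRot_one]

theorem isCubicMap_dartFace [Fintype V] [DecidableRel G.Adj] (hcubic : G.IsRegularOfDegree 3)
    (hP : ∀ e, P.sign e = 1) : IsCubicMap P.rot (dartFace P) where
  rot := isCubicRotation_rot hcubic P
  face_iff d d' := by
    have := (isGauge_one hP).faceOf_eq_iff d d'
    rwa [gaugePerm_one] at this

theorem dartFace_surjective (hP : ∀ e, P.sign e = 1) : Function.Surjective (dartFace P) :=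
  (isGauge_one hP).exists_faceOf

theorem mem_edges_iff [Finite V] (hP : ∀ e, P.sign e = 1) (f : P.Face) (e : Sym2 V) :
    e ∈ f.edges ↔ ∃ d, dartFace P d = f ∧ d.edge = e := by
  obtain ⟨d, rfl⟩ := dartFace_surjective hP f
  rw [show dartFace P d = P.faceOf (gaugeFlag P (fun _ => 1) d) from rfl,
    (isGauge_one hP).mem_edges_iff]
  refine exists_congr fun d' => and_congr_left fun _ => ?_
  rw [← (isGauge_one hP).faceOf_eq_iff, eq_comm]
  rfl

theorem mem_verts_iff [Finite V] (hP : ∀ e, P.sign e = 1) (f : P.Face) (v : V) :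
    v ∈ f.verts ↔ ∃ d, dartFace P d = f ∧ d.fst = v := by
  obtain ⟨d, rfl⟩ := dartFace_surjective hP f
  rw [show dartFace P d = P.faceOf (gaugeFlag P (fun _ => 1) d) from rfl,
    (isGauge_one hP).mem_verts_iff]
  refine exists_congr fun d' => and_congr_left fun _ => ?_
  rw [← (isGauge_one hP).faceOf_eq_iff, eq_comm]
  rfl

theorem length_dartFace (hP : ∀ e, P.sign e = 1) (d : G.Dart) :
    (dartFace P d).length = Function.minimalPeriod (facePerm P.rot) d := by
  rw [← gaugePerm_one]
  exact (isGauge_one hP).length_faceOf d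

instance finite_face [Finite V] (E : SurfaceEmbedding G) : Finite E.Face := by
  have hfin : Finite G.Dart := Finite.of_injective _ (Dart.toProd_injective (G := G))
  exact Quotient.finite _

theorem IsKConnected.connected [Fintype V] {k : ℕ} (hk : 0 < k) (h : G.IsKConnected k) :
    G.Connected := by
  have := h.2 ∅ (by simpa using hk)
  have hs : {v : V | v ∉ (∅ : Finset V)} = Set.univ := by ext; simp
  rw [hs] at this
  exact (induceUnivIso G).connected_iff.1 this

theorem isHomologySphere_dartFace [Fintype V] [DecidableRel G.Adj]
    (hconn : G.Connected) (hcubic : G.IsRegularOfDegree 3) (hP : P.IsPlanar) :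
    IsHomologySphere P.rot (dartFace P) := by
  refine (isCubicMap_dartFace hcubic hP.1).isHomologySphere hcubic hconn
    (dartFace_surjective hP.1) ?_
  have := hP.2
  rw [SurfaceEmbedding.eulerChar] at this
  omega

end Planar

/-! ### Whitney's theorem for cubic graphs -/

section Whitney

variable {V : Type*} {G : SimpleGraph V} {Φ Φ' : Type*}
variable {r r' : Equiv.Perm G.Dart} {F : G.Dart → Φ} {F' : G.Dart → Φ'}

/-- The vertices on a face. -/
def faceVerts (F : G.Dart → Φ) (f : Φ) : Set V := {v | ∃ d, F d = f ∧ d.fst = v}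

theorem fst_mem_faceVerts (d : G.Dart) : d.fst ∈ faceVerts F (F d) := ⟨d, rfl, rfl⟩

theorem IsCubicMap.snd_mem_faceVerts (h : IsCubicMap r F) (d : G.Dart) :
    d.snd ∈ faceVerts F (F d) := ⟨facePerm r d, h.apply_facePerm d, h.rot.facePerm_fst d⟩

theorem IsCubicMap.fst_mem_faceVerts_symm (h : IsCubicMap r F) (d : G.Dart) :
    d.fst ∈ faceVerts F (F d.symm) := h.snd_mem_faceVerts d.symm

/-- Faces have no chords. -/
theorem IsPolyhedral.eq_or_eq_of_mem (h : IsPolyhedral r F) {f : Φ} {d : G.Dart}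
    (h1 : d.fst ∈ faceVerts F f) (h2 : d.snd ∈ faceVerts F f) : F d = f ∨ F d.symm = f := by
  obtain ⟨a, rfl, ha⟩ := h1
  obtain ⟨b, hab, hb⟩ := h2
  by_contra! hcon
  have e1 : F a = F (r (r d)) := by
    rcases h.toIsCubicMap.eq_of_fst_eq ha with e | e | e
    · exact absurd e.symm hcon.1
    · exact absurd e.symm hcon.2
    · exact e
  have e2 : F b = F (r (r d.symm)) := by
    rcases h.toIsCubicMap.eq_of_fst_eq (d := d.symm) hb with e | e | e
    · rw [hab] at e; exact absurd e.symm hcon.2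
    · rw [hab, Dart.symm_symm] at e; exact absurd e.symm hcon.1
    · exact e
  -- If the edge is not on `f`, then `f` is the third face at both of its ends. The two edges that
  -- separate `f` from `F d` there coincide by `inj`, which gives an edge parallel to `d`.
  have key : r (r d) = (r d.symm).symm := by
    refine h.inj _ _ ?_ ?_
    · rw [← e1, ← hab, e2, h.apply_rot_rot]
    · rw [h.apply_rot_rot_symm, Dart.symm_symm, h.apply_rot, Dart.symm_symm]
  refine h.rot.apply_apply_ne d (Dart.ext _ _ (Prod.ext ?_ ?_))
  · rw [h.rot.fst_apply, h.rot.fst_apply]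
  · rw [key]; exact h.rot.fst_apply d.symm

/-- The vertices outside a face are connected to each other outside the face. -/
theorem IsPolyhedral.eq_of_notMem [Fintype G.Dart] (h : IsPolyhedral r F) (hG : G.Connected)
    (f : Φ) (p : V → ZMod 2)
    (hp : ∀ d : G.Dart, d.fst ∉ faceVerts F f → d.snd ∉ faceVerts F f → p d.fst = p d.snd)
    {u v : V} (hu : u ∉ faceVerts F f) (hv : v ∉ faceVerts F f) : p u = p v := by
  classical
  have hout : ∀ d, F d = f → (r d).snd ∉ faceVerts F f := by
    rintro d rfl hmem
    rcases h.eq_or_eq_of_mem (d := r d) (by rw [h.rot.fst_apply]; exact fst_mem_faceVerts d) hmem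
      with e | e
    · rw [h.apply_rot] at e
      exact h.symm_ne d e.symm
    · rw [← h.apply_rot] at e
      apply h.symm_ne (r (r d))
      rw [h.apply_rot_rot_symm, e]
  have hcross : ∀ d : G.Dart, d.fst ∈ faceVerts F f → d.snd ∉ faceVerts F f →
      ∃ a, F a = f ∧ d = r a := by
    rintro d ⟨a, rfl, ha⟩ hd
    refine ⟨a, rfl, ?_⟩
    rcases h.rot.cases a d ha.symm with e | e | e
    · subst e
      exact absurd (h.snd_mem_faceVerts d) hd
    · exact e
    · refine absurd ?_ hd
      have := fst_mem_faceVerts (F := F) (r (r a)).symm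
      rw [h.apply_rot_rot_symm] at this
      rw [e]; exact this
  -- The edges leaving `f` at the two ends of `d` both lie on `F d.symm`. Follow that face with `p`
  -- set to zero on `f`: it meets `f` only along `d`, so these two edges are the only ones that
  -- contribute to the coboundary sum.
  have hstep : ∀ d, F d = f → p (r d).snd = p (r (facePerm r d)).snd := by
    rintro d rfl
    set q : V → ZMod 2 := fun v => if v ∈ faceVerts F (F d) then 0 else p v with hq
    have hsum := sum_face_coboundary h.toIsCubicMap q (F d.symm)
    have hd' : F (facePerm r d) = F d := h.apply_facePerm d
    have hne : r d ≠ (r (facePerm r d)).symm := by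
      intro e
      refine hout d rfl ?_
      rw [e]
      change (r (facePerm r d)).fst ∈ _
      rw [h.rot.fst_apply, ← hd']
      exact fst_mem_faceVerts _
    have hF1 : F (r d) = F d.symm := h.apply_rot d
    have hF2 : F (r (facePerm r d)).symm = F d.symm := by
      rw [facePerm_apply, h.apply_rot_rot_symm]
    rw [← Finset.sum_subset (s₁ := {r d, (r (facePerm r d)).symm}), Finset.sum_pair hne] at hsum
    · have a1 : (r d).fst ∈ faceVerts F (F d) := by
        rw [h.rot.fst_apply]; exact fst_mem_faceVerts d
      have a2 : (r (facePerm r d)).fst ∈ faceVerts F (F d) := by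
        rw [h.rot.fst_apply, ← hd']; exact fst_mem_faceVerts _
      have a3 := hout d rfl
      have a4 := hout _ hd'
      have e : q (r d).fst + q (r d).snd + (q (r (facePerm r d)).snd + q (r (facePerm r d)).fst)
          = 0 := hsum
      simp only [hq, a1, a2, a3, a4, if_true, if_false] at e
      have hz : ∀ x y : ZMod 2, 0 + x + (y + 0) = 0 → x = y := by decide
      exact hz _ _ e
    · intro x hx
      simp only [Finset.mem_insert, Finset.mem_singleton] at hx
      simp only [Finset.mem_filter, Finset.mem_univ, true_and]
      rcases hx with rfl | rfl
      · exact hF1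
      · exact hF2
    · intro x hx hx'
      simp only [Finset.mem_insert, Finset.mem_singleton, not_or] at hx'
      simp only [Finset.mem_filter, Finset.mem_univ, true_and] at hx
      by_cases b1 : x.fst ∈ faceVerts F (F d) <;> by_cases b2 : x.snd ∈ faceVerts F (F d)
      · simp [hq, b1, b2]
      · obtain ⟨a, ha, rfl⟩ := hcross x b1 b2
        rw [h.apply_rot] at hx
        exact absurd (by rw [h.inj a d ha hx]) hx'.1
      · obtain ⟨a, ha, hxa⟩ := hcross x.symm b2 b1
        have : (r (r a)).symm = d := by
          refine h.inj _ _ ?_ ?_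
          · rw [h.apply_rot_rot_symm, ha]
          · rw [Dart.symm_symm, h.apply_rot_rot, ← hxa, Dart.symm_symm, hx]
        refine absurd ?_ hx'.2
        rw [facePerm_apply, ← this, Dart.symm_symm, h.rot.cube, ← hxa, Dart.symm_symm]
      · simp only [hq, b1, b2, if_false]
        rw [hp x b1 b2, CharTwo.add_self_eq_zero]
  have hconst : ∀ d d', F d = f → F d' = f → p (r d).snd = p (r d').snd := by
    intro d d' hd hd'
    obtain ⟨n, -, hn⟩ := ((h.face_iff _ _).1 (hd.trans hd'.symm)).exists_pow_eq'
    rw [← hn]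
    have hF : ∀ m : ℕ, F (((facePerm r) ^ m) d) = f := by
      intro m
      rw [← hd, eq_comm, h.face_iff]
      exact ⟨m, by simp⟩
    clear hn
    induction n with
    | zero => rfl
    | succ n ih => rw [ih, pow_succ', Equiv.Perm.mul_apply, ← hstep _ (hF n)]
  -- All edges leaving `f` lead to the same value of `p`. Assigning that value to the vertices of
  -- `f` extends `p` to the connected graph `G`.
  by_cases hf : ∃ d₀, F d₀ = f
  · obtain ⟨d₀, hd₀⟩ := hf
    have := eq_of_forall_dart hG
      (fun v => if v ∈ faceVerts F f then p (r d₀).snd else p v) (fun d => by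
        by_cases b1 : d.fst ∈ faceVerts F f <;> by_cases b2 : d.snd ∈ faceVerts F f
        · simp [b1, b2]
        · obtain ⟨a, ha, rfl⟩ := hcross d b1 b2
          simp only [b1, b2, if_true, if_false]
          exact hconst _ _ hd₀ ha
        · obtain ⟨a, ha, hda⟩ := hcross d.symm b2 b1
          simp only [b1, b2, if_true, if_false]
          have := hconst _ _ hd₀ ha
          rw [← hda] at this
          exact this.symm
        · simp only [b1, b2, if_false]
          exact hp d b1 b2) u v
    simpa [hu, hv] using this
  · have hn : ∀ w, w ∉ faceVerts F f := fun w ⟨d, hd, _⟩ => hf ⟨d, hd⟩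
    exact eq_of_forall_dart hG p (fun d => hp d (hn _) (hn _)) u v

/-- Local form of Whitney's theorem: two rotation systems, one on the sphere and one polyhedral,
cannot agree at one end of an edge and differ at the other end. -/
theorem IsPolyhedral.rot_symm_eq [Fintype V] [DecidableRel G.Adj]
    (hcubic : G.IsRegularOfDegree 3) (h' : IsPolyhedral r' F') (h : IsHomologySphere r F)
    (a : G.Dart) (ha : r' a = r a) : r' a.symm = r a.symm := by
  classical
  by_contra hs
  have hs : r' a.symm = r (r a.symm) := by
    rcases h.rot.cases a.symm (r' a.symm) (h'.rot.fst_apply _) with e | e | e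
    · exact absurd e (h'.rot.apply_ne _)
    · exact absurd e hs
    · exact e
  have hs2 : r' (r' a.symm) = r a.symm := by
    rcases h.rot.cases a.symm (r' (r' a.symm))
      (by rw [h'.rot.fst_apply, h'.rot.fst_apply]) with e | e | e
    · exact absurd e (h'.rot.apply_apply_ne _)
    · exact e
    · rw [← hs] at e; exact absurd e (h'.rot.apply_ne _)
  -- A Jordan curve argument: the boundary of `F' a` is a cycle of `G`, so on the sphere of `r` it
  -- separates the faces into two classes, told apart by `y`.
  obtain ⟨y, hy⟩ := h.cycle
    (fun d => (if F' d = F' a then 1 else 0) + (if F' d.symm = F' a then 1 else 0))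
    (fun _ => by rw [Dart.symm_symm, add_comm])
    (fun _ => sum_star_coboundary h'.toIsCubicMap (fun f => if f = F' a then 1 else 0) _)
  have hzero : ∀ d, F' d ≠ F' a → F' d.symm ≠ F' a → y (F d) = y (F d.symm) := by
    intro d h1 h2
    have := hy d
    simp only [h1, h2, if_false, add_zero] at this
    exact CharTwo.add_eq_zero.1 this.symm
  have hone : y (F a) ≠ y (F a.symm) := by
    have := hy a
    simp only [(h'.symm_ne a).symm, if_true, if_false, add_zero] at this
    intro e
    rw [e, CharTwo.add_self_eq_zero] at this
    exact one_ne_zero this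
  choose δ hδ using exists_dart_fst hcubic
  have hvert : ∀ d : G.Dart, d.fst ∉ faceVerts F' (F' a) → y (F d) = y (F d.symm) := by
    intro d hd
    refine hzero d (fun e => hd ?_) (fun e => hd ?_)
    · rw [← e]; exact fst_mem_faceVerts d
    · rw [← e]; exact h'.fst_mem_faceVerts_symm d
  have hδy : ∀ d : G.Dart, d.fst ∉ faceVerts F' (F' a) → y (F (δ d.fst)) = y (F d) := by
    intro d hd
    rcases h.rot.cases d (δ d.fst) (hδ _) with e | e | e
    · rw [e]
    · rw [e, h.apply_rot, hvert d hd]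
    · rw [e, h.apply_rot_rot, ← hvert (r d) (by rw [h.rot.fst_apply]; exact hd), h.apply_rot,
        hvert d hd]
  have hconst := fun u v => h'.eq_of_notMem h.connected (F' a) (fun v => y (F (δ v)))
    (fun d h1 h2 => by
      rw [hδy d h1, hvert d h1]
      exact (hδy d.symm h2).symm) (u := u) (v := v)
  have hb1 : F' (r' a) ≠ F' a := by rw [h'.apply_rot]; exact (h'.symm_ne a).symm
  have hb2 : F' (r' a).symm ≠ F' a := by
    intro e
    rw [← h'.apply_rot] at e
    apply h'.symm_ne (r' (r' a))
    rw [h'.apply_rot_rot_symm, e]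
  have hc1 : F' (r' (r' a.symm)) ≠ F' a := by
    intro e
    rw [h'.apply_rot] at e
    apply h'.symm_ne (r' a.symm)
    rw [e, h'.apply_rot, Dart.symm_symm]
  have hc2 : F' (r' (r' a.symm)).symm ≠ F' a := by
    rw [h'.apply_rot_rot_symm]; exact (h'.symm_ne a).symm
  have hbs : (r' a).snd ∉ faceVerts F' (F' a) := by
    intro e
    rcases h'.eq_or_eq_of_mem (d := r' a)
      (by rw [h'.rot.fst_apply]; exact fst_mem_faceVerts a) e with e | e
    · exact hb1 e
    · exact hb2 e
  have hcs : (r' (r' a.symm)).snd ∉ faceVerts F' (F' a) := by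
    intro e
    rcases h'.eq_or_eq_of_mem (d := r' (r' a.symm))
      (by rw [h'.rot.fst_apply, h'.rot.fst_apply]; exact h'.snd_mem_faceVerts a) e with e | e
    · exact hc1 e
    · exact hc2 e
  -- The third edges at the two ends of `a` lead to opposite sides of the curve, as the rotations
  -- agree at one end only. But the vertices off the curve are connected to each other off the
  -- curve.
  have key := hconst _ _ hbs hcs
  have k1 := hδy (r' a).symm hbs
  have k2 := hδy (r' (r' a.symm)).symm hcs
  rw [← hzero _ hb1 hb2, ha, h.apply_rot] at k1
  rw [← hzero _ hc1 hc2, hs2, h.apply_rot, Dart.symm_symm] at k2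
  rw [← ha] at k1
  rw [← hs2] at k2
  exact hone (k2.symm.trans (key.symm.trans k1))

/-- Whitney's theorem for cubic graphs: a polyhedral rotation system agrees with a spherical one
up to a reflection. -/
theorem IsPolyhedral.eq_or_eq_symm [Fintype V] [DecidableRel G.Adj]
    (hcubic : G.IsRegularOfDegree 3) (h' : IsPolyhedral r' F') (h : IsHomologySphere r F) :
    (∀ d, r' d = r d) ∨ (∀ d, r' d = r (r d)) := by
  choose δ hδ using exists_dart_fst hcubic
  have hcase : ∀ d, r' d = r d ∨ r' d = r (r d) := by
    intro d
    rcases h.rot.cases d (r' d) (h'.rot.fst_apply _) with e | e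
    · exact absurd e (h'.rot.apply_ne _)
    · exact e
  have hrot : ∀ d, r' d = r d → r' (r d) = r (r d) := by
    intro d hd
    rcases hcase (r d) with e | e
    · exact e
    · rw [h.rot.cube, ← hd] at e
      exact absurd e (h'.rot.apply_apply_ne _)
  have hvert : ∀ d d' : G.Dart, d'.fst = d.fst → r' d = r d → r' d' = r d' := by
    intro d d' hdd hd
    rcases h.rot.cases d d' hdd with rfl | rfl | rfl
    · exact hd
    · exact hrot _ hd
    · exact hrot _ (hrot _ hd)
  have hconst := eq_of_forall_dart h.connected (fun v => r' (δ v) = r (δ v)) (fun d => by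
    refine propext ⟨fun e => ?_, fun e => ?_⟩
    · exact hvert d.symm _ (hδ _) (h'.rot_symm_eq hcubic h d (hvert _ _ (hδ _).symm e))
    · refine hvert d _ (hδ _) ?_
      have := h'.rot_symm_eq hcubic h d.symm (hvert _ d.symm (hδ _).symm e)
      simpa using this)
  by_cases hd : ∃ d, r' d = r d
  · obtain ⟨d, hd⟩ := hd
    left
    intro d'
    refine hvert (δ d'.fst) _ (hδ _).symm ?_
    have := hconst d.fst d'.fst
    rw [← this]
    exact hvert _ _ (hδ _) hd
  · right
    intro d
    exact (hcase d).resolve_left fun e => hd ⟨d, e⟩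

/-- The permutation of the darts induced by an automorphism. -/
def dartMap (φ : G ≃g G) : Equiv.Perm G.Dart where
  toFun d := ⟨(φ d.fst, φ d.snd), φ.map_adj_iff.2 d.adj⟩
  invFun d := ⟨(φ.symm d.fst, φ.symm d.snd), φ.symm.map_adj_iff.2 d.adj⟩
  left_inv _ := Dart.ext _ _ (Prod.ext (φ.symm_apply_apply _) (φ.symm_apply_apply _))
  right_inv _ := Dart.ext _ _ (Prod.ext (φ.apply_symm_apply _) (φ.apply_symm_apply _))

theorem dartMap_symm (φ : G ≃g G) (d : G.Dart) : dartMap φ d.symm = (dartMap φ d).symm := rfl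

theorem dartMap_fst (φ : G ≃g G) (d : G.Dart) : (dartMap φ d).fst = φ d.fst := rfl

theorem dartMap_inv_fst (φ : G ≃g G) (d : G.Dart) : ((dartMap φ)⁻¹ d).fst = φ.symm d.fst := rfl

theorem perm_apply_inv {α : Type*} (f : Equiv.Perm α) (x : α) : f (f⁻¹ x) = x :=
  f.apply_symm_apply x

theorem perm_inv_apply {α : Type*} (f : Equiv.Perm α) (x : α) : f⁻¹ (f x) = x :=
  f.symm_apply_apply x

/-- The pull-back of the spherical rotation is the second rotation system to which Whitney's theorem
is applied. -/
theorem IsPolyhedral.conj (h : IsPolyhedral r F) (φ : G ≃g G) :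
    IsPolyhedral ((dartMap φ)⁻¹ * r * dartMap φ) (F ∘ dartMap φ) where
  rot := by
    refine ⟨fun d => ?_, fun d hd => ?_, fun d => ?_, fun d d' hd => ?_⟩
    · rw [Equiv.Perm.mul_apply, Equiv.Perm.mul_apply, dartMap_inv_fst, h.rot.fst_apply,
        dartMap_fst, φ.symm_apply_apply]
    · rw [Equiv.Perm.mul_apply, Equiv.Perm.mul_apply, Equiv.Perm.inv_eq_iff_eq] at hd
      exact h.rot.apply_ne _ hd
    · simp only [Equiv.Perm.mul_apply, perm_apply_inv, h.rot.cube,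
        perm_inv_apply]
    · simp only [Equiv.Perm.mul_apply, perm_apply_inv, Equiv.Perm.eq_inv_iff_eq]
      have := h.rot.cases (dartMap φ d) (dartMap φ d') (by rw [dartMap_fst, dartMap_fst, hd])
      rwa [(dartMap φ).injective.eq_iff] at this
  face_iff d d' := by
    have : facePerm ((dartMap φ)⁻¹ * r * dartMap φ)
        = (dartMap φ)⁻¹ * facePerm r * (dartMap φ)⁻¹⁻¹ := by
      ext1 x
      simp only [facePerm_apply, Equiv.Perm.mul_apply, dartMap_symm, inv_inv]
    rw [this, Equiv.Perm.sameCycle_conj, inv_inv]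
    exact h.face_iff _ _
  symm_ne _ := h.symm_ne _
  inj _ _ h1 h2 := (dartMap φ).injective (h.inj _ _ h1 h2)

/-- Automorphisms preserve the rotation system of the sphere up to a reflection. -/
theorem dartMap_rot [Fintype V] [DecidableRel G.Adj]
    (hcubic : G.IsRegularOfDegree 3) (hp : IsPolyhedral r F) (h : IsHomologySphere r F)
    (φ : G ≃g G) :
    (∀ d, dartMap φ (r d) = r (dartMap φ d)) ∨ (∀ d, dartMap φ (r d) = r (r (dartMap φ d))) := by
  have hconj : ∀ d, r (dartMap φ d) = dartMap φ (((dartMap φ)⁻¹ * r * dartMap φ) d) := fun d => by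
    rw [Equiv.Perm.mul_apply, Equiv.Perm.mul_apply, perm_apply_inv]
  rcases (hp.conj φ).eq_or_eq_symm hcubic h with e | e
  · left
    intro d
    rw [hconj, e]
  · right
    intro d
    rw [hconj d, e, hconj (r (r d)), e, h.rot.cube]

end Whitney

/-! ### Reversing the rotation on a region: the new faces -/

section Disk

variable {V : Type*} {G : SimpleGraph V} {Φ : Type*}
variable {r : Equiv.Perm G.Dart} {F : G.Dart → Φ} {S : Set Φ}

/-- The vertices on the faces of `S`. -/
def region (F : G.Dart → Φ) (S : Set Φ) : Set V := {v | ∃ f ∈ S, v ∈ faceVerts F f}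

/-- The faces outside `S` that share an edge with a face of `S`. -/
def rim (F : G.Dart → Φ) (S : Set Φ) : Set Φ := {g | g ∉ S ∧ ∃ d, F d ∈ S ∧ F d.symm = g}

open Classical in
/-- The gauge that is negative exactly on the vertices of `S`. -/
noncomputable def regionSign (F : G.Dart → Φ) (S : Set Φ) (v : V) : ℤˣ :=
  if v ∈ region F S then -1 else 1

/-- The faces of the embedding obtained by reversing the rotation at all vertices of `S`. -/
noncomputable def twistPerm (h : IsCubicMap r F) (S : Set Φ) : Equiv.Perm G.Dart :=
  facePerm (twistRot r h.rot.fst_apply (regionSign F S))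

/-- The closed faces of `S` form a region without chords whose rim is not self-adjacent except
across the edges that leave the region. -/
structure IsDisk (F : G.Dart → Φ) (S : Set Φ) : Prop where
  inner : ∀ d, d.fst ∈ region F S → d.snd ∈ region F S → F d ∈ S ∨ F d.symm ∈ S
  outer : ∀ d, F d ∈ rim F S → F d.symm ∈ rim F S → d.fst ∈ region F S ∨ d.snd ∈ region F S

theorem IsCubicMap.twistPerm_of_mem (h : IsCubicMap r F) {d : G.Dart} (hd : d.snd ∈ region F S) :
    twistPerm h S d = r (r d.symm) := by
  have : d.symm.fst ∈ region F S := hd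
  rw [twistPerm, facePerm_apply, h.rot.twistRot_apply, regionSign, if_pos this, if_neg (by decide)]

theorem IsCubicMap.twistPerm_of_notMem (h : IsCubicMap r F) {d : G.Dart}
    (hd : d.snd ∉ region F S) : twistPerm h S d = facePerm r d := by
  have : d.symm.fst ∉ region F S := hd
  rw [twistPerm, facePerm_apply, h.rot.twistRot_apply, regionSign, if_neg this, if_pos rfl,
    facePerm_apply]

theorem fst_mem_region {d : G.Dart} (hd : F d ∈ S) : d.fst ∈ region F S :=
  ⟨_, hd, fst_mem_faceVerts d⟩

theorem IsCubicMap.snd_mem_region (h : IsCubicMap r F) {d : G.Dart} (hd : F d ∈ S) :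
    d.snd ∈ region F S := ⟨_, hd, h.snd_mem_faceVerts d⟩

theorem IsCubicMap.exists_rot_eq (h : IsCubicMap r F) {d : G.Dart} (h1 : d.fst ∈ region F S)
    (h2 : d.snd ∉ region F S) : ∃ a, F a ∈ S ∧ F (r (r a)).symm ∈ S ∧ d = r a := by
  obtain ⟨f, hf, a, rfl, ha⟩ := h1
  refine ⟨a, hf, by rwa [h.apply_rot_rot_symm], ?_⟩
  rcases h.rot.cases a d ha.symm with e | e | e
  · subst e
    exact absurd (h.snd_mem_region hf) h2
  · exact e
  · refine absurd ?_ h2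
    have : F (r (r a)).symm ∈ S := by rwa [h.apply_rot_rot_symm]
    rw [e]
    exact fst_mem_region this

theorem IsCubicMap.mem_rim (h : IsCubicMap r F) {d : G.Dart} (h1 : d.fst ∈ region F S)
    (h2 : d.snd ∉ region F S) : F d ∈ rim F S ∧ F d.symm ∈ rim F S := by
  obtain ⟨a, ha, ha', rfl⟩ := h.exists_rot_eq h1 h2
  refine ⟨⟨fun h' => h2 (h.snd_mem_region h'), a, ha, (h.apply_rot a).symm⟩,
    ⟨fun h' => h2 (fst_mem_region h'), (r (r a)).symm, ha', ?_⟩⟩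
  rw [Dart.symm_symm, h.apply_rot_rot]

open Classical in
/-- The label of a dart, constant on the faces of the twisted embedding. -/
noncomputable def label (F : G.Dart → Φ) (S : Set Φ) (κ : Φ → ZMod 2) (d : G.Dart) :
    Φ ⊕ ZMod 2 :=
  -- Inside the region the reversed rotation follows the face behind the dart, `F d.symm`,
  -- backwards. If that is a rim face, the twisted walk leaves it at the next crossing edge for a
  -- neighbouring rim face; hence the opposite colour.
  if d.fst ∈ region F S ∧ d.snd ∈ region F S then
    if F d.symm ∈ S then Sum.inl (F d.symm) else Sum.inr (1 + κ (F d.symm))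
  else
    if F d ∈ rim F S then Sum.inr (κ (F d)) else Sum.inl (F d)

/-- The faces on the two sides of each edge leaving the region have different colours. -/
def IsColouring (F : G.Dart → Φ) (S : Set Φ) (κ : Φ → ZMod 2) : Prop :=
  ∀ d, d.fst ∈ region F S → d.snd ∉ region F S → κ (F d) ≠ κ (F d.symm)

variable {κ : Φ → ZMod 2}

theorem zmod_two_eq {a b : ZMod 2} (h : a ≠ b) : a = 1 + b := by
  revert a b; decide

theorem label_twistPerm (h : IsCubicMap r F) (hκ : IsColouring F S κ) (d : G.Dart) :
    label F S κ (twistPerm h S d) = label F S κ d := by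
  by_cases h2 : d.snd ∈ region F S
  · rw [h.twistPerm_of_mem h2]
    have hf : (r (r d.symm)).fst = d.snd := by rw [h.rot.fst_apply, h.rot.fst_apply]; rfl
    have hF : F (r (r d.symm)).symm = F d.symm := h.apply_rot_rot_symm _
    by_cases h1 : d.fst ∈ region F S
    · by_cases h3 : (r (r d.symm)).snd ∈ region F S
      · by_cases hs' : F d.symm ∈ S <;> simp [label, hf, h1, h2, h3, hF, hs']
      · have hr := h.mem_rim (hf ▸ h2) h3
        have hk := hκ _ (hf ▸ h2) h3
        have hS : F d.symm ∉ S := hF ▸ hr.2.1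
        simp only [label, hf, h1, h2, h3, hr.1, hS, and_false, and_self, if_true, if_false]
        rw [zmod_two_eq hk, hF]
    · obtain ⟨a, ha, -, hda⟩ := h.exists_rot_eq (d := d.symm) h2 h1
      have ha' : r (r d.symm) = a := by rw [hda, h.rot.cube]
      have hr := h.mem_rim (d := d.symm) h2 h1
      have hk := hκ d.symm h2 h1
      have hS : F d.symm ∉ S := hr.1.1
      rw [Dart.symm_symm] at hr hk
      rw [ha'] at hF ⊢
      have u1 := fst_mem_region ha
      have u2 := h.snd_mem_region ha
      simp only [label, h1, h2, u1, u2, hF, hS, hr.2, false_and, and_self, if_true, if_false]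
      rw [zmod_two_eq hk.symm]
  · rw [h.twistPerm_of_notMem h2]
    have hf : (facePerm r d).fst ∉ region F S := by rwa [h.rot.facePerm_fst]
    by_cases hs' : F d ∈ rim F S <;> simp only [label, hf, h2, false_and, and_false, if_false,
      h.apply_facePerm, hs', if_true]

/-- An edge inside the region has a face of `S` on some side by `inner`, a crossing edge has rim
faces of both colours beside it, and an outside edge does not have rim faces on both sides by
`outer`. As labels are constant along twisted walks, no walk runs through both sides of an edge. -/
theorem label_symm_ne (h : IsPolyhedral r F) (hS : IsDisk F S) (hκ : IsColouring F S κ)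
    (d : G.Dart) : label F S κ d ≠ label F S κ d.symm := by
  have hcross : ∀ d : G.Dart, d.fst ∈ region F S → d.snd ∉ region F S →
      label F S κ d ≠ label F S κ d.symm := by
    intro d h1 h2
    have hr := h.mem_rim h1 h2
    have h1' : d.symm.snd ∈ region F S := h1
    have h2' : d.symm.fst ∉ region F S := h2
    simp only [label, h1, h1', h2, h2', hr.1, hr.2, and_false, false_and, if_true, if_false]
    simpa using hκ d h1 h2
  by_cases h1 : d.fst ∈ region F S <;> by_cases h2 : d.snd ∈ region F S
  · have h1' : d.symm.snd ∈ region F S := h1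
    have h2' : d.symm.fst ∈ region F S := h2
    simp only [label, h1, h1', h2, h2', and_self, if_true, Dart.symm_symm]
    have := hS.inner d h1 h2
    by_cases a : F d ∈ S <;> by_cases b : F d.symm ∈ S <;> simp [a, b]
    · exact (h.symm_ne d).symm
    · tauto
  · exact hcross d h1 h2
  · have := hcross d.symm h2 h1
    rw [Dart.symm_symm] at this
    exact this.symm
  · have h1' : d.symm.snd ∉ region F S := h1
    have h2' : d.symm.fst ∉ region F S := h2
    simp only [label, h1, h2', false_and, if_false]
    have := hS.outer d
    by_cases a : F d ∈ rim F S <;> by_cases b : F d.symm ∈ rim F S <;> simp [a, b]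
    · tauto
    · exact h.symm_ne d

theorem label_eq_of_sameCycle [Finite G.Dart] (h : IsCubicMap r F) (hκ : IsColouring F S κ)
    {d d' : G.Dart} (hs : (twistPerm h S).SameCycle d d') :
    label F S κ d = label F S κ d' := by
  obtain ⟨n, -, rfl⟩ := hs.exists_pow_eq'
  induction n with
  | zero => rfl
  | succ n ih =>
    rw [pow_succ', Equiv.Perm.mul_apply, label_twistPerm h hκ]
    exact ih ⟨n, by simp⟩

theorem IsDisk.isTwoSided [Finite G.Dart] (h : IsPolyhedral r F) (hS : IsDisk F S)
    (hκ : IsColouring F S κ) :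
    IsTwoSided (twistRot r h.rot.fst_apply (regionSign F S)) := fun d hd =>
  label_symm_ne h hS hκ d (label_eq_of_sameCycle h.toIsCubicMap hκ hd)

/-- A relation that holds along a face between consecutive darts holds between any two. -/
theorem IsCubicMap.sameCycle_of_step [Finite G.Dart] (h : IsCubicMap r F) {α : Type*}
    (ψ : Equiv.Perm α) (g : G.Dart → α) {f : Φ}
    (hstep : ∀ d, F d = f → ψ.SameCycle (g d) (g (facePerm r d)))
    {d d' : G.Dart} (hd : F d = f) (hd' : F d' = f) : ψ.SameCycle (g d) (g d') := by
  obtain ⟨n, -, rfl⟩ := ((h.face_iff _ _).1 (hd.trans hd'.symm)).exists_pow_eq'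
  clear hd'
  induction n with
  | zero => exact Equiv.Perm.SameCycle.refl _ _
  | succ n ih =>
    refine ih.trans ?_
    rw [pow_succ', Equiv.Perm.mul_apply]
    refine hstep _ ?_
    rw [← hd, eq_comm, h.face_iff]
    exact ⟨n, by simp⟩

/-- Along the twisted face, a dart outside the region on a rim face leads back to the region. -/
theorem IsCubicMap.exists_return [Finite G.Dart] (h : IsCubicMap r F) {d : G.Dart}
    (hd : ¬ (d.fst ∈ region F S ∧ d.snd ∈ region F S)) (hr : F d ∈ rim F S) :
    ∃ z, F z = F d ∧ z.fst ∈ region F S ∧ z.snd ∈ region F S ∧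
      (twistPerm h S).SameCycle d (r z) ∧ F (r z) ∈ S ∧ F (r z).symm ∉ S := by
  obtain ⟨hnS, b, hb, hbd⟩ := hr
  have hz : F d = F b.symm := hbd.symm
  obtain ⟨n, -, hn⟩ := ((h.face_iff _ _).1 hz).exists_pow_eq'
  have hbU : (((facePerm r) ^ n) d).fst ∈ region F S ∧ (((facePerm r) ^ n) d).snd ∈ region F S := by
    rw [hn]; exact ⟨h.snd_mem_region hb, fst_mem_region hb⟩
  clear hn hbd hz
  induction n generalizing d with
  | zero => exact absurd hbU hd
  | succ n ih =>
    -- When `d` enters the region, the rim face continues with `z = r (r a)`, whereas the twisted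
    -- walk turns to the inner side, onto `a = r z`.
    by_cases h2 : d.snd ∈ region F S
    · have h1 : d.fst ∉ region F S := fun h1 => hd ⟨h1, h2⟩
      obtain ⟨a, ha, ha', hda⟩ := h.exists_rot_eq (d := d.symm) h2 h1
      have hra : facePerm r d = r (r a) := by rw [facePerm_apply, hda]
      have haa : a = r (r d.symm) := by rw [hda, h.rot.cube]
      have hr := h.mem_rim (d := d.symm) h2 h1
      refine ⟨facePerm r d, h.apply_facePerm d, ?_, ?_, ?_, ?_, ?_⟩
      · rw [hra]; exact h.snd_mem_region ha'
      · rw [hra]; exact fst_mem_region ha'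
      · rw [hra, h.rot.cube, haa, ← h.twistPerm_of_mem h2, Equiv.Perm.sameCycle_apply_right]
      · rw [hra, h.rot.cube]; exact ha
      · rw [hra, h.rot.cube, haa, h.apply_rot_rot_symm]; exact hr.1.1
    · have hf : (facePerm r d).fst ∉ region F S := by rwa [h.rot.facePerm_fst]
      obtain ⟨z, hz, z1, z2, z3, z4, z5⟩ := ih (d := facePerm r d) (fun h' => hf h'.1)
        (by rwa [h.apply_facePerm]) (by rwa [pow_succ, Equiv.Perm.mul_apply] at hbU)
      rw [h.apply_facePerm] at hz
      rw [← h.twistPerm_of_notMem h2, Equiv.Perm.sameCycle_apply_left] at z3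
      exact ⟨z, hz, z1, z2, z3, z4, z5⟩

/-- The twisted face skips a rim face that has only one edge in the region. -/
theorem IsCubicMap.sameCycle_skip [Finite G.Dart] (h : IsCubicMap r F) {d : G.Dart}
    (hd : F d ∈ S) (hz : F (facePerm r d).symm ∉ S)
    (huniq : ∀ z, F z = F (facePerm r d).symm → z.fst ∈ region F S → z.snd ∈ region F S →
      z = (facePerm r d).symm) :
    (twistPerm h S).SameCycle d (facePerm r (facePerm r d)) := by
  set z := (facePerm r d).symm with hzdef
  have hφd : F z.symm ∈ S := by rw [hzdef, Dart.symm_symm, h.apply_facePerm]; exact hd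
  have hout : ¬ ((facePerm r z).fst ∈ region F S ∧ (facePerm r z).snd ∈ region F S) := by
    rintro ⟨h1, h2⟩
    have := huniq _ (h.apply_facePerm z) h1 h2
    have h3 := congrArg (fun d : G.Dart => d.fst) this
    simp only [h.rot.facePerm_fst] at h3
    exact z.snd_ne_fst h3
  obtain ⟨z', h1, h2, h3, h4, -, -⟩ := h.exists_return hout
    ⟨by rw [h.apply_facePerm]; exact hz, z.symm, hφd, by
      rw [h.apply_facePerm, Dart.symm_symm]⟩
  obtain rfl := huniq z' (h1.trans (h.apply_facePerm z)) h2 h3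
  -- The twisted walk leaves the region after `d` along the rim face behind the next border dart. As
  -- `z` is the only dart of that rim face in the region, the walk can only return past `z`, onto
  -- the dart `r z`.
  have e1 : twistPerm h S d = facePerm r z := by
    rw [h.twistPerm_of_mem (h.snd_mem_region hd), facePerm_apply, hzdef, Dart.symm_symm,
      facePerm_apply]
  rw [← Equiv.Perm.sameCycle_apply_left, e1, facePerm_apply r (facePerm r d)]
  exact h4

/-- Any two edges between the region and rim faces of the same colour are on a common twisted
face. -/
def IsLinked (h : IsCubicMap r F) (S : Set Φ) (κ : Φ → ZMod 2) : Prop :=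
  ∀ b b', F b ∈ S → F b.symm ∉ S → F b' ∈ S → F b'.symm ∉ S →
    κ (F b.symm) = κ (F b'.symm) → (twistPerm h S).SameCycle b b'

theorem IsDisk.sameCycle_iff [Finite G.Dart] (h : IsPolyhedral r F) (hS : IsDisk F S)
    (hκ : IsColouring F S κ) (hl : IsLinked h.toIsCubicMap S κ) (d d' : G.Dart) :
    (twistPerm h.toIsCubicMap S).SameCycle d d' ↔ label F S κ d = label F S κ d' := by
  have h0 := h.toIsCubicMap
  refine ⟨label_eq_of_sameCycle h0 hκ, fun heq => ?_⟩
  have hborder : ∀ d c, label F S κ d = Sum.inr c →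
      ∃ b, F b ∈ S ∧ F b.symm ∉ S ∧ (twistPerm h0 S).SameCycle d b := by
    intro d c hd
    by_cases hU : d.fst ∈ region F S ∧ d.snd ∈ region F S
    · rw [label, if_pos hU] at hd
      split_ifs at hd with h1
      have := (hS.inner d hU.1 hU.2).resolve_right h1
      exact ⟨d, this, h1, Equiv.Perm.SameCycle.refl _ _⟩
    · rw [label, if_neg hU] at hd
      split_ifs at hd with h1
      obtain ⟨z, -, -, -, h2, h3, h4⟩ := h0.exists_return hU h1
      exact ⟨_, h3, h4, h2⟩
  have hlab : ∀ b, F b ∈ S → F b.symm ∉ S →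
      label F S κ b = Sum.inr (1 + κ (F b.symm)) := by
    intro b h1 h2
    rw [label, if_pos ⟨fst_mem_region h1, h0.snd_mem_region h1⟩, if_neg h2]
  have hinl : ∀ d f, label F S κ d = Sum.inl f →
      (f ∈ S ∧ F d.symm = f) ∨ (f ∉ S ∧ f ∉ rim F S ∧ F d = f) := by
    intro d f hd
    by_cases hU : d.fst ∈ region F S ∧ d.snd ∈ region F S
    · rw [label, if_pos hU] at hd
      split_ifs at hd with h1
      left
      rw [Sum.inl.injEq] at hd
      exact ⟨hd ▸ h1, hd⟩
    · rw [label, if_neg hU] at hd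
      split_ifs at hd with h1
      right
      rw [Sum.inl.injEq] at hd
      exact ⟨fun h2 => hU ⟨fst_mem_region (hd ▸ h2), h0.snd_mem_region (hd ▸ h2)⟩, hd ▸ h1, hd⟩
  cases hlab1 : label F S κ d with
  | inl f =>
    have hlab2 := heq ▸ hlab1
    rcases hinl _ _ hlab1 with ⟨a1, a2⟩ | ⟨a1, a2, a3⟩ <;>
      rcases hinl _ _ hlab2 with ⟨b1, b2⟩ | ⟨b1, b2, b3⟩
    · have := h0.sameCycle_of_step (twistPerm h0 S) (fun x : G.Dart => x.symm) (f := f)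
        (fun x hx => by
          have e : twistPerm h0 S (facePerm r x).symm = x.symm := by
            rw [h0.twistPerm_of_mem]
            · rw [Dart.symm_symm, facePerm_apply, h0.rot.cube]
            · have : F (facePerm r x) ∈ S := by rw [h0.apply_facePerm, hx]; exact a1
              exact fst_mem_region this
          rw [← Equiv.Perm.sameCycle_apply_right, e]) a2 b2
      simpa using this
    · exact absurd a1 b1
    · exact absurd b1 a1
    · refine h0.sameCycle_of_step (twistPerm h0 S) id (f := f) (fun x hx => ?_) a3 b3
      have hsnd : x.snd ∉ region F S := by
        intro h2
        by_cases h1 : x.fst ∈ region F S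
        · rcases hS.inner x h1 h2 with h3 | h3
          · exact a1 (hx ▸ h3)
          · exact a2 ⟨a1, x.symm, h3, by rw [Dart.symm_symm, hx]⟩
        · have := (h0.mem_rim (d := x.symm) h2 h1).2
          rw [Dart.symm_symm, hx] at this
          exact a2 this
      rw [id, id, ← h0.twistPerm_of_notMem hsnd, Equiv.Perm.sameCycle_apply_right]
  | inr c =>
    have hlab2 := heq ▸ hlab1
    obtain ⟨b, b1, b2, b3⟩ := hborder _ _ hlab1
    obtain ⟨b', b1', b2', b3'⟩ := hborder _ _ hlab2
    refine b3.trans (Equiv.Perm.SameCycle.trans (hl b b' b1 b2 b1' b2' ?_) b3'.symm)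
    have e1 := (label_eq_of_sameCycle h0 hκ b3).symm.trans hlab1
    have e2 := (label_eq_of_sameCycle h0 hκ b3').symm.trans hlab2
    rw [hlab b b1 b2, Sum.inr.injEq] at e1
    rw [hlab b' b1' b2', Sum.inr.injEq] at e2
    exact add_left_cancel (e1.trans e2.symm)

/-- The two sides of a single crossing edge already realize both colours. -/
theorem IsDisk.range_label (h : IsPolyhedral r F) (hF : Function.Surjective F) (hS : IsDisk F S)
    (hκ : IsColouring F S κ)
    (hex : ∃ d : G.Dart, d.fst ∈ region F S ∧ d.snd ∉ region F S) :
    Set.range (label F S κ) = Sum.inl '' (rim F S)ᶜ ∪ Sum.inr '' Set.univ := by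
  have h0 := h.toIsCubicMap
  ext x
  constructor
  · rintro ⟨d, rfl⟩
    rw [label]
    split_ifs with h1 h2 h2
    · exact Or.inl ⟨_, fun h' => h'.1 h2, rfl⟩
    · exact Or.inr ⟨_, trivial, rfl⟩
    · exact Or.inr ⟨_, trivial, rfl⟩
    · exact Or.inl ⟨_, h2, rfl⟩
  · rintro (⟨f, hf, rfl⟩ | ⟨c, -, rfl⟩)
    · obtain ⟨d, rfl⟩ := hF f
      by_cases hd : F d ∈ S
      · refine ⟨d.symm, ?_⟩
        have hU : d.symm.fst ∈ region F S ∧ d.symm.snd ∈ region F S :=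
          ⟨h0.snd_mem_region hd, fst_mem_region hd⟩
        rw [label, if_pos hU, Dart.symm_symm, if_pos hd]
      · refine ⟨d, ?_⟩
        rw [label, if_neg, if_neg hf]
        rintro ⟨h1, h2⟩
        rcases hS.inner d h1 h2 with h3 | h3
        · exact hd h3
        · exact hf ⟨hd, d.symm, h3, by rw [Dart.symm_symm]⟩
    · obtain ⟨d, h1, h2⟩ := hex
      have hr := h0.mem_rim h1 h2
      have e1 : label F S κ d = Sum.inr (κ (F d)) := by
        rw [label, if_neg (fun h' => h2 h'.2), if_pos hr.1]
      have e2 : label F S κ d.symm = Sum.inr (κ (F d.symm)) := by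
        rw [label, if_neg (fun h' => h2 h'.1), if_pos hr.2]
      by_cases hc : κ (F d) = c
      · exact ⟨d, by rw [e1, hc]⟩
      · refine ⟨d.symm, ?_⟩
        rw [e2]
        have hz : ∀ a b c : ZMod 2, a ≠ b → a ≠ c → b = c := by decide
        rw [hz _ _ _ (hκ d h1 h2) hc]

theorem natCard_eq_ncard_range {α β γ : Type*} (j : α → β) (hj : Function.Surjective j)
    (L : α → γ) (hL : ∀ a b, j a = j b ↔ L a = L b) : Nat.card β = (Set.range L).ncard := by
  choose s hs using hj
  rw [← Nat.card_coe_set_eq]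
  refine Nat.card_eq_of_bijective (fun b => (⟨L (s b), s b, rfl⟩ : Set.range L)) ⟨?_, ?_⟩
  · intro a b hab
    rw [← hs a, ← hs b]
    exact (hL _ _).2 (congrArg Subtype.val hab)
  · rintro ⟨_, a, rfl⟩
    exact ⟨j a, Subtype.ext ((hL _ _).1 (hs (j a)))⟩

/-- The number of faces of the twisted embedding. -/
theorem IsDisk.card_face [Finite G.Dart] [Finite Φ] (h : IsPolyhedral r F)
    (hF : Function.Surjective F) (hS : IsDisk F S)
    (hκ : IsColouring F S κ) (hl : IsLinked h.toIsCubicMap S κ)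
    (hex : ∃ d : G.Dart, d.fst ∈ region F S ∧ d.snd ∉ region F S) {β : Type*} (j : G.Dart → β)
    (hj : Function.Surjective j)
    (hjs : ∀ d d', j d = j d' ↔ (twistPerm h.toIsCubicMap S).SameCycle d d') :
    Nat.card β + (rim F S).ncard = Nat.card Φ + 2 := by
  rw [natCard_eq_ncard_range j hj (label F S κ) (fun a b =>
    (hjs a b).trans (hS.sameCycle_iff h hκ hl a b)), hS.range_label h hF hκ hex,
    Set.ncard_union_eq, Set.ncard_image_of_injective _ Sum.inl_injective,
    Set.ncard_image_of_injective _ Sum.inr_injective, Set.ncard_univ, Nat.card_zmod,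
    ← Set.ncard_add_ncard_compl (rim F S)]
  · omega
  · rw [Set.disjoint_left]
    rintro _ ⟨a, -, rfl⟩ ⟨b, -, h'⟩
    cases h'

end Disk

/-! ### Parity along a cycle of a permutation -/

section Parity

variable {α : Type*}

theorem exists_pow_lt_minimalPeriod [Finite α] {φ : Equiv.Perm α} {x d : α}
    (h : φ.SameCycle x d) : ∃ i < Function.minimalPeriod φ x, (φ ^ i) x = d := by
  obtain ⟨i, -, hi⟩ := h.exists_pow_eq'
  refine ⟨i % Function.minimalPeriod φ x, Nat.mod_lt _ ?_, ?_⟩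
  · exact Function.minimalPeriod_pos_of_mem_periodicPts
      (Function.Injective.mem_periodicPts φ.injective x)
  · rw [← hi, ← Equiv.Perm.iterate_eq_pow, ← Equiv.Perm.iterate_eq_pow,
      Function.iterate_mod_minimalPeriod_eq]

theorem pow_ne_of_lt {φ : Equiv.Perm α} {x : α} {i : ℕ} (h0 : 0 < i)
    (hi : i < Function.minimalPeriod φ x) : (φ ^ i) x ≠ x := fun h =>
  h0.ne' (pow_injOn_minimalPeriod φ x hi (h0.trans hi) (by rw [h]; rfl))

theorem exists_index (φ : Equiv.Perm α) (x : α) :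
    ∃ c : α → ℕ, ∀ i < Function.minimalPeriod φ x, c ((φ ^ i) x) = i := by
  classical
  refine ⟨fun d => if h : ∃ i, (φ ^ i) x = d then Nat.find h else 0, fun i hi => ?_⟩
  have h : ∃ j, (φ ^ j) x = (φ ^ i) x := ⟨i, rfl⟩
  beta_reduce
  rw [dif_pos h]
  exact pow_injOn_minimalPeriod φ x ((Nat.find_min' h rfl).trans_lt hi) hi (Nat.find_spec h)

/-- The parity of the index alternates except possibly at the return to `x`, so evenness is demanded
only there. This serves even faces, and odd faces cut open at `x`. -/
theorem exists_parity [Finite α] (φ : Equiv.Perm α) (x : α) :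
    ∃ c : α → ZMod 2, (∀ i < Function.minimalPeriod φ x, c ((φ ^ i) x) = i) ∧
      (∀ d, φ.SameCycle x d →
        (φ d = x → Even (Function.minimalPeriod φ x)) → c (φ d) = c d + 1) := by
  obtain ⟨c, hc⟩ := exists_index φ x
  refine ⟨fun d => c d, fun i hi => by beta_reduce; rw [hc i hi], fun d hd he => ?_⟩
  obtain ⟨i, hi, rfl⟩ := exists_pow_lt_minimalPeriod hd
  beta_reduce
  rw [hc i hi, ← Equiv.Perm.mul_apply, ← pow_succ']
  rw [← Equiv.Perm.mul_apply, ← pow_succ'] at he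
  by_cases h : i + 1 < Function.minimalPeriod φ x
  · rw [hc _ h, Nat.cast_succ]
  · have hn : i + 1 = Function.minimalPeriod φ x := by omega
    rw [hn, pow_minimalPeriod_apply]
    rw [hn] at he
    have h0 := hc 0 (by omega)
    rw [pow_zero, Equiv.Perm.one_apply] at h0
    rw [h0, ← Nat.cast_succ, Nat.succ_eq_add_one, hn, Nat.cast_zero, eq_comm,
      ZMod.natCast_eq_zero_iff_even]
    exact he (pow_minimalPeriod_apply φ x)

end Parity

/-! ### Disks, and the region of one even face -/

section Regions

variable {V : Type*} {G : SimpleGraph V} {Φ : Type*}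
variable {r : Equiv.Perm G.Dart} {F : G.Dart → Φ} {S : Set Φ}

/-- Different darts of `f` have different faces behind them, so a function on these darts descends
to the neighbours of `f`. -/
theorem IsPolyhedral.exists_colour (h : IsPolyhedral r F) (f : Φ) (c : G.Dart → ZMod 2) :
    ∃ κ : Φ → ZMod 2, ∀ d, F d = f → κ (F d.symm) = c d := by
  classical
  refine ⟨fun g => if h : ∃ d, F d = f ∧ F d.symm = g then c h.choose else 0, fun d hd => ?_⟩
  have h' : ∃ d', F d' = f ∧ F d'.symm = F d.symm := ⟨d, hd, rfl⟩
  beta_reduce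
  rw [dif_pos h']
  congr 1
  exact h.inj _ _ (h'.choose_spec.1.trans hd.symm) h'.choose_spec.2

/-- An edge leaving the region is the third edge between consecutive darts of a face of `S`. This
reduces `IsColouring` to alternation along the faces of `S`. -/
theorem IsCubicMap.exists_consecutive (h : IsCubicMap r F) {d : G.Dart}
    (h1 : d.fst ∈ region F S) (h2 : d.snd ∉ region F S) :
    ∃ b, F b ∈ S ∧ F b.symm = F d.symm ∧ F (facePerm r b).symm = F d := by
  obtain ⟨a, ha, ha', rfl⟩ := h.exists_rot_eq h1 h2
  refine ⟨(r (r a)).symm, ha', ?_, ?_⟩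
  · rw [Dart.symm_symm, h.apply_rot_rot]
  · rw [facePerm_apply, Dart.symm_symm, h.rot.cube, h.apply_rot]

theorem IsTriangleFree.outer_of_face (h : IsTriangleFree r F) {d d₁ d₃ : G.Dart}
    (h1 : F d₁ ∈ S) (hd1 : F d₁.symm = F d) (hd3 : F d₃.symm = F d.symm) (h13 : F d₁ = F d₃) :
    d.fst ∈ region F S ∨ d.snd ∈ region F S := by
  obtain ⟨v, hv1, hv, -⟩ := h.triangle d₁ d d₃.symm hd1 hd3.symm (by rw [Dart.symm_symm, h13])
  have hvS : v ∈ region F S := by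
    rw [Dart.edge, Sym2.mem_iff] at hv1
    rcases hv1 with rfl | rfl
    · exact fst_mem_region h1
    · exact h.snd_mem_region h1
  rw [Dart.edge, Sym2.mem_iff] at hv
  rcases hv with rfl | rfl
  · exact Or.inl hvS
  · exact Or.inr hvS

theorem region_singleton (f : Φ) : region F {f} = faceVerts F f := by
  ext v; simp [region]

theorem mem_region_pair (f g : Φ) (v : V) :
    v ∈ region F {f, g} ↔ v ∈ faceVerts F f ∨ v ∈ faceVerts F g := by
  simp [region]

theorem IsTriangleFree.isDisk_singleton (h : IsTriangleFree r F) (f : Φ) : IsDisk F {f} where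
  inner d h1 h2 := by
    rw [region_singleton] at h1 h2
    exact h.eq_or_eq_of_mem h1 h2
  outer d := by
    rintro ⟨-, d₁, h1, hd1⟩ ⟨-, d₃, h3, hd3⟩
    exact h.outer_of_face h1 hd1 hd3 (h1.trans h3.symm)

/-- The third edge between two consecutive border darts has rim faces on both sides, so by `inner`
it leaves the region. -/
theorem IsDisk.exists_crossing (h : IsCubicMap r F) (hS : IsDisk F S) {a : G.Dart} (ha : F a ∈ S)
    (ha1 : F a.symm ∉ S) (ha2 : F (facePerm r a).symm ∉ S) :
    ∃ d : G.Dart, d.fst ∈ region F S ∧ d.snd ∉ region F S := by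
  have ha' : F (facePerm r a) ∈ S := by rwa [h.apply_facePerm]
  have hf : (r (facePerm r a)).fst ∈ region F S := by
    rw [h.rot.fst_apply]; exact fst_mem_region ha'
  refine ⟨r (facePerm r a), hf, fun h2 => ?_⟩
  rcases hS.inner _ hf h2 with e | e
  · rw [h.apply_rot] at e; exact ha2 e
  · rw [facePerm_apply, ← h.apply_rot, h.rot.cube] at e; exact ha1 e

theorem IsPolyhedral.ncard_image_face [Finite G.Dart] (h : IsPolyhedral r F) (d : G.Dart) :
    ((fun x : G.Dart => F x.symm) '' {x | F x = F d}).ncard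
      = Function.minimalPeriod (facePerm r) d := by
  rw [Set.InjOn.ncard_image]
  · have : {x | F x = F d} = (fun i : ℕ => ((facePerm r) ^ i) d) ''
        (Finset.range (Function.minimalPeriod (facePerm r) d) : Finset ℕ) := by
      ext x
      simp only [Set.mem_ofPred_eq, Set.mem_image, Finset.coe_range, Set.mem_Iio]
      constructor
      · intro hx
        exact exists_pow_lt_minimalPeriod ((h.face_iff _ _).1 hx.symm)
      · rintro ⟨i, -, rfl⟩
        rw [eq_comm, h.face_iff]
        exact ⟨i, by simp⟩
    rw [this, Set.InjOn.ncard_image, Set.ncard_coe_finset, Finset.card_range]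
    intro i hi j hj hij
    simp only [Finset.coe_range, Set.mem_Iio] at hi hj
    exact pow_injOn_minimalPeriod _ d hi hj hij
  · intro x hx y hy hxy
    exact h.inj x y (hx.trans hy.symm) hxy

/-- The reversal of the rotation at the vertices of an even face. -/
theorem IsTriangleFree.singleton [Finite G.Dart] (h : IsTriangleFree r F) (d₀ : G.Dart)
    (heven : Even (Function.minimalPeriod (facePerm r) d₀)) :
    (∃ κ, IsColouring F {F d₀} κ ∧ IsLinked h.toIsCubicMap {F d₀} κ) ∧
      (∃ d : G.Dart, d.fst ∈ region F {F d₀} ∧ d.snd ∉ region F {F d₀}) ∧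
      (rim F {F d₀}).ncard = Function.minimalPeriod (facePerm r) d₀ := by
  have h0 := h.toIsCubicMap
  have hsymm : ∀ d, F d = F d₀ → F d.symm ∉ ({F d₀} : Set Φ) := fun d hd hd' =>
    h.symm_ne d (hd.trans (Set.mem_singleton_iff.1 hd').symm)
  refine ⟨?_, ?_, ?_⟩
  · obtain ⟨c, -, hc⟩ := exists_parity (facePerm r) d₀
    have hc : ∀ d, F d = F d₀ → c (facePerm r d) = c d + 1 := fun d hd =>
      hc d ((h.face_iff _ _).1 hd.symm) fun _ => heven
    obtain ⟨κ, hκ⟩ := h.exists_colour (F d₀) c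
    refine ⟨κ, ?_, ?_⟩
    · intro d h1 h2
      obtain ⟨b, hb, hb1, hb2⟩ := h.exists_consecutive h1 h2
      rw [Set.mem_singleton_iff] at hb
      rw [← hb1, ← hb2, hκ _ hb, hκ _ (by rw [h.apply_facePerm, hb]), hc b hb]
      have hz : ∀ x : ZMod 2, x + 1 ≠ x := by decide
      exact hz _
    -- A rim face shares just one edge with a single face, so the twisted walk visits every other
    -- dart of `F d₀`.
    · have hskip : ∀ d, F d = F d₀ →
          (twistPerm h0 {F d₀}).SameCycle d (facePerm r (facePerm r d)) := by
        intro d hd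
        have hφ : F (facePerm r d) = F d₀ := by rw [h.apply_facePerm, hd]
        refine h0.sameCycle_skip hd (hsymm _ hφ) ?_
        intro z hz h1 h2
        rcases (h.isDisk_singleton (F d₀)).inner z h1 h2 with e | e
        · rw [hz] at e; exact absurd e (hsymm _ hφ)
        · rw [Set.mem_singleton_iff] at e
          have := h.inj z.symm (facePerm r d) (e.trans hφ.symm) (by rw [Dart.symm_symm, hz])
          rw [← this, Dart.symm_symm]
      have hpow : ∀ (n : ℕ) d, F d = F d₀ →
          F (((facePerm r) ^ n) d) = F d₀ ∧ c (((facePerm r) ^ n) d) = c d + n := by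
        intro n d hd
        induction n with
        | zero => simpa using hd
        | succ n ih =>
          rw [pow_succ', Equiv.Perm.mul_apply, h.apply_facePerm, hc _ ih.1, ih.2, Nat.cast_succ,
            add_assoc]
          exact ⟨ih.1, rfl⟩
      have heven' : ∀ (n : ℕ) d, F d = F d₀ →
          (twistPerm h0 {F d₀}).SameCycle d (((facePerm r) ^ (2 * n)) d) := by
        intro n d hd
        induction n with
        | zero => exact Equiv.Perm.SameCycle.refl _ _
        | succ n ih =>
          refine ih.trans ?_
          rw [Nat.mul_succ, pow_succ', pow_succ', Equiv.Perm.mul_apply, Equiv.Perm.mul_apply]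
          exact hskip _ (hpow _ d hd).1
      intro b b' hb _ hb' _ hbb
      rw [Set.mem_singleton_iff] at hb hb'
      rw [hκ b hb, hκ b' hb'] at hbb
      obtain ⟨n, -, rfl⟩ := ((h.face_iff _ _).1 (hb.trans hb'.symm)).exists_pow_eq'
      rw [(hpow n b hb).2, left_eq_add, ZMod.natCast_eq_zero_iff_even] at hbb
      obtain ⟨m, rfl⟩ := hbb
      rw [← two_mul]
      exact heven' m b hb
  · refine (h.isDisk_singleton (F d₀)).exists_crossing h0 (a := d₀) rfl (hsymm _ rfl) (hsymm _ ?_)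
    rw [h.apply_facePerm]
  · rw [← h.ncard_image_face d₀]
    congr 1
    ext g
    constructor
    · rintro ⟨-, d, hd, rfl⟩
      exact ⟨d, hd, rfl⟩
    · rintro ⟨d, hd, rfl⟩
      exact ⟨hsymm d hd, d, hd, rfl⟩

end Regions

/-! ### The region of two neighbouring odd faces -/

section Pair

variable {V : Type*} {G : SimpleGraph V} {Φ : Type*}
variable {r : Equiv.Perm G.Dart} {F : G.Dart → Φ} {S : Set Φ} {d₀ : G.Dart}

/-- A pair `S` of odd faces of length at least five, separated by the edge of `d₀`, in a map in
which dual triangles surround vertices and dual 4-cycles have chords. -/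
structure IsOddPair (r : Equiv.Perm G.Dart) (F : G.Dart → Φ) (S : Set Φ) (d₀ : G.Dart) : Prop
    extends IsTriangleFree r F where
  chord : ∀ d₁ d₂ d₃ d₄, F d₁.symm = F d₂ → F d₂.symm = F d₃ → F d₃.symm = F d₄ →
    F d₄.symm = F d₁ → F d₁ ≠ F d₃ → F d₂ ≠ F d₄ →
    ∃ e, (F e = F d₁ ∧ F e.symm = F d₃) ∨ (F e = F d₂ ∧ F e.symm = F d₄)
  eq_pair : S = {F d₀, F d₀.symm}
  five_le : 5 ≤ Function.minimalPeriod (facePerm r) d₀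
  five_le_symm : 5 ≤ Function.minimalPeriod (facePerm r) d₀.symm
  odd : Odd (Function.minimalPeriod (facePerm r) d₀)
  odd_symm : Odd (Function.minimalPeriod (facePerm r) d₀.symm)

namespace IsOddPair

theorem swap (h : IsOddPair r F S d₀) : IsOddPair r F S d₀.symm where
  toIsTriangleFree := h.toIsTriangleFree
  chord := h.chord
  eq_pair := by rw [h.eq_pair, Dart.symm_symm, Set.pair_comm]
  five_le := h.five_le_symm
  five_le_symm := by rw [Dart.symm_symm]; exact h.five_le
  odd := h.odd_symm
  odd_symm := by rw [Dart.symm_symm]; exact h.odd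

theorem mem_iff (h : IsOddPair r F S d₀) (f : Φ) : f ∈ S ↔ f = F d₀ ∨ f = F d₀.symm := by
  rw [h.eq_pair]; simp

theorem mem (h : IsOddPair r F S d₀) : F d₀ ∈ S := (h.mem_iff _).2 (Or.inl rfl)

theorem mem_of_eq (h : IsOddPair r F S d₀) {a : G.Dart} (ha : F a = F d₀) : F a ∈ S :=
  ha ▸ h.mem

theorem symm_notMem (h : IsOddPair r F S d₀) {a : G.Dart} (ha : F a = F d₀) (hne : a ≠ d₀) :
    F a.symm ∉ S := by
  rw [h.mem_iff]
  rintro (e | e)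
  · exact h.symm_ne a (ha.trans e.symm)
  · exact hne (h.inj _ _ ha e)

theorem facePerm_ne (h : IsOddPair r F S d₀) : facePerm r d₀ ≠ d₀ := by
  have := h.five_le
  exact pow_ne_of_lt (φ := facePerm r) (x := d₀) (i := 1) (by omega) (by omega)

theorem facePerm_two_ne (h : IsOddPair r F S d₀) : facePerm r (facePerm r d₀) ≠ d₀ := by
  have := h.five_le
  exact pow_ne_of_lt (φ := facePerm r) (x := d₀) (i := 2) (by omega) (by omega)

theorem facePerm_three_ne (h : IsOddPair r F S d₀) :
    facePerm r (facePerm r (facePerm r d₀)) ≠ d₀ := by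
  have := h.five_le
  exact pow_ne_of_lt (φ := facePerm r) (x := d₀) (i := 3) (by omega) (by omega)

/-- A common neighbour of both faces is at an end of their common edge. -/
theorem near (h : IsOddPair r F S d₀) {a a' : G.Dart} (ha : F a = F d₀) (ha' : F a' = F d₀.symm)
    (haa : F a.symm = F a'.symm) : d₀ = facePerm r a ∨ a = facePerm r d₀ := by
  refine h.eq_facePerm (e := a'.symm) ha ?_ haa.symm (by rw [Dart.symm_symm, ha'])
  rintro rfl
  exact h.symm_ne a' (ha'.trans haa)

theorem third_face (h : IsOddPair r F S d₀) {a : G.Dart} (ha : facePerm r a = d₀.symm) :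
    F a.symm = F (facePerm r d₀).symm := by
  have : a.symm = r (r d₀.symm) := by rw [← ha, facePerm_apply, h.rot.cube]
  rw [this, h.apply_rot_rot, facePerm_apply]

theorem eq_of_facePerm_eq (h : IsOddPair r F S d₀) {a a' : G.Dart} (ha : F a = F d₀)
    (haa : F a.symm = F a'.symm) (h2 : facePerm r a' = d₀.symm) : a = facePerm r d₀ := by
  refine h.inj _ _ (by rw [h.apply_facePerm, ha]) ?_
  rw [haa, h.third_face h2]

/-- Applying `near` from both sides places `a` and `a'` next to the common edge. They must be at the
same end of it, for otherwise a face would have a return after two steps. -/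
theorem near_iff (h : IsOddPair r F S d₀) {a a' : G.Dart} (ha : F a = F d₀)
    (ha' : F a' = F d₀.symm) (haa : F a.symm = F a'.symm) :
    (facePerm r a = d₀ ∧ a' = facePerm r d₀.symm) ∨
      (a = facePerm r d₀ ∧ facePerm r a' = d₀.symm) := by
  rcases h.swap.near ha' (by rw [Dart.symm_symm, ha]) haa.symm with e | e
  · exact Or.inr ⟨h.eq_of_facePerm_eq ha haa e.symm, e.symm⟩
  · rcases h.near ha ha' haa with e' | e'
    · exact Or.inl ⟨e'.symm, e⟩
    · exfalso
      set b := (r (r d₀.symm)).symm with hb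
      have hφb : facePerm r b = d₀.symm := by
        rw [facePerm_apply, hb, Dart.symm_symm, h.rot.cube]
      have hbe : b = a' := by
        refine h.inj _ _ ?_ ?_
        · rw [ha', ← hφb, h.apply_facePerm]
        · rw [h.third_face hφb, ← haa, e']
      rw [hbe, e] at hφb
      exact h.swap.facePerm_two_ne hφb

/-- If the two rim faces border the same face of `S`, they form a dual triangle with it. Otherwise
they form a dual 4-cycle with the pair, and a chord of it again produces a triangle with one face of
`S`. -/
theorem outer_region (h : IsOddPair r F S d₀) : ∀ d, F d ∈ rim F S → F d.symm ∈ rim F S →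
    d.fst ∈ region F S ∨ d.snd ∈ region F S := by
  rintro d ⟨hd, d₁, h1, hd1⟩ ⟨hds, d₃, h3, hd3⟩
  by_cases h13 : F d₁ = F d₃
  · exact h.outer_of_face h1 hd1 hd3 h13
  · have hx : ∃ x, F x = F d₃ ∧ F x.symm = F d₁ := by
      rcases (h.mem_iff _).1 h1 with e1 | e1 <;> rcases (h.mem_iff _).1 h3 with e3 | e3
      · exact absurd (e1.trans e3.symm) h13
      · exact ⟨d₀.symm, e3.symm, by rw [Dart.symm_symm, e1]⟩
      · exact ⟨d₀, e3.symm, e1.symm⟩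
      · exact absurd (e1.trans e3.symm) h13
    obtain ⟨x, hx1, hx2⟩ := hx
    obtain ⟨e, ⟨he1, he2⟩ | ⟨he1, he2⟩⟩ := h.chord d₁ d d₃.symm x hd1 hd3.symm
      (by rw [Dart.symm_symm, hx1]) hx2 (fun e => hds (by rw [← hd3, ← e]; exact h1))
      (fun e => hd (by rw [e, hx1]; exact h3))
    · exact h.outer_of_face h1 hd1 (he2.trans hd3) he1.symm
    · rw [hx1] at he2
      refine h.outer_of_face (d₁ := e.symm) (d₃ := d₃) ?_ ?_ hd3 he2
      · rw [he2]; exact h3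
      · rw [Dart.symm_symm, he1]

/-- Were the edge on neither face of the pair, both of its sides would be common neighbours of the
pair, reached across consecutive darts `b`, `a` of `F d₀`. Common neighbours lie at the ends of
`d₀`, so the length of that face would be too small. -/
theorem inner_aux (h : IsOddPair r F S d₀) {d : G.Dart} (h1 : d.fst ∈ faceVerts F (F d₀))
    (h2 : d.snd ∈ faceVerts F (F d₀.symm)) : F d ∈ S ∨ F d.symm ∈ S := by
  by_contra! hcon
  have key : ∀ d : G.Dart, F d ∉ S → F d.symm ∉ S → ∀ f ∈ S, d.fst ∈ faceVerts F f →
      ∃ a b, F a = f ∧ F b = f ∧ F a.symm = F d ∧ F b.symm = F d.symm ∧ facePerm r b = a := by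
    rintro d n1 n2 f hf ⟨a, ha, haf⟩
    rcases h.rot.cases a d haf.symm with e | e | e
    · rw [e, ha] at n1; exact absurd hf n1
    · refine ⟨a, (r (r a)).symm, ha, ?_, ?_, ?_, ?_⟩
      · rw [h.apply_rot_rot_symm, ha]
      · rw [e, h.apply_rot]
      · rw [Dart.symm_symm, e, h.apply_rot_rot]
      · rw [facePerm_apply, Dart.symm_symm, h.rot.cube]
    · rw [e, h.apply_rot_rot_symm, ha] at n2; exact absurd hf n2
  obtain ⟨a, b, ha, hb, had, hbd, hba⟩ := key d hcon.1 hcon.2 _ h.mem h1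
  obtain ⟨a', b', ha', hb', had', hbd', -⟩ := key d.symm hcon.2 (by simpa using hcon.1) _
    h.swap.mem h2
  rw [Dart.symm_symm] at hbd'
  have hbne : b ≠ a := by
    rintro rfl
    exact h.symm_ne d (had.symm.trans hbd)
  rcases h.near hb ha' (hbd.trans had'.symm) with e | e
  · rw [hba] at e
    subst e
    exact hcon.1 (had ▸ h.swap.mem)
  · rcases h.near ha hb' (had.trans hbd'.symm) with e' | e'
    · rw [e] at hba
      rw [← hba] at e'
      exact h.facePerm_three_ne e'.symm
    · exact hbne (e.trans e'.symm)

theorem isDisk (h : IsOddPair r F S d₀) : IsDisk F S where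
  outer := h.outer_region
  inner d h1 h2 := by
    rw [h.eq_pair, mem_region_pair] at h1 h2
    rcases h1 with h1 | h1 <;> rcases h2 with h2 | h2
    · exact (h.eq_or_eq_of_mem h1 h2).imp (fun e => by rw [e]; exact h.mem)
        (fun e => by rw [e]; exact h.mem)
    · exact h.inner_aux h1 h2
    · exact h.swap.inner_aux h1 (by rwa [Dart.symm_symm])
    · exact (h.eq_or_eq_of_mem h1 h2).imp (fun e => by rw [e]; exact h.swap.mem)
        (fun e => by rw [e]; exact h.swap.mem)

/-- Along one of the two faces, twisted faces connect every other dart away from `d₀`. -/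
theorem sameCycle_two_mul [Finite G.Dart] (h : IsOddPair r F S d₀) (i j : ℕ) (hi : 0 < i)
    (hij : i + 2 * j < Function.minimalPeriod (facePerm r) d₀) :
    (twistPerm h.toIsCubicMap S).SameCycle (((facePerm r) ^ i) d₀)
      (((facePerm r) ^ (i + 2 * j)) d₀) := by
  have hF : ∀ n : ℕ, F (((facePerm r) ^ n) d₀) = F d₀ := fun n => by
    rw [eq_comm, h.face_iff]; exact ⟨n, by simp⟩
  induction j with
  | zero => exact Equiv.Perm.SameCycle.refl _ _
  | succ j ih =>
    refine (ih (by omega)).trans ?_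
    have e : i + 2 * (j + 1) = (i + 2 * j) + 1 + 1 := by ring
    rw [e, pow_succ', Equiv.Perm.mul_apply, pow_succ', Equiv.Perm.mul_apply]
    set n := i + 2 * j with hn
    have e1 : facePerm r (((facePerm r) ^ n) d₀) = ((facePerm r) ^ (n + 1)) d₀ := by
      rw [pow_succ', Equiv.Perm.mul_apply]
    have hx : F (((facePerm r) ^ (n + 1)) d₀) = F d₀ := hF _
    have hn1 : ((facePerm r) ^ (n + 1)) d₀ ≠ d₀ := pow_ne_of_lt (by omega) (by omega)
    have hn2 : ((facePerm r) ^ (n + 2)) d₀ ≠ d₀ := pow_ne_of_lt (by omega) (by omega)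
    have hn0 : ((facePerm r) ^ n) d₀ ≠ d₀ := pow_ne_of_lt (by omega) (by omega)
    refine h.toIsCubicMap.sameCycle_skip (h.mem_of_eq (hF n)) ?_ ?_
    · rw [e1]; exact h.symm_notMem hx hn1
    · intro z hz z1 z2
      rw [e1] at hz ⊢
      rcases h.isDisk.inner z z1 z2 with e2 | e2
      · rw [hz] at e2; exact absurd e2 (h.symm_notMem hx hn1)
      · rcases (h.mem_iff _).1 e2 with e3 | e3
        · have := h.inj z.symm _ (e3.trans hx.symm) (by rw [Dart.symm_symm, hz])
          rw [← this, Dart.symm_symm]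
        · exfalso
          -- A rim face with an edge on each face of the pair lies at an end of `d₀`, but the dart
          -- in the middle of this skip is not next to `d₀`.
          rcases h.near hx e3 (by rw [Dart.symm_symm, hz]) with e4 | e4
          · rw [← Equiv.Perm.mul_apply, ← pow_succ'] at e4
            exact hn2 e4.symm
          · rw [← e1] at e4
            exact hn0 ((facePerm r).injective e4)

theorem twistPerm_symm_apply [Finite G.Dart] (h : IsOddPair r F S d₀) :
    twistPerm h.toIsCubicMap S ((facePerm r).symm d₀) = facePerm r d₀.symm := by
  have hx : facePerm r ((facePerm r).symm d₀) = d₀ := Equiv.apply_symm_apply _ _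
  have hs : ((facePerm r).symm d₀).snd ∈ region F S := by
    rw [← h.rot.facePerm_fst, hx]
    exact fst_mem_region h.mem
  rw [h.twistPerm_of_mem hs, facePerm_apply, Dart.symm_symm]
  conv_rhs => rw [← hx, facePerm_apply]

/-- The index along the face of `d₀`, with the class of each dart on the twisted faces. -/
theorem exists_index_colour [Finite G.Dart] (h : IsOddPair r F S d₀) :
    ∃ c : G.Dart → ZMod 2, c (facePerm r d₀) = 1 ∧ c ((facePerm r).symm d₀) = 0 ∧
      (∀ d, F d = F d₀ → facePerm r d ≠ d₀ → c (facePerm r d) = c d + 1) ∧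
      (∀ d, F d = F d₀ → d ≠ d₀ →
        (c d = 1 → (twistPerm h.toIsCubicMap S).SameCycle (facePerm r d₀) d) ∧
        (c d = 0 → (twistPerm h.toIsCubicMap S).SameCycle ((facePerm r).symm d₀) d)) := by
  obtain ⟨c, hc, hc'⟩ := exists_parity (facePerm r) d₀
  have h5 := h.five_le
  obtain ⟨m, hm⟩ := h.odd
  -- With length 2m + 1, the last dart before the return to `d₀` has even index 2m and the first one
  -- has odd index 1. So the rim faces at the two ends of `d₀` get different colours.
  have hlast : (facePerm r).symm d₀ = ((facePerm r) ^ (2 * m)) d₀ := by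
    rw [Equiv.symm_apply_eq, ← Equiv.Perm.mul_apply, ← pow_succ', ← hm, pow_minimalPeriod_apply]
  refine ⟨c, ?_, ?_, fun d hd hne => hc' d ((h.face_iff _ _).1 hd.symm) (fun e => absurd e hne),
    ?_⟩
  · have := hc 1 (by omega)
    simpa using this
  · rw [hlast, hc _ (by omega), ZMod.natCast_eq_zero_iff_even]
    exact even_two_mul m
  · intro d hd hne
    obtain ⟨i, hi, rfl⟩ := exists_pow_lt_minimalPeriod ((h.face_iff _ _).1 hd.symm)
    have hi0 : 0 < i := by
      rcases Nat.eq_zero_or_pos i with rfl | h'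
      · exact absurd rfl hne
      · exact h'
    rw [hc i hi]
    constructor
    · intro hodd
      have : Odd i := by
        rw [← ZMod.natCast_eq_one_iff_odd]; exact hodd
      obtain ⟨j, rfl⟩ := this
      have := h.sameCycle_two_mul 1 j (by omega) (by omega)
      rwa [pow_one, add_comm 1] at this
    · intro heven
      obtain ⟨j, rfl⟩ := (ZMod.natCast_eq_zero_iff_even).1 heven
      obtain ⟨t, rfl⟩ : ∃ t, m = j + t := ⟨m - j, by omega⟩
      have := h.sameCycle_two_mul (j + j) t (by omega) (by omega)
      rw [hlast, show 2 * (j + t) = j + j + 2 * t by ring]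
      exact this.symm

theorem exists_colouring [Finite G.Dart] (h : IsOddPair r F S d₀) :
    ∃ κ, IsColouring F S κ ∧ IsLinked h.toIsCubicMap S κ := by
  classical
  obtain ⟨c₁, a1, a2, a3, a4⟩ := h.exists_index_colour
  obtain ⟨c₂, b1, b2, b3, b4⟩ := h.swap.exists_index_colour
  obtain ⟨κ₁, hκ₁⟩ := h.exists_colour (F d₀) c₁
  obtain ⟨κ₂, hκ₂⟩ := h.exists_colour (F d₀.symm) c₂
  -- The second face runs along the common edge in the opposite direction, so a rim face at an end
  -- of it is first for one face and last for the other. Adding 1 makes the two colourings agree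
  -- there.
  set κ : Φ → ZMod 2 := fun g => if ∃ d, F d = F d₀ ∧ F d.symm = g then κ₁ g else 1 + κ₂ g with hκ
  have k1 : ∀ d, F d = F d₀ → κ (F d.symm) = c₁ d := by
    intro d hd
    rw [hκ]
    beta_reduce
    rw [if_pos ⟨d, hd, rfl⟩, hκ₁ d hd]
  have k2 : ∀ d, F d = F d₀.symm → d ≠ d₀.symm → κ (F d.symm) = 1 + c₂ d := by
    intro d hd hne
    by_cases hex : ∃ d', F d' = F d₀ ∧ F d'.symm = F d.symm
    · obtain ⟨d', h1, h2⟩ := hex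
      rw [← h2, k1 d' h1]
      rcases h.near_iff h1 hd h2 with ⟨e1, e2⟩ | ⟨e1, e2⟩
      · have e3 : d' = (facePerm r).symm d₀ := by rw [Equiv.eq_symm_apply, e1]
        rw [e3, a2, e2, b1]
        decide
      · rw [e1, a1]
        rw [← e2, Equiv.symm_apply_apply] at b2
        rw [b2, add_zero]
    · rw [hκ]
      beta_reduce
      rw [if_neg hex, hκ₂ d hd]
  have hz : ∀ x : ZMod 2, x + 1 ≠ x := by decide
  refine ⟨κ, ?_, ?_⟩
  · intro d h1 h2
    obtain ⟨b, hb, hb1, hb2⟩ := h.exists_consecutive h1 h2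
    have hr := h.mem_rim h1 h2
    have n1 : F b.symm ∉ S := hb1 ▸ hr.2.1
    have n2 : F (facePerm r b).symm ∉ S := hb2 ▸ hr.1.1
    rw [← hb1, ← hb2]
    rcases (h.mem_iff _).1 hb with e | e
    · rw [k1 b e, k1 _ (by rw [h.apply_facePerm, e]), a3 b e]
      · exact hz _
      · intro e'
        rw [e'] at n2
        exact n2 h.swap.mem
    · have hne : facePerm r b ≠ d₀.symm := by
        intro e'
        rw [e', Dart.symm_symm] at n2
        exact n2 h.mem
      rw [k2 b e, k2 _ (by rw [h.apply_facePerm, e]) hne, b3 b e hne]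
      · have hz : ∀ x : ZMod 2, 1 + (x + 1) ≠ 1 + x := by decide
        exact hz _
      · rintro rfl
        rw [Dart.symm_symm] at n1
        exact n1 h.mem
  -- Around each end of the common edge the twisted walk passes from one face of the pair to the
  -- other, which joins the chains of equal colour.
  · have s1 : (twistPerm h.toIsCubicMap S).SameCycle ((facePerm r).symm d₀)
        (facePerm r d₀.symm) := by
      rw [← h.twistPerm_symm_apply, Equiv.Perm.sameCycle_apply_right]
    have s2 : (twistPerm h.toIsCubicMap S).SameCycle ((facePerm r).symm d₀.symm)
        (facePerm r d₀) := by
      have := h.swap.twistPerm_symm_apply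
      rw [Dart.symm_symm] at this
      rw [← this, Equiv.Perm.sameCycle_apply_right]
    have key : ∀ b, F b ∈ S → F b.symm ∉ S →
        (κ (F b.symm) = 1 → (twistPerm h.toIsCubicMap S).SameCycle (facePerm r d₀) b) ∧
        (κ (F b.symm) = 0 →
          (twistPerm h.toIsCubicMap S).SameCycle ((facePerm r).symm d₀) b) := by
      intro b hb hbs
      rcases (h.mem_iff _).1 hb with e | e
      · rw [k1 b e]
        refine a4 b e ?_
        rintro rfl
        exact hbs h.swap.mem
      · have hne : b ≠ d₀.symm := by
          rintro rfl
          rw [Dart.symm_symm] at hbs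
          exact hbs h.mem
        rw [k2 b e hne]
        have hz : ∀ x : ZMod 2, (1 + x = 1 → x = 0) ∧ (1 + x = 0 → x = 1) := by decide
        exact ⟨fun h' => s2.symm.trans ((b4 b e hne).2 ((hz _).1 h')),
          fun h' => s1.trans ((b4 b e hne).1 ((hz _).2 h'))⟩
    intro b b' hb hbs hb' hbs' heq
    have hz : ∀ x : ZMod 2, x = 1 ∨ x = 0 := by decide
    rcases hz (κ (F b.symm)) with h' | h'
    · exact ((key b hb hbs).1 h').symm.trans ((key b' hb' hbs').1 (heq ▸ h'))
    · exact ((key b hb hbs).2 h').symm.trans ((key b' hb' hbs').2 (heq ▸ h'))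

theorem exists_crossing (h : IsOddPair r F S d₀) :
    ∃ d : G.Dart, d.fst ∈ region F S ∧ d.snd ∉ region F S := by
  have e : F (facePerm r d₀) = F d₀ := h.apply_facePerm _
  refine h.isDisk.exists_crossing h.toIsCubicMap (a := facePerm r d₀) (h.mem_of_eq e)
    (h.symm_notMem e h.facePerm_ne) (h.symm_notMem ?_ h.facePerm_two_ne)
  rw [h.apply_facePerm, e]

theorem ncard_image_diff [Finite G.Dart] (h : IsOddPair r F S d₀) :
    ((fun x : G.Dart => F x.symm) '' ({x | F x = F d₀} \ {d₀})).ncard + 1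
      = Function.minimalPeriod (facePerm r) d₀ := by
  rw [← h.ncard_image_face d₀, Set.InjOn.ncard_image, Set.InjOn.ncard_image]
  · exact Set.ncard_sdiff_singleton_add_one rfl (Set.toFinite _)
  · intro x hx y hy hxy
    exact h.inj x y (hx.trans hy.symm) hxy
  · intro x hx y hy hxy
    exact h.inj x y (hx.1.trans hy.1.symm) hxy

/-- Inclusion and exclusion: each face of the pair loses the other as a neighbour, and exactly the
two faces at the ends of the common edge are counted twice. -/
theorem ncard_rim [Finite G.Dart] [Finite Φ] (h : IsOddPair r F S d₀) :
    (rim F S).ncard + 4 = Function.minimalPeriod (facePerm r) d₀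
      + Function.minimalPeriod (facePerm r) d₀.symm := by
  set A := (fun x : G.Dart => F x.symm) '' ({x | F x = F d₀} \ {d₀}) with hA
  set B := (fun x : G.Dart => F x.symm) '' ({x | F x = F d₀.symm} \ {d₀.symm}) with hB
  have hrim : rim F S = A ∪ B := by
    ext g
    constructor
    · rintro ⟨hg, d, hd, rfl⟩
      rcases (h.mem_iff _).1 hd with e | e
      · refine Or.inl ⟨d, ⟨e, ?_⟩, rfl⟩
        rintro rfl
        exact hg h.swap.mem
      · refine Or.inr ⟨d, ⟨e, ?_⟩, rfl⟩
        rintro rfl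
        rw [Dart.symm_symm] at hg
        exact hg h.mem
    · rintro (⟨d, ⟨hd, hne⟩, rfl⟩ | ⟨d, ⟨hd, hne⟩, rfl⟩)
      · exact ⟨h.symm_notMem hd hne, d, h.mem_of_eq hd, rfl⟩
      · exact ⟨h.swap.symm_notMem hd hne, d, h.swap.mem_of_eq hd, rfl⟩
  have hinv : (facePerm r).symm d₀ = (r (r d₀)).symm := by
    rw [facePerm_symm_apply, h.rot.symm_apply]
  have hlast : F ((facePerm r).symm d₀) = F d₀ := by
    rw [← h.apply_facePerm, Equiv.apply_symm_apply]
  have hinter : A ∩ B = {F (facePerm r d₀).symm, F ((facePerm r).symm d₀).symm} := by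
    ext g
    constructor
    · rintro ⟨⟨a, ⟨ha, -⟩, rfl⟩, b, ⟨hb, -⟩, hab⟩
      rcases h.near ha hb hab.symm with e | e
      · right
        rw [e, Equiv.symm_apply_apply]
        rfl
      · left
        rw [e]
    · rintro (rfl | rfl)
      · refine ⟨⟨facePerm r d₀, ⟨h.apply_facePerm _, h.facePerm_ne⟩, rfl⟩,
          (facePerm r).symm d₀.symm, ⟨?_, ?_⟩, ?_⟩
        · change F _ = _
          rw [← h.apply_facePerm, Equiv.apply_symm_apply]
        · intro e
          rw [Set.mem_singleton_iff, Equiv.symm_apply_eq] at e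
          exact h.swap.facePerm_ne e.symm
        · exact h.third_face (Equiv.apply_symm_apply _ _)
      · refine ⟨⟨(facePerm r).symm d₀, ⟨hlast, fun e => ?_⟩, rfl⟩,
          facePerm r d₀.symm, ⟨h.apply_facePerm _, h.swap.facePerm_ne⟩, ?_⟩
        · rw [Set.mem_singleton_iff, Equiv.symm_apply_eq] at e
          exact h.facePerm_ne e.symm
        · refine (h.swap.third_face ?_).symm
          rw [Dart.symm_symm, Equiv.apply_symm_apply]
  have hne : F (facePerm r d₀).symm ≠ F ((facePerm r).symm d₀).symm := by
    intro e
    have := h.inj _ _ ((h.apply_facePerm d₀).trans hlast.symm) e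
    rw [Equiv.eq_symm_apply] at this
    exact h.facePerm_two_ne this
  have h1 := Set.ncard_union_add_ncard_inter A B
  rw [← hrim, hinter, Set.ncard_pair hne] at h1
  have h2 := h.ncard_image_diff
  have h3 := h.swap.ncard_image_diff
  rw [← hA] at h2
  rw [← hB] at h3
  omega

end IsOddPair

end Pair

/-! ### The link of `S` is dual to the cut around the region -/

section Link

variable {V : Type*} [Fintype V] {G : SimpleGraph V} {P : SurfaceEmbedding G}

theorem dualGraph_adj_iff (hP : ∀ e, P.sign e = 1) (h : IsPolyhedral P.rot (dartFace P))
    (f g : P.Face) : P.dualGraph.Adj f g ↔ ∃ d, dartFace P d = f ∧ dartFace P d.symm = g := by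
  constructor
  · rintro ⟨hne, e, hf, hg⟩
    obtain ⟨d, hd, rfl⟩ := (mem_edges_iff hP f e).1 hf
    obtain ⟨d', hd', he⟩ := (mem_edges_iff hP g _).1 hg
    rcases (dart_edge_eq_iff _ _).1 he with rfl | rfl
    · exact absurd (hd.symm.trans hd') hne
    · exact ⟨d, hd, hd'⟩
  · rintro ⟨d, rfl, rfl⟩
    exact ⟨h.symm_ne d, d.edge, (mem_edges_iff hP _ _).2 ⟨d, rfl, rfl⟩,
      (mem_edges_iff hP _ _).2 ⟨d.symm, rfl, d.edge_symm⟩⟩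

theorem exists_link_adj (hP : ∀ e, P.sign e = 1) (h : IsPolyhedral P.rot (dartFace P))
    {S : Set P.Face} {d : G.Dart} (h1 : d.fst ∈ region (dartFace P) S)
    (h2 : d.snd ∉ region (dartFace P) S) :
    ∃ f g : P.Face, (P.link S).Adj f g ∧ d.edge ∈ f.edges ∧ d.edge ∈ g.edges := by
  have hr := h.mem_rim h1 h2
  obtain ⟨a, ha, ha', hda⟩ := h.exists_rot_eq h1 h2
  have hadj := fun x : G.Dart => (dualGraph_adj_iff hP h _ _).2 ⟨x, rfl, rfl⟩
  have hF : dartFace P (P.rot (P.rot a)).symm = dartFace P a := h.apply_rot_rot_symm a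
  refine ⟨dartFace P d, dartFace P d.symm, ⟨hr.1.1, hr.2.1, hadj d, dartFace P a, ha, ?_, ?_,
    d.fst, ?_, ?_, ?_⟩, (mem_edges_iff hP _ _).2 ⟨d, rfl, rfl⟩,
    (mem_edges_iff hP _ _).2 ⟨d.symm, rfl, d.edge_symm⟩⟩
  · have := hadj a
    rwa [← h.apply_rot, ← hda] at this
  · have := hadj (P.rot (P.rot a)).symm
    rwa [hF, Dart.symm_symm, h.apply_rot_rot, ← hda] at this
  · refine (mem_verts_iff hP _ _).2 ⟨a, rfl, ?_⟩
    rw [hda, h.rot.fst_apply]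
  · exact (mem_verts_iff hP _ _).2 ⟨d, rfl, rfl⟩
  · exact (mem_verts_iff hP _ _).2 (h.fst_mem_faceVerts_symm d)

/-- The sides of a link edge form a dual triangle with a face of `S`, so the edge has an end in the
region. It does not have both there, since neither side belongs to `S`. Conversely, the sides of a
crossing edge meet a face of `S` at its end in the region. -/
theorem exists_link_adj_iff (hP : ∀ e, P.sign e = 1) (h : IsTriangleFree P.rot (dartFace P))
    {S : Set P.Face} (hS : IsDisk (dartFace P) S) (d : G.Dart) :
    (∃ f g : P.Face, (P.link S).Adj f g ∧ d.edge ∈ f.edges ∧ d.edge ∈ g.edges) ↔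
      (d.fst ∈ region (dartFace P) S ↔ d.snd ∉ region (dartFace P) S) := by
  constructor
  · rintro ⟨f, g, ⟨hf, hg, hfg, k, hk, hkf, hkg, -⟩, hdf, hdg⟩
    have key : ∀ f g : P.Face, f ∉ S → g ∉ S → P.dualGraph.Adj k f → P.dualGraph.Adj k g →
        dartFace P d = f → dartFace P d.symm = g →
        (d.fst ∈ region (dartFace P) S ↔ d.snd ∉ region (dartFace P) S) := by
      rintro _ _ hf hg hkf hkg rfl rfl
      obtain ⟨d₁, h1, h2⟩ := (dualGraph_adj_iff hP h.toIsPolyhedral _ _).1 hkf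
      obtain ⟨d₃, h3, h4⟩ := (dualGraph_adj_iff hP h.toIsPolyhedral _ _).1 hkg
      have o := h.outer_of_face (S := S) (h1 ▸ hk) h2 h4 (h1.trans h3.symm)
      have i := hS.inner d
      tauto
    obtain ⟨x, hx, hxd⟩ := (mem_edges_iff hP f _).1 hdf
    obtain ⟨y, hy, hyd⟩ := (mem_edges_iff hP g _).1 hdg
    rcases (dart_edge_eq_iff _ _).1 hxd with rfl | rfl <;>
      rcases (dart_edge_eq_iff _ _).1 hyd with rfl | rfl
    · exact absurd (hx.symm.trans hy) hfg.ne
    · exact key f g hf hg hkf hkg hx hy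
    · exact key g f hg hf hkg hkf hy hx
    · exact absurd (hx.symm.trans hy) hfg.ne
  · intro hd
    by_cases h1 : d.fst ∈ region (dartFace P) S
    · exact exists_link_adj hP h.toIsPolyhedral h1 (hd.1 h1)
    · have h2 : d.snd ∈ region (dartFace P) S := by tauto
      have := exists_link_adj hP h.toIsPolyhedral (d := d.symm) h2 h1
      rwa [Dart.edge_symm] at this

/-- The embedding induced by `S` is obtained by reversing the rotation on the vertices of `S`. -/
theorem isGauge_reembed_link (hP : ∀ e, P.sign e = 1) (h : IsTriangleFree P.rot (dartFace P))
    {S : Set P.Face} (hS : IsDisk (dartFace P) S) :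
    IsGauge (P.reembed (P.link S)) (regionSign (dartFace P) S) := by
  classical
  intro d
  have := exists_link_adj_iff hP h hS d
  have e : (P.reembed (P.link S)).dartSign d
      = if (d.fst ∈ region (dartFace P) S ↔ d.snd ∉ region (dartFace P) S) then -1 else 1 :=
    if_congr this rfl rfl
  rw [e, regionSign, regionSign]
  by_cases h1 : d.fst ∈ region (dartFace P) S <;> by_cases h2 : d.snd ∈ region (dartFace P) S <;>
    simp [h1, h2]

theorem isStrong_reembed_link (hP : ∀ e, P.sign e = 1) (h : IsTriangleFree P.rot (dartFace P))
    {S : Set P.Face} (hS : IsDisk (dartFace P) S) {κ : P.Face → ZMod 2}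
    (hκ : IsColouring (dartFace P) S κ) [Finite G.Dart] :
    (P.reembed (P.link S)).IsStrong :=
  (isGauge_reembed_link hP h hS).isStrong h.rot (hS.isTwoSided h.toIsPolyhedral hκ)

theorem isOnOrientableSurface_reembed_link (hP : P.IsPlanar)
    (h : IsTriangleFree P.rot (dartFace P))
    {S : Set P.Face} (hS : IsDisk (dartFace P) S) {κ : P.Face → ZMod 2}
    (hκ : IsColouring (dartFace P) S κ) (hl : IsLinked h.toIsCubicMap S κ) [Finite G.Dart]
    (hex : ∃ d : G.Dart, d.fst ∈ region (dartFace P) S ∧ d.snd ∉ region (dartFace P) S)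
    {g : ℕ} (hg : (rim (dartFace P) S).ncard = 2 * g + 2) :
    (P.reembed (P.link S)).IsOnOrientableSurface g := by
  have hG := isGauge_reembed_link hP.1 h hS
  refine ⟨⟨_, hG⟩, ?_⟩
  have := hS.card_face h.toIsPolyhedral (dartFace_surjective hP.1) hκ hl hex
    (fun d => (P.reembed (P.link S)).faceOf (gaugeFlag _ (regionSign (dartFace P) S) d))
    hG.exists_faceOf hG.faceOf_eq_iff
  have h2 := hP.2
  rw [SurfaceEmbedding.eulerChar] at h2 ⊢
  omega

end Link

/-! ### Recovering the twisted edges from the facial cycles -/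

section Isomorphism

variable {V : Type*} {G : SimpleGraph V}

/-- The edges of a cycle of a permutation of the darts. -/
def orbitEdges (ψ : Equiv.Perm G.Dart) (d : G.Dart) : Set (Sym2 V) :=
  {e | ∃ d', ψ.SameCycle d d' ∧ d'.edge = e}

theorem IsGauge.facialCycles_eq [Finite V] {E : SurfaceEmbedding G} {o : V → ℤˣ}
    (hE : IsGauge E o) : E.facialCycles = Set.range (orbitEdges (gaugePerm E o)) := by
  have key : ∀ d, (E.faceOf (gaugeFlag E o d)).edges = orbitEdges (gaugePerm E o) d := fun d =>
    Set.ext fun e => hE.mem_edges_iff d e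
  ext C
  constructor
  · rintro ⟨f, rfl⟩
    obtain ⟨d, rfl⟩ := hE.exists_faceOf f
    exact ⟨d, (key d).symm⟩
  · rintro ⟨d, rfl⟩
    exact ⟨_, key d⟩

theorem IsTwoSided.edge_rot_notMem {ρ : Equiv.Perm G.Dart} (h : IsTwoSided ρ)
    (hρ : IsCubicRotation ρ) {d x : G.Dart} (hx : (facePerm ρ).SameCycle d x) :
    (ρ x).edge ∉ orbitEdges (facePerm ρ) d := by
  rintro ⟨y, hy, he⟩
  have hxy := hx.symm.trans hy
  rcases (dart_edge_eq_iff _ _).1 he with rfl | rfl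
  · have := hρ.apply_ne x
    exact this (h.eq_of_fst_eq hρ hxy (hρ.fst_apply x))
  · have h1 : (facePerm ρ).SameCycle x (ρ (ρ x)) := by
      have := hxy
      rw [← Equiv.Perm.sameCycle_apply_right, facePerm_apply, Dart.symm_symm] at this
      exact this
    have := h.eq_of_fst_eq hρ h1 (by rw [hρ.fst_apply, hρ.fst_apply])
    exact absurd this (hρ.apply_apply_ne x)

/-- An edge is untwisted if and only if some facial cycle takes the same side at its two ends. -/
theorem IsTwoSided.straight_iff {r : Equiv.Perm G.Dart} (hr : IsCubicRotation r) {o : V → ℤˣ}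
    (h : IsTwoSided (twistRot r hr.fst_apply o)) (a : G.Dart) :
    o a.fst * o a.snd = 1 ↔ ∃ d, a.edge ∈ orbitEdges (facePerm (twistRot r hr.fst_apply o)) d ∧
      (r (r a)).edge ∈ orbitEdges (facePerm (twistRot r hr.fst_apply o)) d ∧
      (r a.symm).edge ∈ orbitEdges (facePerm (twistRot r hr.fst_apply o)) d := by
  set ρ := twistRot r hr.fst_apply o with hρdef
  have hρ : IsCubicRotation ρ := hr.twistRot o
  have happ : ∀ x, ρ x = if o x.fst = 1 then r x else r (r x) := hr.twistRot_apply o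
  have hs : a.symm.fst = a.snd := rfl
  constructor
  · intro ho
    -- The facial cycle that keeps to the right of `a` runs along `a` where the rotation is kept and
    -- along `a.symm` where it is reversed.
    have hos : o a.fst = o a.snd := by
      rw [mul_eq_one_iff_eq_inv, Int.units_inv_eq_self] at ho
      exact ho
    rcases Int.units_eq_one_or (o a.fst) with h1 | h1
    · refine ⟨a, ⟨a, Equiv.Perm.SameCycle.refl _ _, rfl⟩,
        ⟨(r (r a)).symm, ?_, Dart.edge_symm _⟩, ⟨facePerm ρ a, ?_, ?_⟩⟩
      · rw [← Equiv.Perm.sameCycle_apply_right, facePerm_apply, Dart.symm_symm, happ,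
          hr.fst_apply, hr.fst_apply, if_pos h1, hr.cube]
      · rw [Equiv.Perm.sameCycle_apply_right]
      · rw [facePerm_apply, happ, hs, if_pos (hos ▸ h1)]
    · have h2 : o a.snd ≠ 1 := by rw [← hos, h1]; decide
      have h1' : o a.fst ≠ 1 := by rw [h1]; decide
      refine ⟨a.symm, ⟨a.symm, Equiv.Perm.SameCycle.refl _ _, a.edge_symm⟩,
        ⟨facePerm ρ a.symm, ?_, ?_⟩, ⟨(r a.symm).symm, ?_, Dart.edge_symm _⟩⟩
      · rw [Equiv.Perm.sameCycle_apply_right]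
      · rw [facePerm_apply, Dart.symm_symm, happ, if_neg h1']
      · rw [← Equiv.Perm.sameCycle_apply_right, facePerm_apply, Dart.symm_symm, happ,
          hr.fst_apply, hs, if_neg h2, hr.cube]
  · rintro ⟨d, ⟨x, hx, hxa⟩, h2, h3⟩
    -- At each end of the edge the facial cycle misses exactly one edge. Which one it misses reveals
    -- the sign at that end.
    have n1 := h.edge_rot_notMem hρ hx
    have n2 := h.edge_rot_notMem hρ (d := d) (x := facePerm ρ x)
      (by rwa [Equiv.Perm.sameCycle_apply_right])
    rw [facePerm_apply] at n2
    rcases (dart_edge_eq_iff _ _).1 hxa with rfl | rfl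
    · have e1 : o x.fst = 1 := by
        by_contra hne
        rw [happ, if_neg hne] at n1
        exact n1 h2
      have e2 : o x.snd = 1 := by
        by_contra hne
        have e : ρ x.symm = r (r x.symm) := by rw [happ, hs, if_neg hne]
        rw [happ, hρ.fst_apply, hs, if_neg hne, e, hr.cube] at n2
        exact n2 h3
      rw [e1, e2, one_mul]
    · have e1 : o a.snd ≠ 1 := by
        intro hne
        rw [happ, hs, if_pos hne] at n1
        exact n1 h3
      have e2 : o a.fst ≠ 1 := by
        intro hne
        have e : ρ a = r a := by rw [happ, if_pos hne]
        rw [Dart.symm_symm, happ, hρ.fst_apply, if_pos hne, e] at n2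
        exact n2 h2
      rw [(Int.units_eq_one_or _).resolve_left e1, (Int.units_eq_one_or _).resolve_left e2]
      decide

end Isomorphism

/-! ### Transport of twisted embeddings along automorphisms -/

section Transport

variable {V : Type*} {G : SimpleGraph V} {r ρ ρ' : Equiv.Perm G.Dart}

/-- The edge of `a` and, at its two ends, the edges on its right belong to one of the sets. -/
def IsStraight (r : Equiv.Perm G.Dart) (𝒞 : Set (Set (Sym2 V))) (a : G.Dart) : Prop :=
  ∃ C ∈ 𝒞, a.edge ∈ C ∧ (r (r a)).edge ∈ C ∧ (r a.symm).edge ∈ C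

theorem IsTwoSided.isStraight_iff (hr : IsCubicRotation r) {o : V → ℤˣ}
    (h : IsTwoSided (twistRot r hr.fst_apply o)) (a : G.Dart) :
    IsStraight r (Set.range (orbitEdges (facePerm (twistRot r hr.fst_apply o)))) a ↔
      o a.fst * o a.snd = 1 := by
  rw [h.straight_iff hr, IsStraight, Set.exists_range_iff]

theorem isStraight_image (φ : G ≃g G) (𝒞 : Set (Set (Sym2 V))) (a b : G.Dart)
    (h1 : b.edge = Sym2.map φ a.edge)
    (h2 : ((r (r b)).edge = Sym2.map φ (r (r a)).edge ∧
        (r b.symm).edge = Sym2.map φ (r a.symm).edge)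
      ∨ ((r (r b)).edge = Sym2.map φ (r a.symm).edge ∧
        (r b.symm).edge = Sym2.map φ (r (r a)).edge)) :
    IsStraight r ((fun C => Sym2.map φ '' C) '' 𝒞) b ↔ IsStraight r 𝒞 a := by
  have hinj : Function.Injective (Sym2.map φ) := Sym2.map.injective φ.injective
  rw [IsStraight, Set.exists_mem_image]
  refine exists_congr fun C => and_congr_right fun _ => ?_
  rw [h1, hinj.mem_set_image]
  rcases h2 with ⟨e, e'⟩ | ⟨e, e'⟩
  · rw [e, e', hinj.mem_set_image, hinj.mem_set_image]
  · rw [e, e', hinj.mem_set_image, hinj.mem_set_image, and_comm (a := (r a.symm).edge ∈ C)]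

/-- Automorphisms that preserve the facial cycles preserve the twisted edges. -/
theorem sign_eq_iff_of_image_eq (hr : IsCubicRotation r) {o o' : V → ℤˣ}
    (h : IsTwoSided (twistRot r hr.fst_apply o)) (h' : IsTwoSided (twistRot r hr.fst_apply o'))
    {φ : G ≃g G}
    (hφ : (∀ d, dartMap φ (r d) = r (dartMap φ d)) ∨ (∀ d, dartMap φ (r d) = r (r (dartMap φ d))))
    (himg : (fun C => Sym2.map φ '' C) ''
        Set.range (orbitEdges (facePerm (twistRot r hr.fst_apply o)))
      = Set.range (orbitEdges (facePerm (twistRot r hr.fst_apply o')))) (a : G.Dart) :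
    o a.fst * o a.snd = 1 ↔ o' (φ a.fst) * o' (φ a.snd) = 1 := by
  rw [← h.isStraight_iff hr]
  rcases hφ with hφ | hφ
  · rw [← isStraight_image φ _ a (dartMap φ a) rfl, himg, h'.isStraight_iff hr]
    · rfl
    · left
      rw [← hφ, ← hφ, ← dartMap_symm, ← hφ]
      exact ⟨rfl, rfl⟩
  -- A reflection exchanges left and right, so the image dart is reversed to keep the tested edges
  -- on its right.
  · rw [← isStraight_image φ _ a (dartMap φ a).symm (Dart.edge_symm _), himg,
      h'.isStraight_iff hr, mul_comm]
    · rfl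
    · right
      have e1 := hφ a.symm
      have e2 := hφ (r a)
      rw [hφ a, hr.cube] at e2
      rw [Dart.symm_symm, ← dartMap_symm, ← e1]
      refine ⟨rfl, ?_⟩
      rw [← e2]
      rfl

theorem dartMap_twistRot (hr : IsCubicRotation r) {o o' : V → ℤˣ} {φ : G ≃g G}
    (hφ : (∀ d, dartMap φ (r d) = r (dartMap φ d)) ∨ (∀ d, dartMap φ (r d) = r (r (dartMap φ d))))
    (ho : ∀ v, o' (φ v) = o v) :
    (∀ d, dartMap φ (twistRot r hr.fst_apply o d) = twistRot r hr.fst_apply o' (dartMap φ d)) ∨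
    (∀ d, dartMap φ (twistRot r hr.fst_apply o d)
      = twistRot r hr.fst_apply o' (twistRot r hr.fst_apply o' (dartMap φ d))) := by
  have h1 := fun d => hr.twistRot_apply o d
  have h2 : ∀ d, twistRot r hr.fst_apply o' (dartMap φ d)
      = if o d.fst = 1 then r (dartMap φ d) else r (r (dartMap φ d)) := fun d => by
    rw [hr.twistRot_apply, dartMap_fst, ho]
  rcases hφ with hφ | hφ
  · left
    intro d
    rw [h1, h2]
    split_ifs
    · exact hφ d
    · rw [hφ, hφ]
  · right
    intro d
    rw [h1, h2]
    split_ifs with h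
    · rw [hr.twistRot_apply, hr.fst_apply, dartMap_fst, ho, if_pos h, hφ]
    · rw [hr.twistRot_apply, hr.fst_apply, hr.fst_apply, dartMap_fst, ho, if_neg h, hφ, hφ]

/-- A permutation of the darts that realizes an automorphism and maps facial walks to facial
walks, reversing their direction if necessary. -/
theorem exists_conj (hρ' : IsCubicRotation ρ') {φ : G ≃g G}
    (hφ : (∀ d, dartMap φ (ρ d) = ρ' (dartMap φ d)) ∨
      (∀ d, dartMap φ (ρ d) = ρ' (ρ' (dartMap φ d)))) :
    ∃ g : Equiv.Perm G.Dart, (∀ d, (g d).edge = Sym2.map φ d.edge) ∧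
      (∀ d, g d.symm = (g d).symm) ∧
      ∀ d d', (facePerm ρ').SameCycle (g d) (g d') ↔ (facePerm ρ).SameCycle d d' := by
  rcases hφ with hφ | hφ
  · refine ⟨dartMap φ, fun _ => rfl, fun _ => rfl, fun d d' => ?_⟩
    have : facePerm ρ' = dartMap φ * facePerm ρ * (dartMap φ)⁻¹ := by
      rw [eq_mul_inv_iff_mul_eq]
      ext1 x
      rw [Equiv.Perm.mul_apply, Equiv.Perm.mul_apply, facePerm_apply, facePerm_apply, hφ,
        dartMap_symm]
    rw [this, Equiv.Perm.sameCycle_conj, perm_inv_apply, perm_inv_apply]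
  · set g : Equiv.Perm G.Dart := (dartMap φ).trans Dart.symm_involutive.toPerm with hg
    have hga : ∀ d, g d = (dartMap φ d).symm := fun _ => rfl
    refine ⟨g, fun d => Dart.edge_symm _, fun _ => rfl, fun d d' => ?_⟩
    have : facePerm ρ' = g * (facePerm ρ)⁻¹ * g⁻¹ := by
      rw [eq_mul_inv_iff_mul_eq, eq_mul_inv_iff_mul_eq]
      ext1 x
      rw [Equiv.Perm.mul_apply, Equiv.Perm.mul_apply, facePerm_apply, facePerm_apply, hga, hga,
        Dart.symm_symm, hφ, hρ'.cube, dartMap_symm]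
    rw [this, Equiv.Perm.sameCycle_conj, perm_inv_apply, perm_inv_apply,
      Equiv.Perm.sameCycle_inv]

theorem image_orbitEdges {ψ ψ' g : Equiv.Perm G.Dart} {φ : G ≃g G}
    (hg : ∀ d, (g d).edge = Sym2.map φ d.edge)
    (hs : ∀ d d', ψ'.SameCycle (g d) (g d') ↔ ψ.SameCycle d d') (d : G.Dart) :
    Sym2.map φ '' orbitEdges ψ d = orbitEdges ψ' (g d) := by
  ext e
  constructor
  · rintro ⟨_, ⟨x, hx, rfl⟩, rfl⟩
    exact ⟨g x, (hs _ _).2 hx, hg x⟩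
  · rintro ⟨x, hx, rfl⟩
    obtain ⟨y, rfl⟩ := g.surjective x
    exact ⟨y.edge, ⟨y, (hs _ _).1 hx, rfl⟩, (hg y).symm⟩

theorem image_range_orbitEdges {ψ ψ' g : Equiv.Perm G.Dart} {φ : G ≃g G}
    (hg : ∀ d, (g d).edge = Sym2.map φ d.edge)
    (hs : ∀ d d', ψ'.SameCycle (g d) (g d') ↔ ψ.SameCycle d d') :
    (fun C => Sym2.map φ '' C) '' Set.range (orbitEdges ψ) = Set.range (orbitEdges ψ') := by
  rw [← Set.range_comp, ← g.surjective.range_comp (orbitEdges ψ')]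
  exact congrArg Set.range (funext fun d => image_orbitEdges hg hs d)

theorem units_mul_eq_one_iff (s t : ℤˣ) : s * t = 1 ↔ s = t := by
  rw [mul_eq_one_iff_eq_inv, Int.units_inv_eq_self]

theorem regionSign_eq_iff {Φ : Type*} {F : G.Dart → Φ} {S S' : Set Φ} {u v : V} :
    regionSign F S u = regionSign F S' v ↔ (u ∈ region F S ↔ v ∈ region F S') := by
  rw [regionSign, regionSign]
  have : (-1 : ℤˣ) ≠ 1 := by decide
  by_cases hu : u ∈ region F S <;> by_cases hv : v ∈ region F S' <;> simp [hu, hv, this, this.symm]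

/-- A vertex set with prescribed coboundary is determined up to complementation. -/
theorem forall_mem_iff_or (hG : G.Connected) {R R' : Set V} (φ : V → V)
    (h : ∀ d : G.Dart, (d.fst ∈ R ↔ d.snd ∈ R) ↔ (φ d.fst ∈ R' ↔ φ d.snd ∈ R')) :
    (∀ v, φ v ∈ R' ↔ v ∈ R) ∨ (∀ v, φ v ∈ R' ↔ v ∉ R) := by
  have key := eq_of_forall_dart hG (fun v => (φ v ∈ R' ↔ v ∈ R)) (fun d => by
    have := h d
    exact propext (by tauto))
  by_cases hv : ∃ v, (φ v ∈ R' ↔ v ∈ R)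
  · obtain ⟨v, hv⟩ := hv
    left
    intro w
    have := key v w
    exact this ▸ hv
  · right
    intro v
    have := fun h => hv ⟨v, h⟩
    tauto

end Transport

/-! ### Two faces that partition the vertices -/

section Opposite

variable {V : Type*} {G : SimpleGraph V} {Φ : Type*}
variable {r : Equiv.Perm G.Dart} {F : G.Dart → Φ} {f f' : Φ} {S S' : Set Φ} {d₀ d₀' : G.Dart}

theorem IsCubicRotation.facePerm_ne (hr : IsCubicRotation r) (d : G.Dart) : facePerm r d ≠ d := by
  intro e
  have := congrArg (fun x : G.Dart => x.fst) e
  exact d.adj.ne (this.symm.trans (hr.facePerm_fst d))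

/-- Faces have no chords, so otherwise every edge of `F d` would border `f`, although two different
faces share at most one edge. -/
theorem IsPolyhedral.eq_of_faceVerts_subset (h : IsPolyhedral r F) {d : G.Dart}
    (hsub : faceVerts F (F d) ⊆ faceVerts F f) : F d = f := by
  by_contra hne
  have key : ∀ x, F x = F d → F x.symm = f := by
    intro x hx
    refine (h.eq_or_eq_of_mem (hsub ?_) (hsub ?_)).resolve_left (fun e => hne (hx.symm.trans e))
    · rw [← hx]; exact fst_mem_faceVerts x
    · rw [← hx]; exact h.snd_mem_faceVerts x
  have hφ := h.apply_facePerm d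
  exact h.rot.facePerm_ne d (h.inj _ _ hφ ((key _ hφ).trans (key d rfl).symm))

/-- The dart leaving the face `f` at the start of a dart of `f`. -/
theorem IsPolyhedral.rot_snd_notMem (h : IsPolyhedral r F) {d : G.Dart} (hd : F d = f) :
    (r d).snd ∉ faceVerts F f := by
  intro h2
  subst hd
  have h1 : (r d).fst ∈ faceVerts F (F d) := by rw [h.rot.fst_apply]; exact fst_mem_faceVerts d
  rcases h.eq_or_eq_of_mem h1 h2 with e | e
  · rw [h.apply_rot] at e
    exact h.symm_ne d e.symm
  · rw [← h.apply_rot] at e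
    exact h.rot.apply_apply_ne d (h.eq_of_fst_eq e (by rw [h.rot.fst_apply, h.rot.fst_apply]))

/-- Each vertex is on one of the two faces. Two of its edges follow that face, and the third leaves
the vertices of the face since faces have no chords. -/
theorem IsPolyhedral.existsUnique_crossing (h : IsPolyhedral r F)
    (hc : ∀ v, v ∈ faceVerts F f' ↔ v ∉ faceVerts F f) (v : V) :
    ∃ d : G.Dart, (d.fst = v ∧ (d.fst ∈ faceVerts F f ↔ d.snd ∉ faceVerts F f)) ∧
      ∀ x : G.Dart, x.fst = v → (x.fst ∈ faceVerts F f ↔ x.snd ∉ faceVerts F f) → x = d := by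
  have key : ∀ f, v ∈ faceVerts F f → ∃ d : G.Dart, d.fst = v ∧ d.snd ∉ faceVerts F f ∧
      ∀ x : G.Dart, x.fst = v → x.snd ∉ faceVerts F f → x = d := by
    rintro f ⟨a, ha, rfl⟩
    refine ⟨r a, h.rot.fst_apply a, h.rot_snd_notMem ha, fun x hx hx' => ?_⟩
    rcases h.rot.cases a x hx with rfl | rfl | rfl
    · exact absurd (ha ▸ h.snd_mem_faceVerts x) hx'
    · rfl
    · refine absurd ?_ hx'
      have := fst_mem_faceVerts (F := F) (r (r a)).symm
      rwa [h.apply_rot_rot_symm, ha] at this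
  by_cases hv : v ∈ faceVerts F f
  · obtain ⟨d, h1, h2, h3⟩ := key f hv
    refine ⟨d, ⟨h1, by rw [h1]; tauto⟩, fun x hx hx' => h3 x hx (hx'.1 (by rwa [hx]))⟩
  · obtain ⟨d, h1, h2, h3⟩ := key f' ((hc v).2 hv)
    rw [hc, not_not] at h2
    refine ⟨d, ⟨h1, by rw [h1]; tauto⟩, fun x hx hx' => h3 x hx ?_⟩
    rw [hc, not_not]
    rw [hx] at hx'
    tauto

/-- If the vertices of `f` and `f'` partition the vertex set, then exchanging the ends of the edges
between them is an automorphism that exchanges the two faces. -/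
theorem IsPolyhedral.exists_swap (h : IsPolyhedral r F)
    (hc : ∀ v, v ∈ faceVerts F f' ↔ v ∉ faceVerts F f) :
    ∃ σ : G ≃g G, Sym2.map σ '' {e | ∃ d, F d = f ∧ d.edge = e} = {e | ∃ d, F d = f' ∧ d.edge = e}
    := by
  choose c hc1 hc2 using h.existsUnique_crossing hc
  have hcs : ∀ v, c (c v).snd = (c v).symm := fun v => by
    refine (hc2 _ (c v).symm rfl ?_).symm
    have := (hc1 v).2
    change (c v).snd ∈ _ ↔ (c v).fst ∉ _
    tauto
  have hinv : ∀ v, (c (c v).snd).snd = v := fun v => by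
    rw [hcs]; exact (hc1 v).1
  have hc' : ∀ v, v ∈ faceVerts F f ↔ v ∉ faceVerts F f' := fun v => by rw [hc, not_not]
  have aux : ∀ f f', (∀ v, v ∈ faceVerts F f' ↔ v ∉ faceVerts F f) →
      (∀ x : G.Dart, x.fst ∈ faceVerts F f → x.snd ∉ faceVerts F f → x = c x.fst) →
      ∀ d, F d = f → ∃ e : G.Dart, F e = f' ∧ e.fst = (c d.snd).snd ∧ e.snd = (c d.fst).snd := by
    intro f f' hc hcr d hd
    have hφ : F (facePerm r d) = f := by rw [h.apply_facePerm, hd]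
    have n1 := h.rot_snd_notMem hd
    have n2 := h.rot_snd_notMem hφ
    have m1 : (r d).fst ∈ faceVerts F f := by
      rw [h.rot.fst_apply, ← hd]; exact fst_mem_faceVerts d
    have m2 : (r (facePerm r d)).fst ∈ faceVerts F f := by
      rw [h.rot.fst_apply, ← hφ]; exact fst_mem_faceVerts _
    have c1 := hcr _ m1 n1
    have c2 := hcr _ m2 n2
    rw [h.rot.fst_apply] at c1 c2
    rw [h.rot.facePerm_fst] at c2
    obtain ⟨a, ha, ha', hra⟩ := h.exists_rot_eq (S := {f'}) (d := (r d).symm)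
      (by rw [region_singleton, hc]; exact n1) (by rw [region_singleton, hc, not_not]; exact m1)
    obtain ⟨b, hb, hb', hrb⟩ := h.exists_rot_eq (S := {f'}) (d := (r (facePerm r d)).symm)
      (by rw [region_singleton, hc]; exact n2) (by rw [region_singleton, hc, not_not]; exact m2)
    rw [Set.mem_singleton_iff] at ha ha' hb hb'
    -- The face across `d` also borders `f'` at the far ends of both crossing edges. It shares only
    -- one edge with `f'`, so these ends are joined by that edge.
    have e1 : r (r a) = b.symm := by
      refine h.inj _ _ ?_ ?_
      · rw [h.apply_rot_rot, ← hra, Dart.symm_symm, h.apply_rot, ← h.apply_rot b, ← hrb,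
          facePerm_apply, h.apply_rot_rot_symm]
      · rw [ha', Dart.symm_symm, hb]
    refine ⟨b, hb, ?_, ?_⟩
    · rw [← h.rot.fst_apply b, ← hrb, c2]
      rfl
    · change b.symm.fst = _
      rw [← e1, h.rot.fst_apply, ← hra, c1]
      rfl
  have aux1 := aux f f' hc fun x h1 h2 => hc2 _ x rfl (by tauto)
  have aux2 := aux f' f hc' fun x h1 h2 => hc2 _ x rfl (by
    rw [hc] at h1 h2
    tauto)
  have hadj : ∀ d : G.Dart, G.Adj (c d.fst).snd (c d.snd).snd := by
    intro d
    by_cases hX : d.fst ∈ faceVerts F f ↔ d.snd ∉ faceVerts F f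
    · have e : d = c d.fst := hc2 _ d rfl hX
      have e' : (c d.snd).snd = d.fst := by
        rw [e, hcs, ← e]; rfl
      rw [e', ← e]
      exact d.adj.symm
    · have hfin : ∀ f, d.fst ∈ faceVerts F f → d.snd ∈ faceVerts F f →
          (∀ d, F d = f → ∃ e : G.Dart, e.fst = (c d.snd).snd ∧ e.snd = (c d.fst).snd) →
          G.Adj (c d.fst).snd (c d.snd).snd := by
        intro f h1 h2 hE
        rcases h.eq_or_eq_of_mem h1 h2 with e | e
        · obtain ⟨x, hx1, hx2⟩ := hE d e
          rw [← hx1, ← hx2]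
          exact x.adj.symm
        · obtain ⟨x, hx1, hx2⟩ := hE d.symm e
          have hx1 : x.fst = (c d.fst).snd := hx1
          have hx2 : x.snd = (c d.snd).snd := hx2
          rw [← hx1, ← hx2]
          exact x.adj
      by_cases h1 : d.fst ∈ faceVerts F f
      · refine hfin f h1 (by tauto) fun d hd => ?_
        obtain ⟨x, -, hx⟩ := aux1 d hd
        exact ⟨x, hx⟩
      · refine hfin f' ((hc _).2 h1) ((hc _).2 (by tauto)) fun d hd => ?_
        obtain ⟨x, -, hx⟩ := aux2 d hd
        exact ⟨x, hx⟩
  set σ : G ≃g G := ⟨⟨fun v => (c v).snd, fun v => (c v).snd, hinv, hinv⟩, fun {u v} => ⟨fun e => by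
    have := hadj ⟨(_, _), e⟩
    change G.Adj (c (c u).snd).snd (c (c v).snd).snd at this
    rwa [hinv, hinv] at this, fun e => hadj ⟨(u, v), e⟩⟩⟩ with hσ
  have hσa : ∀ v, σ v = (c v).snd := fun _ => rfl
  have hedge : ∀ d e : G.Dart, e.fst = (c d.snd).snd → e.snd = (c d.fst).snd →
      e.edge = Sym2.map σ d.edge := by
    intro d e h1 h2
    change s(e.fst, e.snd) = s(σ d.fst, σ d.snd)
    rw [h1, h2, hσa, hσa, Sym2.eq_swap]
  refine ⟨σ, ?_⟩
  ext x
  constructor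
  · rintro ⟨_, ⟨d, hd, rfl⟩, rfl⟩
    obtain ⟨e, he, h1, h2⟩ := aux1 d hd
    exact ⟨e, he, hedge d e h1 h2⟩
  · rintro ⟨d, hd, rfl⟩
    obtain ⟨e, he, h1, h2⟩ := aux2 d hd
    refine ⟨e.edge, ⟨e, he, rfl⟩, (hedge e d ?_ ?_).symm⟩
    · rw [h2, hinv]
    · rw [h1, hinv]

end Opposite

/-! ### Regions of pairs determine the pairs and are never complementary -/

section PairTransport

variable {V : Type*} {G : SimpleGraph V} {Φ : Type*}
variable {r : Equiv.Perm G.Dart} {F : G.Dart → Φ} {f f' : Φ} {S S' : Set Φ} {d₀ d₀' : G.Dart}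

theorem IsPolyhedral.minimalPeriod_eq_ncard [Finite G.Dart] (h : IsPolyhedral r F) (d : G.Dart) :
    Function.minimalPeriod (facePerm r) d = {x | F x = F d}.ncard := by
  rw [← h.ncard_image_face, Set.InjOn.ncard_image]
  intro x hx y hy hxy
  exact h.inj x y (Eq.trans hx (Eq.symm hy)) hxy

theorem IsPolyhedral.minimalPeriod_map [Finite G.Dart] (h : IsPolyhedral r F)
    {g : Equiv.Perm G.Dart} (hs : ∀ d d', F (g d) = F (g d') ↔ F d = F d') (d : G.Dart) :
    Function.minimalPeriod (facePerm r) (g d) = Function.minimalPeriod (facePerm r) d := by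
  rw [h.minimalPeriod_eq_ncard, h.minimalPeriod_eq_ncard,
    ← Set.InjOn.ncard_image (s := {x | F x = F d}) g.injective.injOn]
  congr 1
  ext x
  obtain ⟨y, rfl⟩ := g.surjective x
  rw [g.injective.mem_set_image]
  exact hs y d

namespace IsOddPair

theorem map [Finite G.Dart] (h : IsOddPair r F S d₀)
    {g : Equiv.Perm G.Dart} (hsymm : ∀ d, g d.symm = (g d).symm)
    (hs : ∀ d d', F (g d) = F (g d') ↔ F d = F d') :
    IsOddPair r F {F (g d₀), F (g d₀.symm)} (g d₀) where
  toIsTriangleFree := h.toIsTriangleFree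
  chord := h.chord
  eq_pair := by rw [hsymm]
  five_le := by rw [h.minimalPeriod_map hs]; exact h.five_le
  five_le_symm := by rw [← hsymm, h.minimalPeriod_map hs]; exact h.five_le_symm
  odd := by rw [h.minimalPeriod_map hs]; exact h.odd
  odd_symm := by rw [← hsymm, h.minimalPeriod_map hs]; exact h.odd_symm

/-- A face whose vertices are in the region of the pair belongs to the pair. -/
theorem mem_of_faceVerts_subset (h : IsOddPair r F S d₀) {d : G.Dart}
    (hd : 3 ≤ Function.minimalPeriod (facePerm r) d) (hsub : faceVerts F (F d) ⊆ region F S) :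
    F d ∈ S := by
  by_contra hne
  have key : ∀ x, F x = F d → F x.symm = F d₀ ∨ F x.symm = F d₀.symm := by
    intro x hx
    rw [← h.mem_iff]
    refine (h.isDisk.inner x (hsub ?_) (hsub ?_)).resolve_left (fun e => hne (hx ▸ e))
    · rw [← hx]; exact fst_mem_faceVerts x
    · rw [← hx]; exact h.snd_mem_faceVerts x
  have h1 : F (facePerm r d) = F d := h.apply_facePerm d
  have h2 : F (facePerm r (facePerm r d)) = F d := by rw [h.apply_facePerm, h1]
  have n1 := h.rot.facePerm_ne d
  have n2 := h.rot.facePerm_ne (facePerm r d)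
  have n3 : facePerm r (facePerm r d) ≠ d :=
    pow_ne_of_lt (φ := facePerm r) (x := d) (i := 2) (by omega) (by omega)
  have i1 := fun e => n1 (h.inj _ _ h1 e)
  have i2 := fun e => n2 (h.inj _ _ (h2.trans h1.symm) e)
  have i3 := fun e => n3 (h.inj _ _ h2 e)
  -- Three different edges of one face would border only two faces, so two of them would have the
  -- same face behind them.
  rcases key d rfl with e1 | e1 <;> rcases key _ h1 with e2 | e2 <;> rcases key _ h2 with e3 | e3
  · exact i1 (e2.trans e1.symm)
  · exact i1 (e2.trans e1.symm)
  · exact i3 (e3.trans e1.symm)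
  · exact i2 (e3.trans e2.symm)
  · exact i2 (e3.trans e2.symm)
  · exact i3 (e3.trans e1.symm)
  · exact i1 (e2.trans e1.symm)
  · exact i1 (e2.trans e1.symm)

/-- If the regions of two pairs are complementary, then faces next to one of the pairs away from
its common edge are neighbours of both faces of the other pair. -/
theorem eq_or_eq_of_compl [Finite G.Dart] (h : IsOddPair r F S d₀) (h' : IsOddPair r F S' d₀')
    (hc : ∀ v, v ∈ region F S' ↔ v ∉ region F S) {c : G.Dart} (hF : F c = F d₀)
    (n0 : c ≠ d₀) (n1 : facePerm r c ≠ d₀) (n2 : facePerm r (facePerm r c) ≠ d₀) :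
    F (facePerm r c).symm = F (facePerm r d₀').symm ∨
      F (facePerm r c).symm = F ((facePerm r).symm d₀').symm := by
  have hFx : F (facePerm r c) = F d₀ := by rw [h.apply_facePerm, hF]
  have hFy : F (facePerm r (facePerm r c)) = F d₀ := by rw [h.apply_facePerm, hFx]
  have hcS := h.symm_notMem hF n0
  have hxS := h.symm_notMem hFx n1
  have hyS := h.symm_notMem hFy n2
  have hc5 : 5 ≤ Function.minimalPeriod (facePerm r) c := by
    rw [h.minimalPeriod_eq_ncard, hF, ← h.minimalPeriod_eq_ncard]; exact h.five_le
  set x := facePerm r c with hx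
  have hrx : F (r x) = F x.symm := h.apply_rot x
  have hrxs : F (r x).symm = F c.symm := by
    rw [← h.apply_rot_rot, hx, facePerm_apply, h.rot.cube]
  have hz : F (r (r x.symm)).symm = F x.symm := h.apply_rot_rot_symm _
  have hzs : F (r (r x.symm)) = F (facePerm r x).symm := by
    rw [h.apply_rot_rot, facePerm_apply]
  have m1 : (r x).fst ∈ region F S := by
    rw [h.rot.fst_apply]; exact fst_mem_region (h.mem_of_eq hFx)
  have m2 : (r (r x.symm)).fst ∈ region F S := by
    rw [h.rot.fst_apply, h.rot.fst_apply]; exact h.snd_mem_region (h.mem_of_eq hFx)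
  have k1 : (r x).snd ∉ region F S := by
    intro e
    rcases h.isDisk.inner _ m1 e with e | e
    · exact hxS (hrx ▸ e)
    · exact hcS (hrxs ▸ e)
  have k2 : (r (r x.symm)).snd ∉ region F S := by
    intro e
    rcases h.isDisk.inner _ m2 e with e | e
    · exact hyS (hzs ▸ e)
    · exact hxS (hz ▸ e)
  obtain ⟨a, ha, ha', hra⟩ := h.exists_rot_eq (S := S') (d := (r x).symm)
    ((hc _).2 k1) (fun e => (hc _).1 e m1)
  obtain ⟨b, hb, hb', hrb⟩ := h.exists_rot_eq (S := S') (d := (r (r x.symm)).symm)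
    ((hc _).2 k2) (fun e => (hc _).1 e m2)
  have hu : F (r (r a)) = F x.symm := by
    rw [h.apply_rot_rot, ← hra, Dart.symm_symm, hrx]
  have hw : F b.symm = F x.symm := by rw [← h.apply_rot, ← hrb, hz]
  -- Both edges that leave the region at the ends of `x` run along the rim face behind `x` and end
  -- at vertices of `S'`. If one edge of that rim face joins their far ends, it is a quadrangle and
  -- its four neighbours form a dual 4-cycle. One possible chord makes `c` and `facePerm r x`
  -- consecutive on their face, the other makes a face of `S` border a face of `S'`. Both are
  -- impossible.
  by_cases huw : r (r a) = b.symm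
  · exfalso
    have hab : F a = F b := by rw [← h.apply_rot_rot_symm, huw, Dart.symm_symm]
    have hSS : F x ≠ F b := fun e =>
      (hc _).1 (fst_mem_region (by rw [e]; exact hb)) (fst_mem_region (h.mem_of_eq hFx))
    have n3 : facePerm r x ≠ c :=
      pow_ne_of_lt (φ := facePerm r) (x := c) (i := 2) (by omega) (by omega)
    have n4 : facePerm r (facePerm r x) ≠ c :=
      pow_ne_of_lt (φ := facePerm r) (x := c) (i := 3) (by omega) (by omega)
    have hcy : F c = F (facePerm r x) := by rw [hF, hFy]
    obtain ⟨e, ⟨e1, e2⟩ | ⟨e1, e2⟩⟩ := h.chord c.symm (facePerm r x) (r (r b)) a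
      (by rw [Dart.symm_symm, hcy])
      (by rw [h.apply_rot_rot, ← hrb, Dart.symm_symm, hzs])
      (by rw [h.apply_rot_rot_symm, hab])
      (by rw [← h.apply_rot a, ← hra, hrxs])
      (by
        rw [h.apply_rot_rot, ← hrb, Dart.symm_symm, hzs]
        exact fun e => n3 (h.inj _ _ hcy e).symm)
      (by rw [hFy, ← hFx, hab]; exact hSS)
    · rw [h.apply_rot_rot, ← hrb, Dart.symm_symm, hzs] at e2
      rcases h.eq_facePerm hcy n3.symm e1 e2 with e | e
      · exact h.rot.facePerm_ne x (e.trans hx.symm)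
      · exact n4 e.symm
    · have t1 : e.fst ∈ region F S := fst_mem_region (by rw [e1, hFy]; exact h.mem)
      have t2 : e.fst ∈ region F S' := h.snd_mem_region (d := e.symm) (by rw [e2]; exact ha)
      exact (hc _).1 t2 t1
  · have hne : F (r (r a)).symm ≠ F b := by
      intro e
      exact huw (h.inj _ _ (hu.trans hw.symm) (by rw [Dart.symm_symm, e]))
    -- Otherwise the rim face borders both faces of the other pair, so it is at an end of their
    -- common edge.
    have fin : ∀ y y' : G.Dart, F y = F d₀' → F y' = F d₀'.symm → F y.symm = F x.symm →
        F y'.symm = F x.symm → F x.symm = F (facePerm r d₀').symm ∨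
          F x.symm = F ((facePerm r).symm d₀').symm := by
      intro y y' h1 h2 h3 h4
      rcases h'.near_iff h1 h2 (h3.trans h4.symm) with ⟨e, -⟩ | ⟨e, -⟩
      · right
        rw [← e, Equiv.symm_apply_apply, h3]
      · left
        rw [← e, h3]
    rcases (h'.mem_iff _).1 ha' with e | e <;> rcases (h'.mem_iff _).1 hb with e' | e'
    · exact absurd (e.trans e'.symm) hne
    · exact fin _ _ e e' (by rw [Dart.symm_symm, hu]) hw
    · exact fin _ _ e' e hw (by rw [Dart.symm_symm, hu])
    · exact absurd (e.trans e'.symm) hne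

/-- The regions of two pairs are not complementary. -/
theorem not_compl [Finite G.Dart] (h : IsOddPair r F S d₀) (h' : IsOddPair r F S' d₀') :
    ¬ ∀ v, v ∈ region F S' ↔ v ∉ region F S := by
  intro hc
  have p5 := h.five_le
  have q5 := h.five_le_symm
  have hp : ∀ i : ℕ, 0 < i → i < 5 → ((facePerm r) ^ i) d₀ ≠ d₀ := fun i h1 h2 =>
    pow_ne_of_lt h1 (by omega)
  have hq : ∀ i : ℕ, 0 < i → i < 5 → ((facePerm r) ^ i) d₀.symm ≠ d₀.symm := fun i h1 h2 =>
    pow_ne_of_lt h1 (by omega)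
  have a1 : facePerm r d₀ ≠ d₀ := hp 1 (by omega) (by omega)
  have a2 : facePerm r (facePerm r d₀) ≠ d₀ := hp 2 (by omega) (by omega)
  have a3 : facePerm r (facePerm r (facePerm r d₀)) ≠ d₀ := hp 3 (by omega) (by omega)
  have a4 : facePerm r (facePerm r (facePerm r (facePerm r d₀))) ≠ d₀ := hp 4 (by omega) (by omega)
  have b1 : facePerm r d₀.symm ≠ d₀.symm := hq 1 (by omega) (by omega)
  have b2 : facePerm r (facePerm r d₀.symm) ≠ d₀.symm := hq 2 (by omega) (by omega)
  have b3 : facePerm r (facePerm r (facePerm r d₀.symm)) ≠ d₀.symm := hq 3 (by omega) (by omega)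
  have f1 : F (facePerm r d₀) = F d₀ := h.apply_facePerm _
  have f2 : F (facePerm r (facePerm r d₀)) = F d₀ := by rw [h.apply_facePerm, f1]
  have f3 : F (facePerm r (facePerm r (facePerm r d₀))) = F d₀ := by rw [h.apply_facePerm, f2]
  have g1 : F (facePerm r d₀.symm) = F d₀.symm := h.apply_facePerm _
  have g2 : F (facePerm r (facePerm r d₀.symm)) = F d₀.symm := by rw [h.apply_facePerm, g1]
  -- Length at least five leaves room for three different rim faces away from the ends of `d₀`: two
  -- next to the first face and one next to the second. Each would be one of the two faces at the
  -- ends of `d₀'`.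
  have c1 := h.eq_or_eq_of_compl h' hc f1 a1 a2 a3
  have c2 := h.eq_or_eq_of_compl h' hc f2 a2 a3 a4
  have c3 := h.swap.eq_or_eq_of_compl h' hc g1 b1 b2 b3
  have n12 : F (facePerm r (facePerm r (facePerm r d₀))).symm
      ≠ F (facePerm r (facePerm r d₀)).symm :=
    fun e => h.rot.facePerm_ne _ (h.inj _ _ (f3.trans f2.symm) e)
  have n13 : F (facePerm r (facePerm r d₀)).symm ≠ F (facePerm r (facePerm r d₀.symm)).symm := by
    intro e
    rcases h.near f2 g2 e with e | e
    · exact a3 e.symm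
    · exact a1 ((facePerm r).injective e)
  have n23 : F (facePerm r (facePerm r (facePerm r d₀))).symm
      ≠ F (facePerm r (facePerm r d₀.symm)).symm := by
    intro e
    rcases h.near f3 g2 e with e | e
    · exact a4 e.symm
    · exact a2 ((facePerm r).injective e)
  grind

end IsOddPair

end PairTransport

/-! ### Isomorphism of induced embeddings and orbits of faces -/

section Orbits

variable {V : Type*} [Fintype V] {G : SimpleGraph V} {P : SurfaceEmbedding G}

theorem edges_dartFace (hP : ∀ e, P.sign e = 1) (d : G.Dart) :
    (dartFace P d).edges = orbitEdges (facePerm P.rot) d := by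
  ext e
  have := (isGauge_one hP).mem_edges_iff d e
  rwa [gaugePerm_one] at this

theorem mem_faceVerts_iff (hP : ∀ e, P.sign e = 1) (h : IsCubicMap P.rot (dartFace P)) (f : P.Face)
    (v : V) : v ∈ faceVerts (dartFace P) f ↔ ∃ e ∈ f.edges, v ∈ e := by
  constructor
  · rintro ⟨d, hd, rfl⟩
    exact ⟨d.edge, (mem_edges_iff hP _ _).2 ⟨d, hd, rfl⟩, Sym2.mem_mk_left _ _⟩
  · rintro ⟨e, he, hv⟩
    obtain ⟨d, rfl, rfl⟩ := (mem_edges_iff hP _ _).1 he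
    rcases Sym2.mem_iff.1 hv with rfl | rfl
    · exact fst_mem_faceVerts d
    · exact h.snd_mem_faceVerts d

theorem apply_mem_faceVerts_iff (hP : ∀ e, P.sign e = 1) (h : IsCubicMap P.rot (dartFace P))
    {φ : G ≃g G} {f f' : P.Face} (hφ : SurfaceEmbedding.MapsFace φ f f') (v : V) :
    φ v ∈ faceVerts (dartFace P) f' ↔ v ∈ faceVerts (dartFace P) f := by
  rw [mem_faceVerts_iff hP h, mem_faceVerts_iff hP h, ← hφ, Set.exists_mem_image]
  refine exists_congr fun e => and_congr_right fun _ => ?_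
  rw [Sym2.mem_map]
  constructor
  · rintro ⟨w, hw, hwv⟩
    rwa [← φ.injective hwv]
  · exact fun hv => ⟨v, hv, rfl⟩

variable [DecidableRel G.Adj]

/-- Automorphisms act on the darts along the faces of a spherical embedding. -/
theorem exists_mapsFace (hcubic : G.IsRegularOfDegree 3) (hP : ∀ e, P.sign e = 1)
    (hp : IsPolyhedral P.rot (dartFace P)) (hs : IsHomologySphere P.rot (dartFace P))
    (φ : G ≃g G) : ∃ g : Equiv.Perm G.Dart, (∀ d, g d.symm = (g d).symm) ∧
      (∀ d d', dartFace P (g d) = dartFace P (g d') ↔ dartFace P d = dartFace P d') ∧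
      ∀ d, SurfaceEmbedding.MapsFace φ (dartFace P d) (dartFace P (g d)) := by
  obtain ⟨g, h1, h2, h3⟩ := exists_conj hp.rot (dartMap_rot hcubic hp hs φ)
  refine ⟨g, h2, fun d d' => ?_, fun d => ?_⟩
  · rw [hp.face_iff, hp.face_iff, h3]
  · rw [SurfaceEmbedding.MapsFace, edges_dartFace hP, edges_dartFace hP, image_orbitEdges h1 h3]

theorem isomorphic_of_region (hcubic : G.IsRegularOfDegree 3) (hP : ∀ e, P.sign e = 1)
    (h : IsTriangleFree P.rot (dartFace P)) (hs : IsHomologySphere P.rot (dartFace P))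
    {S S' : Set P.Face} (hS : IsDisk (dartFace P) S) (hS' : IsDisk (dartFace P) S') {φ : G ≃g G}
    (hφ : ∀ v, φ v ∈ region (dartFace P) S' ↔ v ∈ region (dartFace P) S) :
    (P.reembed (P.link S)).Isomorphic (P.reembed (P.link S')) := by
  obtain ⟨g, h1, -, h3⟩ := exists_conj (h.rot.twistRot _) (dartMap_twistRot h.rot
    (dartMap_rot hcubic h.toIsPolyhedral hs φ) fun v => regionSign_eq_iff.2 (hφ v))
  refine ⟨φ, ?_⟩
  rw [(isGauge_reembed_link hP h hS).facialCycles_eq,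
    (isGauge_reembed_link hP h hS').facialCycles_eq]
  exact image_range_orbitEdges h1 h3

/-- The automorphism preserves twisted edges, that is, the cuts around the two regions. In a
connected graph a cut determines its sides up to exchange. -/
theorem exists_of_isomorphic (hcubic : G.IsRegularOfDegree 3) (hP : ∀ e, P.sign e = 1)
    (h : IsTriangleFree P.rot (dartFace P)) (hs : IsHomologySphere P.rot (dartFace P))
    {S S' : Set P.Face} (hS : IsDisk (dartFace P) S) (hS' : IsDisk (dartFace P) S')
    {κ κ' : P.Face → ZMod 2} (hκ : IsColouring (dartFace P) S κ)
    (hκ' : IsColouring (dartFace P) S' κ')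
    (hiso : (P.reembed (P.link S)).Isomorphic (P.reembed (P.link S'))) : ∃ φ : G ≃g G,
      (∀ v, φ v ∈ region (dartFace P) S' ↔ v ∈ region (dartFace P) S) ∨
      (∀ v, φ v ∈ region (dartFace P) S' ↔ v ∉ region (dartFace P) S) := by
  classical
  obtain ⟨φ, hφ⟩ := hiso
  rw [(isGauge_reembed_link hP h hS).facialCycles_eq,
    (isGauge_reembed_link hP h hS').facialCycles_eq] at hφ
  have key := sign_eq_iff_of_image_eq h.rot (hS.isTwoSided h.toIsPolyhedral hκ)
    (hS'.isTwoSided h.toIsPolyhedral hκ') (dartMap_rot hcubic h.toIsPolyhedral hs φ) hφ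
  refine ⟨φ, forall_mem_iff_or hs.connected φ fun d => ?_⟩
  have := key d
  rwa [units_mul_eq_one_iff, units_mul_eq_one_iff, regionSign_eq_iff, regionSign_eq_iff] at this

theorem isomorphic_singleton_iff (hcubic : G.IsRegularOfDegree 3) (hP : ∀ e, P.sign e = 1)
    (h : IsTriangleFree P.rot (dartFace P)) (hs : IsHomologySphere P.rot (dartFace P))
    {f f' : P.Face} (hf : Even f.length) (hf' : Even f'.length) :
    (P.reembed (P.link {f})).Isomorphic (P.reembed (P.link {f'})) ↔
      SurfaceEmbedding.SameOrbit f f' := by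
  classical
  have hp := h.toIsPolyhedral
  have hD := h.isDisk_singleton f
  have hD' := h.isDisk_singleton f'
  constructor
  · intro hiso
    obtain ⟨d, rfl⟩ := dartFace_surjective hP f
    obtain ⟨d', rfl⟩ := dartFace_surjective hP f'
    rw [length_dartFace hP] at hf hf'
    obtain ⟨⟨κ, hκ, -⟩, -⟩ := h.singleton d hf
    obtain ⟨⟨κ', hκ', -⟩, -⟩ := h.singleton d' hf'
    obtain ⟨φ, hφ⟩ := exists_of_isomorphic hcubic hP h hs hD hD' hκ hκ' hiso
    obtain ⟨g, -, -, hg⟩ := exists_mapsFace hcubic hP hp hs φ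
    have hgv := fun v => apply_mem_faceVerts_iff hP h.toIsCubicMap (hg d) v
    simp only [region_singleton] at hφ
    rcases hφ with hφ | hφ
    · have : dartFace P (g d) = dartFace P d' := by
        refine hp.eq_of_faceVerts_subset fun v hv => ?_
        obtain ⟨w, rfl⟩ := φ.surjective v
        rwa [hφ, ← hgv]
      exact ⟨φ, this ▸ hg d⟩
    -- The image of the first face and the second face partition the vertices. Composing with the
    -- exchange of the two corrects `φ`.
    · obtain ⟨σ, hσ⟩ := hp.exists_swap (f := dartFace P (g d)) (f' := dartFace P d') fun v => by
        obtain ⟨w, rfl⟩ := φ.surjective v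
        rw [hφ, hgv]
      have hσ' : SurfaceEmbedding.MapsFace σ (dartFace P (g d)) (dartFace P d') := by
        have e : ∀ f : P.Face, f.edges = {e | ∃ d, dartFace P d = f ∧ d.edge = e} := fun f =>
          Set.ext fun _ => mem_edges_iff hP f _
        rw [SurfaceEmbedding.MapsFace, e, e]
        exact hσ
      refine ⟨φ.trans σ, ?_⟩
      rw [SurfaceEmbedding.MapsFace, ← hσ', ← hg d, Set.image_image]
      refine Set.image_congr fun e _ => ?_
      rw [Sym2.map_map]
      rfl
  · rintro ⟨φ, hφ⟩
    refine isomorphic_of_region hcubic hP h hs hD hD' (φ := φ) fun v => ?_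
    rw [region_singleton, region_singleton]
    exact apply_mem_faceVerts_iff hP h.toIsCubicMap hφ v

theorem isomorphic_pair_iff (hcubic : G.IsRegularOfDegree 3) (hP : ∀ e, P.sign e = 1)
    (hs : IsHomologySphere P.rot (dartFace P)) {d d' : G.Dart}
    (h : IsOddPair P.rot (dartFace P) {dartFace P d, dartFace P d.symm} d)
    (h' : IsOddPair P.rot (dartFace P) {dartFace P d', dartFace P d'.symm} d') :
    (P.reembed (P.link {dartFace P d, dartFace P d.symm})).Isomorphic
      (P.reembed (P.link {dartFace P d', dartFace P d'.symm})) ↔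
      SurfaceEmbedding.SamePairOrbit (dartFace P d) (dartFace P d.symm) (dartFace P d')
        (dartFace P d'.symm) := by
  classical
  have hp := h.toIsPolyhedral
  constructor
  · intro hiso
    obtain ⟨κ, hκ, -⟩ := h.exists_colouring
    obtain ⟨κ', hκ', -⟩ := h'.exists_colouring
    obtain ⟨φ, hφ⟩ := exists_of_isomorphic hcubic hP h.toIsTriangleFree hs h.isDisk h'.isDisk
      hκ hκ' hiso
    obtain ⟨g, hsymm, hgF, hg⟩ := exists_mapsFace hcubic hP hp hs φ
    have hgv := fun d v => apply_mem_faceVerts_iff hP h.toIsCubicMap (hg d) v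
    have hmap := h.map hsymm hgF
    have hreg : ∀ v, φ v ∈ region (dartFace P) {dartFace P (g d), dartFace P (g d.symm)} ↔
        v ∈ region (dartFace P) {dartFace P d, dartFace P d.symm} := fun v => by
      rw [mem_region_pair, mem_region_pair, hgv, hgv]
    rcases hφ with hφ | hφ
    · have hmem : ∀ x, dartFace P (g x) ∈ ({dartFace P (g d), dartFace P (g d.symm)} : Set P.Face) →
          5 ≤ Function.minimalPeriod (facePerm P.rot) x →
          dartFace P (g x) = dartFace P d' ∨ dartFace P (g x) = dartFace P d'.symm := by
        intro x hx hx5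
        rw [← h'.mem_iff]
        refine h'.mem_of_faceVerts_subset ?_ fun v hv => ?_
        · rw [hp.minimalPeriod_map hgF]; omega
        · obtain ⟨w, rfl⟩ := φ.surjective v
          rw [hφ, ← hreg]
          exact ⟨_, hx, hv⟩
      have hne : dartFace P (g d) ≠ dartFace P (g d.symm) := by
        rw [hsymm]; exact hp.symm_ne _
      have h1 := hg d
      have h2 := hg d.symm
      refine ⟨φ, ?_⟩
      rcases hmem d (Or.inl rfl) h.five_le with e1 | e1 <;>
        rcases hmem d.symm (Or.inr rfl) h.five_le_symm with e2 | e2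
      · exact absurd (e1.trans e2.symm) hne
      · rw [e1] at h1
        rw [e2] at h2
        exact Or.inl ⟨h1, h2⟩
      · rw [e1] at h1
        rw [e2] at h2
        exact Or.inr ⟨h1, h2⟩
      · exact absurd (e1.trans e2.symm) hne
    · refine absurd (fun v => ?_) (hmap.not_compl h')
      obtain ⟨w, rfl⟩ := φ.surjective v
      rw [hφ, hreg]
  · rintro ⟨φ, hφ⟩
    refine isomorphic_of_region hcubic hP h.toIsTriangleFree hs h.isDisk h'.isDisk (φ := φ)
      fun v => ?_
    rw [mem_region_pair, mem_region_pair]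
    rcases hφ with ⟨h1, h2⟩ | ⟨h1, h2⟩
    · rw [apply_mem_faceVerts_iff hP h.toIsCubicMap h1,
        apply_mem_faceVerts_iff hP h.toIsCubicMap h2]
    · rw [apply_mem_faceVerts_iff hP h.toIsCubicMap h1,
        apply_mem_faceVerts_iff hP h.toIsCubicMap h2, or_comm]

/-- Neighbouring odd faces in a cyclically 5-edge connected cubic graph. -/
theorem exists_isOddPair (hcubic : G.IsRegularOfDegree 3) (hP : ∀ e, P.sign e = 1)
    (hs : IsHomologySphere P.rot (dartFace P)) (hcyc : G.IsCyclicallyEdgeConnected 5)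
    {f₁ f₂ : P.Face} {k m : ℕ} (hk : 2 ≤ k) (hm : 2 ≤ m) (hadj : P.dualGraph.Adj f₁ f₂)
    (h₁ : f₁.length = 2 * k + 1) (h₂ : f₂.length = 2 * m + 1) :
    ∃ d, dartFace P d = f₁ ∧ dartFace P d.symm = f₂ ∧
      IsOddPair P.rot (dartFace P) {dartFace P d, dartFace P d.symm} d := by
  have ht := hs.isTriangleFree hcubic (by norm_num) hcyc
  obtain ⟨d, rfl, rfl⟩ := (dualGraph_adj_iff hP ht.toIsPolyhedral _ _).1 hadj
  rw [length_dartFace hP] at h₁ h₂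
  exact ⟨d, rfl, rfl, { ht with
    chord := hs.exists_chord hcubic le_rfl hcyc
    eq_pair := rfl
    five_le := by omega
    five_le_symm := by omega
    odd := ⟨k, h₁⟩
    odd_symm := ⟨m, h₂⟩ }⟩

end Orbits

end CubicMap

/-! ### Assembly of the two statements -/

theorem mainTheorem9 {V : Type*} [Fintype V] (G : SimpleGraph V) [DecidableRel G.Adj]
    (hconn : G.IsKConnected 3) (hcubic : G.IsRegularOfDegree 3)
    (P : SurfaceEmbedding G) (hplanar : P.IsPlanar) :
    (G.IsCyclicallyEdgeConnected 4 →
      (∀ (f : P.Face) (k : ℕ), 2 ≤ k → f.length = 2 * k →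
        (P.reembed (P.link {f})).IsStrong ∧
        (P.reembed (P.link {f})).IsOnOrientableSurface (k - 1)) ∧
      (∀ (f f' : P.Face) (k k' : ℕ), 2 ≤ k → 2 ≤ k' →
        f.length = 2 * k → f'.length = 2 * k' →
        ((P.reembed (P.link {f})).Isomorphic (P.reembed (P.link {f'})) ↔
          SurfaceEmbedding.SameOrbit f f'))) ∧
    (G.IsCyclicallyEdgeConnected 5 →
      (∀ (f₁ f₂ : P.Face) (k m : ℕ), 2 ≤ k → 2 ≤ m → P.dualGraph.Adj f₁ f₂ →
        f₁.length = 2 * k + 1 → f₂.length = 2 * m + 1 →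
        (P.reembed (P.link {f₁, f₂})).IsStrong ∧
        (P.reembed (P.link {f₁, f₂})).IsOnOrientableSurface (k + m - 2)) ∧
      (∀ (f₁ f₂ f₁' f₂' : P.Face) (k m k' m' : ℕ), 2 ≤ k → 2 ≤ m → 2 ≤ k' → 2 ≤ m' →
        P.dualGraph.Adj f₁ f₂ → P.dualGraph.Adj f₁' f₂' →
        f₁.length = 2 * k + 1 → f₂.length = 2 * m + 1 →
        f₁'.length = 2 * k' + 1 → f₂'.length = 2 * m' + 1 →
        ((P.reembed (P.link {f₁, f₂})).Isomorphic (P.reembed (P.link {f₁', f₂'})) ↔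
          SurfaceEmbedding.SamePairOrbit f₁ f₂ f₁' f₂'))) := by
  classical
  have hs := CubicMap.isHomologySphere_dartFace
    (CubicMap.IsKConnected.connected (by norm_num) hconn) hcubic hplanar
  have hP := hplanar.1
  refine ⟨fun hcyc => ?_, fun hcyc => ?_⟩
  · have ht := hs.isTriangleFree hcubic le_rfl hcyc
    refine ⟨fun f k hk hf => ?_, fun f f' k k' _ _ hf hf' => ?_⟩
    · obtain ⟨d, rfl⟩ := CubicMap.dartFace_surjective hP f
      rw [CubicMap.length_dartFace hP] at hf
      obtain ⟨⟨κ, hκ, hl⟩, hex, hrim⟩ := ht.singleton d (hf ▸ even_two_mul k)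
      have hD := ht.isDisk_singleton (CubicMap.dartFace P d)
      exact ⟨CubicMap.isStrong_reembed_link hP ht hD hκ,
        CubicMap.isOnOrientableSurface_reembed_link hplanar ht hD hκ hl hex (by omega)⟩
    · exact CubicMap.isomorphic_singleton_iff hcubic hP ht hs (hf ▸ even_two_mul k)
        (hf' ▸ even_two_mul k')
  · refine ⟨fun f₁ f₂ k m hk hm hadj h₁ h₂ => ?_,
      fun f₁ f₂ f₁' f₂' k m k' m' hk hm hk' hm' hadj hadj' h₁ h₂ h₁' h₂' => ?_⟩
    · obtain ⟨d, rfl, rfl, h⟩ := CubicMap.exists_isOddPair hcubic hP hs hcyc hk hm hadj h₁ h₂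
      rw [CubicMap.length_dartFace hP] at h₁ h₂
      obtain ⟨κ, hκ, hl⟩ := h.exists_colouring
      have hrim := h.ncard_rim
      exact ⟨CubicMap.isStrong_reembed_link hP h.toIsTriangleFree h.isDisk hκ,
        CubicMap.isOnOrientableSurface_reembed_link hplanar h.toIsTriangleFree h.isDisk hκ hl
          h.exists_crossing (by omega)⟩
    · obtain ⟨d, rfl, rfl, h⟩ := CubicMap.exists_isOddPair hcubic hP hs hcyc hk hm hadj h₁ h₂
      obtain ⟨d', rfl, rfl, h'⟩ := CubicMap.exists_isOddPair hcubic hP hs hcyc hk' hm' hadj' h₁' h₂'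
      exact CubicMap.isomorphic_pair_iff hcubic hP hs h h'
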